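/- \textbf{Notation.} For $d\in\mathbf N$, $s\ge \frac12$ and $h>0$ let $\mathcal S_{s,h}(\mathbf R^d)$ be the space of all $f\in C^\infty(\mathbf R^d)$ such that $$\|f\|_{\mathcal S_{s,h}}=\sup_{\alpha,\beta\in\mathbf N^d,\,x\in\mathbf R^d}\frac{|x^\beta\partial^\alpha f(x)|}{h^{|\alpha|+|\beta|}(\alpha!\,\beta!)^s}<\infty .$$ Let $\mathcal S_s(\mathbf R^d)=\bigcup_{h>0}\mathcal S_{s,h}(\mathbf R^d)$ with the (locally convex) inductive limit topology and $\Sigma_s(\mathbf R^d)=\bigcap_{h>0}\mathcal S_{s,h}(\mathbf R^d)$ with the projective limit topology, let $\mathscr S(\mathbf R^d)$ be the Schwartz space, and let $\mathcal S_s'$, $\Sigma_s'$, $\mathscr S'$ be the topological duals with the strong topology. Test functions are embedded in the dual by $f\mapsto\big(g\mapsto\int f g\,dx\big)$. $\mathscr L(V_1,V_2)$ denotes the space of continuous linear maps from $V_1$ to $V_2$. For $a\in\mathscr S(\mathbf R^{2d})$, $f\in\mathscr S(\mathbf R^d)$ and $t\in[0,1]$ let $$(\operatorname{Op}_t(a)f)(x)=(2\pi)^{-d}\iint_{\mathbf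 R^{2d}} a((1-t)x+ty,\xi)f(y)e^{i\langle x-y,\xi\rangle}\,dy\,d\xi ,\qquad \operatorname{Op}_{\mathrm{BJ}}(a)f=\int_0^1\operatorname{Op}_t(a)f\,dt .$$ \textbf{Theorem.} Let $d\in\mathbf N$ and $s\ge\frac12$. Then the following is true: \begin{enumerate} \item if $a\in\mathcal S_s(\mathbf R^{2d})$, then $\operatorname{Op}_{\mathrm{BJ}}(a)$, as a map from $\mathcal S_s(\mathbf R^d)$ to $\mathcal S_s'(\mathbf R^d)$, extends uniquely to a continuous map from $\mathcal S_s'(\mathbf R^d)$ to $\mathcal S_s(\mathbf R^d)$, and this extension is linear; \item the map $a\mapsto\operatorname{Op}_{\mathrm{BJ}}(a)$ from $\mathcal S_s(\mathbf R^{2d})$ to $\mathscr L(\mathcal S_s(\mathbf R^d),\mathcal S_s'(\mathbf R^d))$ extends uniquely to a continuous map from $\mathcal S_s'(\mathbf R^{2d})$ to $\mathscr L(\mathcal S_s(\mathbf R^d),\mathcal S_s'(\mathbf R^d))$. The extension is linear and is continuous when $\mathscr L$ carries the topology of uniform convergence on bounded sets, and it is unique even among all maps $u\mapsto A_u$ for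 which $u\mapsto\langle A_uf,g\rangle$ is continuous for all $f,g\in\mathcal S_s(\mathbf R^d)$. \end{enumerate} The same holds if each $\mathcal S_s$ and $\mathcal S_s'$ is replaced by $\Sigma_s$ and $\Sigma_s'$, respectively, or by $\mathscr S$ and $\mathscr S'$. -/

import Mathlib

open MeasureTheory
open scoped ContDiff Nat SchwartzMap

noncomputable section

/-! ### Gelfand-Shilov seminorms -/

/-- The mixed partial derivative `∂^α f (x)` of `f : ℝ^ι → ℂ`, for a multi-index `α`: the derivative
of order `|α| = ∑ i, α i` applied to the list of directions that contains the `i`-th standard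
basis vector exactly `α i` times (the order of the list is irrelevant for smooth `f`). -/
def multiDeriv {ι : Type} [Fintype ι] (α : ι → ℕ) (f : EuclideanSpace ℝ ι → ℂ)
    (x : EuclideanSpace ℝ ι) : ℂ :=
  iteratedFDeriv ℝ (∑ i, α i) f x fun j =>
    EuclideanSpace.basisFun ι ℝ
      ((Fintype.equivFinOfCardEq (by simp) : (Σ i, Fin (α i)) ≃ Fin (∑ i, α i)).symm j).1

/-- The quotient `|x^β ∂^α f(x)| / (h^{|α|+|β|} (α! β!)^s)`. -/
def gsQuot {ι : Type} [Fintype ι] (s h : ℝ) (f : EuclideanSpace ℝ ι → ℂ)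
    (α β : ι → ℕ) (x : EuclideanSpace ℝ ι) : ℝ :=
  |∏ i, x i ^ β i| * ‖multiDeriv α f x‖ /
    (h ^ (∑ i, α i + ∑ i, β i) * (((∏ i, (α i)! : ℕ) : ℝ) * ((∏ i, (β i)! : ℕ) : ℝ)) ^ s)

/-- The norm `‖f‖_{𝒮_{s,h}}`, the supremum of `gsQuot s h f α β x` over all `α, β, x`
(used only for `f` in `𝒮_{s,h}`, where the supremum is finite). -/
def gsNorm {ι : Type} [Fintype ι] (s h : ℝ) (f : EuclideanSpace ℝ ι → ℂ) : ℝ :=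
  ⨆ q : (ι → ℕ) × (ι → ℕ) × EuclideanSpace ℝ ι, gsQuot s h f q.1 q.2.1 q.2.2

/-- Membership in `𝒮_{s,h}(ℝ^ι)`: `f` is smooth and `‖f‖_{𝒮_{s,h}} < ∞`. -/
def IsGS {ι : Type} [Fintype ι] (s h : ℝ) (f : EuclideanSpace ℝ ι → ℂ) : Prop :=
  ContDiff ℝ ∞ f ∧ ∃ C : ℝ, ∀ α β x, gsQuot s h f α β x ≤ C

section Basic

variable {ι : Type} [Fintype ι] {s h : ℝ} {f g : EuclideanSpace ℝ ι → ℂ}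

theorem multiDeriv_add (hf : ContDiff ℝ ∞ f) (hg : ContDiff ℝ ∞ g) (α : ι → ℕ)
    (x : EuclideanSpace ℝ ι) :
    multiDeriv α (f + g) x = multiDeriv α f x + multiDeriv α g x := by
  unfold multiDeriv
  rw [iteratedFDeriv_add_apply]
  · rfl
  · exact (hf.of_le (by exact_mod_cast le_top)).contDiffAt
  · exact (hg.of_le (by exact_mod_cast le_top)).contDiffAt

theorem multiDeriv_smul (hf : ContDiff ℝ ∞ f) (c : ℂ) (α : ι → ℕ) (x : EuclideanSpace ℝ ι) :
    multiDeriv α (c • f) x = c * multiDeriv α f x := by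
  unfold multiDeriv
  rw [iteratedFDeriv_const_smul_apply]
  · rfl
  · exact (hf.of_le (by exact_mod_cast le_top)).contDiffAt

theorem gsQuot_nonneg (hh : 0 < h) (α β : ι → ℕ) (x : EuclideanSpace ℝ ι) :
    0 ≤ gsQuot s h f α β x := by
  unfold gsQuot
  positivity

theorem gsQuot_add (hh : 0 < h) (hf : ContDiff ℝ ∞ f) (hg : ContDiff ℝ ∞ g) (α β : ι → ℕ)
    (x : EuclideanSpace ℝ ι) :
    gsQuot s h (f + g) α β x ≤ gsQuot s h f α β x + gsQuot s h g α β x := by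
  unfold gsQuot
  rw [multiDeriv_add hf hg, ← add_div, ← mul_add]
  gcongr
  exact norm_add_le _ _

theorem gsQuot_smul (hf : ContDiff ℝ ∞ f) (c : ℂ) (α β : ι → ℕ) (x : EuclideanSpace ℝ ι) :
    gsQuot s h (c • f) α β x = ‖c‖ * gsQuot s h f α β x := by
  unfold gsQuot
  rw [multiDeriv_smul hf, norm_mul]
  ring

theorem IsGS.bddAbove (hf : IsGS s h f) :
    BddAbove (Set.range fun q : (ι → ℕ) × (ι → ℕ) × EuclideanSpace ℝ ι =>
      gsQuot s h f q.1 q.2.1 q.2.2) := by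
  obtain ⟨_, C, hC⟩ := hf
  exact ⟨C, by rintro _ ⟨q, rfl⟩; exact hC _ _ _⟩

theorem IsGS.le_gsNorm (hf : IsGS s h f) (α β : ι → ℕ) (x : EuclideanSpace ℝ ι) :
    gsQuot s h f α β x ≤ gsNorm s h f :=
  le_ciSup hf.bddAbove (α, β, x)

theorem IsGS.add (hh : 0 < h) (hf : IsGS s h f) (hg : IsGS s h g) : IsGS s h (f + g) := by
  obtain ⟨hf, C, hC⟩ := hf
  obtain ⟨hg, D, hD⟩ := hg
  exact ⟨hf.add hg, C + D, fun α β x =>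
    (gsQuot_add hh hf hg α β x).trans (add_le_add (hC α β x) (hD α β x))⟩

theorem IsGS.smul (c : ℂ) (hf : IsGS s h f) : IsGS s h (c • f) := by
  obtain ⟨hf, C, hC⟩ := hf
  refine ⟨hf.const_smul c, ‖c‖ * C, fun α β x => ?_⟩
  rw [gsQuot_smul hf]
  gcongr
  exact hC α β x

theorem IsGS.zero : IsGS s h (0 : EuclideanSpace ℝ ι → ℂ) := by
  refine ⟨contDiff_const, 0, fun α β x => ?_⟩
  have : multiDeriv α (0 : EuclideanSpace ℝ ι → ℂ) x = 0 := by
    have := multiDeriv_smul (f := (0 : EuclideanSpace ℝ ι → ℂ)) contDiff_const 0 α x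
    simpa using this
  simp [gsQuot, this]

/-- `𝒮_{s,h}` increases with `h`. -/
theorem IsGS.mono {h' : ℝ} (hh : 0 < h) (hle : h ≤ h') (hf : IsGS s h f) : IsGS s h' f := by
  obtain ⟨hf, C, hC⟩ := hf
  refine ⟨hf, C, fun α β x => le_trans ?_ (hC α β x)⟩
  unfold gsQuot
  gcongr

theorem gsNorm_nonneg (hh : 0 < h) : 0 ≤ gsNorm s h f :=
  Real.iSup_nonneg fun _ => gsQuot_nonneg hh _ _ _

theorem gsNorm_add (hh : 0 < h) (hf : IsGS s h f) (hg : IsGS s h g) :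
    gsNorm s h (f + g) ≤ gsNorm s h f + gsNorm s h g :=
  ciSup_le fun _ => (gsQuot_add hh hf.1 hg.1 _ _ _).trans
    (add_le_add (hf.le_gsNorm _ _ _) (hg.le_gsNorm _ _ _))

theorem gsNorm_smul (c : ℂ) (hf : IsGS s h f) : gsNorm s h (c • f) = ‖c‖ * gsNorm s h f := by
  unfold gsNorm
  rw [Real.mul_iSup_of_nonneg (norm_nonneg c)]
  exact iSup_congr fun q => gsQuot_smul hf.1 _ _ _ _

/-- The sup norm is dominated by the norm of `𝒮_{s,h}`. -/
theorem IsGS.norm_le (hf : IsGS s h f) (x : EuclideanSpace ℝ ι) : ‖f x‖ ≤ gsNorm s h f := by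
  have := hf.le_gsNorm 0 0 x
  have hz : ‖multiDeriv (0 : ι → ℕ) f x‖ = ‖f x‖ := by
    have key : ∀ (n : ℕ) (hn : n = 0) (v : Fin n → EuclideanSpace ℝ ι),
        iteratedFDeriv ℝ n f x v = f x := by
      rintro n rfl v
      simp
    unfold multiDeriv
    rw [key _ (by simp)]
  simpa [gsQuot, hz] using this

/-- Elements of `𝒮_{s,h}` are integrable. -/
theorem IsGS.integrable (hh : 0 < h) (hf : IsGS s h f) : Integrable f := by
  classical
  set N := (volume : Measure (EuclideanSpace ℝ ι)).integrablePower with hN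
  have hz : ∀ x, ‖multiDeriv (0 : ι → ℕ) f x‖ = ‖f x‖ := by
    intro x
    have key : ∀ (n : ℕ) (hn : n = 0) (v : Fin n → EuclideanSpace ℝ ι),
        iteratedFDeriv ℝ n f x v = f x := by
      rintro n rfl v
      simp
    unfold multiDeriv
    rw [key _ (by simp)]
  have hcoord : ∀ m : ℕ, ∃ C : ℝ, ∀ (i : ι) x, |x i| ^ m * ‖f x‖ ≤ C := by
    intro m
    refine ⟨gsNorm s h f * (h ^ m * (m ! : ℝ) ^ s), fun i x => ?_⟩
    have := hf.le_gsNorm 0 (Pi.single i m) x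
    have hprod : ∏ j, x j ^ (Pi.single i m : ι → ℕ) j = x i ^ m := by
      rw [Finset.prod_eq_single i]
      · simp
      · intro j _ hj
        simp [Pi.single_eq_of_ne hj]
      · simp
    have hfact : ∏ j, ((Pi.single i m : ι → ℕ) j)! = m ! := by
      rw [Finset.prod_eq_single i]
      · simp
      · intro j _ hj
        simp [Pi.single_eq_of_ne hj]
      · simp
    rw [gsQuot, hz, hprod, hfact, div_le_iff₀ (by simp; positivity)] at this
    simpa [abs_pow] using this
  have hpow : ∀ m : ℕ, ∃ C : ℝ, ∀ x, ‖x‖ ^ m * ‖f x‖ ≤ C := by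
    intro m
    rcases m with _ | m
    · exact ⟨gsNorm s h f, fun x => by simpa using hf.norm_le x⟩
    obtain ⟨C, hC⟩ := hcoord (m + 1)
    refine ⟨(Fintype.card ι : ℝ) ^ m * ∑ _i : ι, C, fun x => ?_⟩
    have h1 : ‖x‖ ≤ ∑ i, |x i| := by
      conv_lhs => rw [← (EuclideanSpace.basisFun ι ℝ).sum_repr x]
      refine (norm_sum_le _ _).trans (le_of_eq ?_)
      simp [norm_smul]
    have h2 : ‖x‖ ^ (m + 1) ≤ (Fintype.card ι : ℝ) ^ m * ∑ i, |x i| ^ (m + 1) := by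
      refine (pow_le_pow_left₀ (norm_nonneg _) h1 _).trans ?_
      have h3 := pow_sum_div_card_le_sum_pow (s := Finset.univ) (f := fun i : ι => |x i|)
        (fun i _ => abs_nonneg _) m
      rcases isEmpty_or_nonempty ι with hι | hι
      · simp
      · rwa [div_le_iff₀' (by simp; positivity)] at h3
    calc ‖x‖ ^ (m + 1) * ‖f x‖
        ≤ ((Fintype.card ι : ℝ) ^ m * ∑ i, |x i| ^ (m + 1)) * ‖f x‖ := by gcongr
      _ = (Fintype.card ι : ℝ) ^ m * ∑ i, |x i| ^ (m + 1) * ‖f x‖ := by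
          rw [mul_assoc, Finset.sum_mul]
      _ ≤ _ := by
          gcongr with i
          exact hC i x
  obtain ⟨C₁, hC₁⟩ := hpow 0
  obtain ⟨C₂, hC₂⟩ := hpow (0 + N)
  have := integrable_of_le_of_pow_mul_le (μ := (volume : Measure (EuclideanSpace ℝ ι)))
    (f := f) (k := 0) (C₁ := C₁) (C₂ := C₂)
    (fun x => by simpa using hC₁ x) hC₂ hf.1.continuous.aestronglyMeasurable
  exact (integrable_norm_iff hf.1.continuous.aestronglyMeasurable).1 (by simpa using this)

theorem IsGS.integrable_mul {h' : ℝ} (hh : 0 < h) (hf : IsGS s h f) (hg : IsGS s h' g) :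
    Integrable fun x => f x * g x :=
  (hf.integrable hh).mul_bdd (c := gsNorm s h' g) hg.1.continuous.aestronglyMeasurable
    (Filter.Eventually.of_forall hg.norm_le)

theorem IsGS.norm_integral_mul_le {h' : ℝ} (hh : 0 < h) (hf : IsGS s h f) (hg : IsGS s h' g) :
    ‖∫ x, f x * g x‖ ≤ (∫ x, ‖f x‖) * gsNorm s h' g := by
  rw [← integral_mul_const]
  refine norm_integral_le_of_norm_le ((hf.integrable hh).norm.mul_const _)
    (Filter.Eventually.of_forall fun x => ?_)
  rw [norm_mul]
  gcongr
  exact hg.norm_le x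

end Basic

/-! ### The spaces `𝒮_s` and their topology -/

/-- The set `𝒮_s(ℝ^ι) = ⋃_{h > 0} 𝒮_{s,h}(ℝ^ι)` as a vector space of functions. -/
def gsSubmodule (s : ℝ) (ι : Type) [Fintype ι] : Submodule ℂ (EuclideanSpace ℝ ι → ℂ) where
  carrier := {f | ∃ h : ℝ, 0 < h ∧ IsGS s h f}
  zero_mem' := ⟨1, one_pos, IsGS.zero⟩
  add_mem' := by
    rintro f g ⟨h, hh, hf⟩ ⟨k, hk, hg⟩
    exact ⟨max h k, lt_max_of_lt_left hh, (hf.mono hh (le_max_left _ _)).add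
      (lt_max_of_lt_left hh) (hg.mono hk (le_max_right _ _))⟩
  smul_mem' := by
    rintro c f ⟨h, hh, hf⟩
    exact ⟨h, hh, hf.smul c⟩

/-- The Gelfand-Shilov space `𝒮_s(ℝ^ι)`. (A type of its own, so that it does not inherit the
topology of pointwise convergence.) -/
def GelfandShilov (s : ℝ) (ι : Type) [Fintype ι] : Type := gsSubmodule s ι

namespace GelfandShilov

variable {s : ℝ} {ι : Type} [Fintype ι]

instance : AddCommGroup (GelfandShilov s ι) := inferInstanceAs (AddCommGroup (gsSubmodule s ι))

instance : Module ℂ (GelfandShilov s ι) := inferInstanceAs (Module ℂ (gsSubmodule s ι))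

instance : FunLike (GelfandShilov s ι) (EuclideanSpace ℝ ι) ℂ where
  coe f := f.1
  coe_injective _ _ hfg := Subtype.ext hfg

theorem coe_add (f g : GelfandShilov s ι) : ⇑(f + g) = ⇑f + ⇑g := rfl

theorem coe_smul (c : ℂ) (f : GelfandShilov s ι) : ⇑(c • f) = c • ⇑f := rfl

theorem exists_isGS (f : GelfandShilov s ι) : ∃ h : ℝ, 0 < h ∧ IsGS s h f := f.2

/-- The family of all seminorms on `𝒮_s` whose restriction to each Banach space `𝒮_{s,h}` is
continuous. -/
def seminormFamily (s : ℝ) (ι : Type) [Fintype ι] :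
    SeminormFamily ℂ (GelfandShilov s ι)
      {p : Seminorm ℂ (GelfandShilov s ι) // ∀ h : ℝ, 0 < h → ∃ C : ℝ,
        ∀ f : GelfandShilov s ι, IsGS s h f → p f ≤ C * gsNorm s h f} :=
  fun p => p.1

/-- The (locally convex) inductive limit topology of the `𝒮_{s,h}`, `h > 0`, i.e. the finest
locally convex topology for which all inclusions `𝒮_{s,h} → 𝒮_s` are continuous. -/
instance : TopologicalSpace (GelfandShilov s ι) :=
  (seminormFamily s ι).moduleFilterBasis.topology

theorem withSeminorms : WithSeminorms (seminormFamily s ι) := ⟨rfl⟩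

instance : IsTopologicalAddGroup (GelfandShilov s ι) := withSeminorms.topologicalAddGroup

instance : ContinuousSMul ℂ (GelfandShilov s ι) := withSeminorms.continuousSMul

/-- The inclusion of `𝒮_s` in its dual `𝒮_s'`: the functional `g ↦ ∫ f(x) g(x) dx`. -/
def toDual (f : GelfandShilov s ι) : StrongDual ℂ (GelfandShilov s ι) where
  toFun g := ∫ x, f x * g x
  map_add' g₁ g₂ := by
    obtain ⟨h, hh, hf⟩ := f.exists_isGS
    obtain ⟨h₁, _, hg₁⟩ := g₁.exists_isGS
    obtain ⟨h₂, _, hg₂⟩ := g₂.exists_isGS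
    rw [← integral_add (hf.integrable_mul hh hg₁) (hf.integrable_mul hh hg₂)]
    simp [coe_add, mul_add]
  map_smul' c g := by
    rw [RingHom.id_apply, smul_eq_mul, ← integral_const_mul]
    congr 1
    ext x
    simp [coe_smul]
    ring
  cont := by
    obtain ⟨h, hh, hf⟩ := f.exists_isGS
    let L : GelfandShilov s ι →ₗ[ℂ] ℂ :=
      { toFun := fun g => ∫ x, f x * g x
        map_add' := fun g₁ g₂ => by
          obtain ⟨h₁, _, hg₁⟩ := g₁.exists_isGS
          obtain ⟨h₂, _, hg₂⟩ := g₂.exists_isGS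
          rw [← integral_add (hf.integrable_mul hh hg₁) (hf.integrable_mul hh hg₂)]
          simp [coe_add, mul_add]
        map_smul' := fun c g => by
          rw [RingHom.id_apply, smul_eq_mul, ← integral_const_mul]
          congr 1
          ext x
          simp [coe_smul]
          ring }
    change Continuous L
    have hp : ∀ h' : ℝ, 0 < h' → ∃ C : ℝ, ∀ g : GelfandShilov s ι, IsGS s h' g →
        ((normSeminorm ℂ ℂ).comp L) g ≤ C * gsNorm s h' g :=
      fun h' _ => ⟨∫ x, ‖f x‖, fun g hg => hf.norm_integral_mul_le hh hg⟩
    refine withSeminorms.continuous_normedSpace_rng ℂ L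
      ⟨{⟨(normSeminorm ℂ ℂ).comp L, hp⟩}, 1, ?_⟩
    simp [seminormFamily]

end GelfandShilov

/-! ### The spaces `Σ_s` and their topology -/

/-- The set `Σ_s(ℝ^ι) = ⋂_{h > 0} 𝒮_{s,h}(ℝ^ι)` as a vector space of functions. -/
def gsSigmaSubmodule (s : ℝ) (ι : Type) [Fintype ι] : Submodule ℂ (EuclideanSpace ℝ ι → ℂ) where
  carrier := {f | ∀ h : ℝ, 0 < h → IsGS s h f}
  zero_mem' := fun _ _ => IsGS.zero
  add_mem' := fun hf hg h hh => (hf h hh).add hh (hg h hh)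
  smul_mem' := fun c _ hf h hh => (hf h hh).smul c

/-- The Gelfand-Shilov space `Σ_s(ℝ^ι)`. -/
def GelfandShilovSigma (s : ℝ) (ι : Type) [Fintype ι] : Type := gsSigmaSubmodule s ι

namespace GelfandShilovSigma

variable {s : ℝ} {ι : Type} [Fintype ι]

instance : AddCommGroup (GelfandShilovSigma s ι) :=
  inferInstanceAs (AddCommGroup (gsSigmaSubmodule s ι))

instance : Module ℂ (GelfandShilovSigma s ι) :=
  inferInstanceAs (Module ℂ (gsSigmaSubmodule s ι))

instance : FunLike (GelfandShilovSigma s ι) (EuclideanSpace ℝ ι) ℂ where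
  coe f := f.1
  coe_injective _ _ hfg := Subtype.ext hfg

theorem coe_add (f g : GelfandShilovSigma s ι) : ⇑(f + g) = ⇑f + ⇑g := rfl

theorem coe_smul (c : ℂ) (f : GelfandShilovSigma s ι) : ⇑(c • f) = c • ⇑f := rfl

theorem isGS (f : GelfandShilovSigma s ι) {h : ℝ} (hh : 0 < h) : IsGS s h f := f.2 h hh

/-- The seminorms `‖·‖_{𝒮_{s,h}}`, `h > 0`, on `Σ_s`. -/
def seminormFamily (s : ℝ) (ι : Type) [Fintype ι] :
    SeminormFamily ℂ (GelfandShilovSigma s ι) {h : ℝ // 0 < h} :=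
  fun h => Seminorm.of (fun f => gsNorm s h f)
    (fun f g => gsNorm_add h.2 (f.isGS h.2) (g.isGS h.2))
    (fun c f => gsNorm_smul c (f.isGS h.2))

/-- The projective limit topology of the `𝒮_{s,h}`, `h > 0`. -/
instance : TopologicalSpace (GelfandShilovSigma s ι) :=
  (seminormFamily s ι).moduleFilterBasis.topology

theorem withSeminorms : WithSeminorms (seminormFamily s ι) := ⟨rfl⟩

instance : IsTopologicalAddGroup (GelfandShilovSigma s ι) := withSeminorms.topologicalAddGroup

instance : ContinuousSMul ℂ (GelfandShilovSigma s ι) := withSeminorms.continuousSMul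

/-- The inclusion of `Σ_s` in its dual `Σ_s'`: the functional `g ↦ ∫ f(x) g(x) dx`. -/
def toDual (f : GelfandShilovSigma s ι) : StrongDual ℂ (GelfandShilovSigma s ι) where
  toFun g := ∫ x, f x * g x
  map_add' g₁ g₂ := by
    rw [← integral_add ((f.isGS one_pos).integrable_mul one_pos (g₁.isGS one_pos))
      ((f.isGS one_pos).integrable_mul one_pos (g₂.isGS one_pos))]
    simp [coe_add, mul_add]
  map_smul' c g := by
    rw [RingHom.id_apply, smul_eq_mul, ← integral_const_mul]
    congr 1
    ext x
    simp [coe_smul]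
    ring
  cont := by
    let L : GelfandShilovSigma s ι →ₗ[ℂ] ℂ :=
      { toFun := fun g => ∫ x, f x * g x
        map_add' := fun g₁ g₂ => by
          rw [← integral_add ((f.isGS one_pos).integrable_mul one_pos (g₁.isGS one_pos))
            ((f.isGS one_pos).integrable_mul one_pos (g₂.isGS one_pos))]
          simp [coe_add, mul_add]
        map_smul' := fun c g => by
          rw [RingHom.id_apply, smul_eq_mul, ← integral_const_mul]
          congr 1
          ext x
          simp [coe_smul]
          ring }
    change Continuous L
    refine withSeminorms.continuous_normedSpace_rng ℂ L
      ⟨{⟨1, one_pos⟩}, ⟨∫ x, ‖f x‖, integral_nonneg fun _ => norm_nonneg _⟩, fun g => ?_⟩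
    rw [Finset.sup_singleton]
    exact (f.isGS one_pos).norm_integral_mul_le one_pos (g.isGS one_pos)

end GelfandShilovSigma

/-- The inclusion of the Schwartz space in the space of tempered distributions (with its strong
topology): the functional `g ↦ ∫ f(x) g(x) dx`. -/
def schwartzToDual {ι : Type} [Fintype ι] (f : 𝓢(EuclideanSpace ℝ ι, ℂ)) :
    StrongDual ℂ 𝓢(EuclideanSpace ℝ ι, ℂ) :=
  SchwartzMap.integralCLM ℂ volume ∘L SchwartzMap.pairing (ContinuousLinearMap.mul ℂ ℂ) f

theorem schwartzToDual_apply {ι : Type} [Fintype ι] (f g : 𝓢(EuclideanSpace ℝ ι, ℂ)) :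
    schwartzToDual f g = ∫ x, f x * g x := rfl

/-! ### Pseudo-differential operators -/

/-- The point `(x, ξ)` of `ℝ^{2d}`. -/
def phasePoint {d : ℕ} (x ξ : EuclideanSpace ℝ (Fin d)) : EuclideanSpace ℝ (Fin d ⊕ Fin d) :=
  WithLp.toLp 2 (Sum.elim x ξ)

/-- The operator of Shubin type
`(Op_t(a) f)(x) = (2π)^{-d} ∬ a((1-t)x + ty, ξ) f(y) e^{i⟨x-y,ξ⟩} dy dξ`. -/
def shubinOp {d : ℕ} (t : ℝ) (a : EuclideanSpace ℝ (Fin d ⊕ Fin d) → ℂ)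
    (f : EuclideanSpace ℝ (Fin d) → ℂ) (x : EuclideanSpace ℝ (Fin d)) : ℂ :=
  ((2 * Real.pi : ℝ) ^ d : ℂ)⁻¹ *
    ∫ p : EuclideanSpace ℝ (Fin d) × EuclideanSpace ℝ (Fin d),
      a (phasePoint ((1 - t) • x + t • p.1) p.2) * f p.1 *
        Complex.exp (Complex.I * (inner ℝ (x - p.1) p.2 : ℝ))

/-- The Born-Jordan operator `Op_BJ(a) = ∫_0^1 Op_t(a) dt`. -/
def bornJordanOp {d : ℕ} (a : EuclideanSpace ℝ (Fin d ⊕ Fin d) → ℂ)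
    (f : EuclideanSpace ℝ (Fin d) → ℂ) (x : EuclideanSpace ℝ (Fin d)) : ℂ :=
  ∫ t in (0 : ℝ)..1, shubinOp t a f x

end

/-! The three families of spaces differ only in the growth allowed for `x^β ∂^α f`, and every
operation behind the theorem respects that growth. The proof uses words in the letters `x_i` and
`∂_i`: a space is described by a class `W` of weights, and its elements are the smooth `f` for which
some `w ∈ W` satisfies `‖τ f‖_∞ ≤ w |τ|` for all words `τ`. The class consists of all sequences for
the Schwartz space, of those dominated by `C h^n n!^s` for some `h` for `𝒮_s`, and for every `h` for
`Σ_s`. `IsWeightClass` and `IsTestSpace` collect what is needed; in particular, bounded sets have a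
common weight, and seminorms that are bounded on bounded sets are continuous.

Existence. The kernel of `Op_BJ(a)` is `∫_0^1 (F a)((1-t)x + ty, x - y) dt`, with `F` the inverse
Fourier transform in the second variable. `F` turns letters into letters up to factors `i`, the
substitution has coefficients at most `2` uniformly in `t`, and averaging keeps bounds, so the
kernel `K` is again of the given class (`IsWeightClass.exists_bornJordanKernel`). The extension in
the first part is `u ↦ ⟨u, K(x, ·)⟩`; it is a continuous map into test functions because weights
split, `w (m + n) ≤ v m * v n` (`IsTestSpace.exists_kernelOperator`). For the second part, Fubini
gives `∫ Op_BJ(a)f · g = ∫ a · Q(g, f)`, where `Q` is the cross Born-Jordan distribution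
(`WordBdd.integral_bornJordanOp_mul`). The right side makes sense for `u` in place of `a`, and since
`Q` sends bounded sets to bounded sets, the result is continuous for uniform convergence on bounded
sets.

Uniqueness is the density of test functions in the strong dual (`IsTestSpace.denseRange_toDual`).
Sets with a common weight are compact (`IsTestSpace.isCompact_setOf_wordBdd`), so strong convergence
is uniform convergence on compact convex balanced sets, and there Hahn-Banach separation of the
graph of `u` from a point `(0, ε)` produces approximants.

Comparison with the given seminorms. These only see words with all multiplications to the left of
all derivatives. Reordering a word of length `n` produces at most about `n` commutators for each
derivative that is moved, each shorter by two letters. They are harmless if `n · h^n n!^s` is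
dominated by `h^{n+2} (n+2)!^s`, that is, if `n^{1-2s}` is dominated by `h²`. This works for `s ≥
1/2` when `h` may be enlarged, as in `𝒮_s`, and for `s > 1/2` when `h` must be small, as in `Σ_s`.
The remaining space `Σ_{1/2}` is zero in positive dimension by Liouville's theorem
(`eq_zero_of_gaussian_bounds`), and in dimension zero the exponent is immaterial. -/

noncomputable section

/-! ### Words in multiplications and derivatives -/

section Words

variable {ι : Type} [Fintype ι]

/-- The letter `inl i` acts as multiplication by the `i`-th coordinate, the letter `inr i` as the
`i`-th partial derivative. -/
def letterOp : ι ⊕ ι → (EuclideanSpace ℝ ι → ℂ) → EuclideanSpace ℝ ι → ℂ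
  | .inl i, f => fun x => (x i : ℂ) * f x
  | .inr i, f => fun x => fderiv ℝ f x (EuclideanSpace.basisFun ι ℝ i)

/-- A word acts as the composition of its letters, the last letter first. -/
def wordOp (τ : List (ι ⊕ ι)) (f : EuclideanSpace ℝ ι → ℂ) : EuclideanSpace ℝ ι → ℂ :=
  τ.foldr letterOp f

/-- `f` is smooth, and words of length `n` map it to functions bounded by `w n`. -/
structure WordBdd (w : ℕ → ℝ) (f : EuclideanSpace ℝ ι → ℂ) : Prop where
  contDiff : ContDiff ℝ ∞ f
  norm_le : ∀ τ x, ‖wordOp τ f x‖ ≤ w τ.length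

variable {f g : EuclideanSpace ℝ ι → ℂ} {w v : ℕ → ℝ}

theorem letterOp_inl (i : ι) (f : EuclideanSpace ℝ ι → ℂ) (x : EuclideanSpace ℝ ι) :
    letterOp (.inl i) f x = (x i : ℂ) * f x := rfl

theorem letterOp_inr (i : ι) (f : EuclideanSpace ℝ ι → ℂ) (x : EuclideanSpace ℝ ι) :
    letterOp (.inr i) f x = fderiv ℝ f x (EuclideanSpace.basisFun ι ℝ i) := rfl

theorem wordOp_nil (f : EuclideanSpace ℝ ι → ℂ) : wordOp [] f = f := rfl

theorem wordOp_cons (ℓ : ι ⊕ ι) (τ : List (ι ⊕ ι)) (f : EuclideanSpace ℝ ι → ℂ) :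
    wordOp (ℓ :: τ) f = letterOp ℓ (wordOp τ f) := rfl

theorem wordOp_append (τ σ : List (ι ⊕ ι)) (f : EuclideanSpace ℝ ι → ℂ) :
    wordOp (τ ++ σ) f = wordOp τ (wordOp σ f) := by
  simp [wordOp, List.foldr_append]

theorem wordOp_concat (τ : List (ι ⊕ ι)) (ℓ : ι ⊕ ι) (f : EuclideanSpace ℝ ι → ℂ) :
    wordOp (τ ++ [ℓ]) f = wordOp τ (letterOp ℓ f) := wordOp_append _ _ _

theorem sum_coord_smul_basisFun (h : EuclideanSpace ℝ ι) :
    ∑ i, h i • EuclideanSpace.basisFun ι ℝ i = h := by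
  simpa using (EuclideanSpace.basisFun ι ℝ).sum_repr h

theorem clm_apply_eq_sum (L : EuclideanSpace ℝ ι →L[ℝ] ℂ) (h : EuclideanSpace ℝ ι) :
    L h = ∑ i, (h i : ℂ) * L (EuclideanSpace.basisFun ι ℝ i) := by
  conv_lhs => rw [← sum_coord_smul_basisFun h]
  simp [map_sum]

theorem abs_coord_le_norm (h : EuclideanSpace ℝ ι) (i : ι) : |h i| ≤ ‖h‖ := by
  simpa using PiLp.norm_apply_le h i

theorem ContDiff.letterOp (hf : ContDiff ℝ ∞ f) (ℓ : ι ⊕ ι) : ContDiff ℝ ∞ (letterOp ℓ f) := by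
  rcases ℓ with i | i
  · exact (Complex.ofRealCLM.contDiff.comp
      (EuclideanSpace.proj i : EuclideanSpace ℝ ι →L[ℝ] ℝ).contDiff).mul hf
  · exact (hf.fderiv_right (m := ∞) (by simp)).clm_apply contDiff_const

theorem ContDiff.wordOp (hf : ContDiff ℝ ∞ f) (τ : List (ι ⊕ ι)) : ContDiff ℝ ∞ (wordOp τ f) := by
  induction τ with
  | nil => exact hf
  | cons ℓ τ ih => exact ih.letterOp ℓ

theorem ContDiff.diffAt (hf : ContDiff ℝ ∞ f) (x : EuclideanSpace ℝ ι) :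
    DifferentiableAt ℝ f x := (hf.differentiable (by simp)) x

theorem letterOp_add (hf : ContDiff ℝ ∞ f) (hg : ContDiff ℝ ∞ g) (ℓ : ι ⊕ ι) :
    letterOp ℓ (f + g) = letterOp ℓ f + letterOp ℓ g := by
  rcases ℓ with i | i <;> ext x
  · simp [letterOp_inl, mul_add]
  · simp [letterOp_inr, fderiv_add (hf.diffAt x) (hg.diffAt x)]

theorem letterOp_smul (hf : ContDiff ℝ ∞ f) (c : ℂ) (ℓ : ι ⊕ ι) :
    letterOp ℓ (c • f) = c • letterOp ℓ f := by
  rcases ℓ with i | i <;> ext x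
  · simp [letterOp_inl]; ring
  · simp [letterOp_inr, fderiv_const_smul (hf.diffAt x)]

theorem wordOp_add (hf : ContDiff ℝ ∞ f) (hg : ContDiff ℝ ∞ g) (τ : List (ι ⊕ ι)) :
    wordOp τ (f + g) = wordOp τ f + wordOp τ g := by
  induction τ with
  | nil => rfl
  | cons ℓ τ ih => rw [wordOp_cons, ih, letterOp_add (hf.wordOp τ) (hg.wordOp τ)]; rfl

theorem wordOp_smul (hf : ContDiff ℝ ∞ f) (c : ℂ) (τ : List (ι ⊕ ι)) :
    wordOp τ (c • f) = c • wordOp τ f := by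
  induction τ with
  | nil => rfl
  | cons ℓ τ ih => rw [wordOp_cons, ih, letterOp_smul (hf.wordOp τ)]; rfl

theorem wordOp_sub (hf : ContDiff ℝ ∞ f) (hg : ContDiff ℝ ∞ g) (τ : List (ι ⊕ ι)) :
    wordOp τ (f - g) = wordOp τ f - wordOp τ g := by
  have := wordOp_add (g := (-1 : ℂ) • g) hf (hg.const_smul (-1 : ℂ)) τ
  rw [wordOp_smul hg] at this
  simpa [sub_eq_add_neg] using this

theorem wordOp_zero (τ : List (ι ⊕ ι)) : wordOp τ (0 : EuclideanSpace ℝ ι → ℂ) = 0 := by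
  have := wordOp_smul (f := (0 : EuclideanSpace ℝ ι → ℂ)) contDiff_const 0 τ
  simpa using this

theorem wordOp_sum {κ : Type*} (s : Finset κ) {F : κ → EuclideanSpace ℝ ι → ℂ}
    (hF : ∀ k, ContDiff ℝ ∞ (F k)) (τ : List (ι ⊕ ι)) :
    wordOp τ (∑ k ∈ s, F k) = ∑ k ∈ s, wordOp τ (F k) := by
  classical
  induction s using Finset.induction_on with
  | empty => simp [wordOp_zero]
  | insert a s ha ih =>
    rw [Finset.sum_insert ha, Finset.sum_insert ha, wordOp_add (hF a), ih]
    have : (∑ k ∈ s, F k) = fun x => ∑ k ∈ s, F k x := by ext; simp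
    rw [this]
    exact ContDiff.sum fun k _ => hF k

namespace WordBdd

theorem mono (hf : WordBdd w f) (h : ∀ n, w n ≤ v n) : WordBdd v f :=
  ⟨hf.1, fun τ x => (hf.2 τ x).trans (h _)⟩

theorem add (hf : WordBdd w f) (hg : WordBdd v g) : WordBdd (fun n => w n + v n) (f + g) :=
  ⟨hf.1.add hg.1, fun τ x => by
    rw [wordOp_add hf.1 hg.1]
    exact (norm_add_le _ _).trans (add_le_add (hf.2 τ x) (hg.2 τ x))⟩

theorem smul (hf : WordBdd w f) (c : ℂ) : WordBdd (fun n => ‖c‖ * w n) (c • f) :=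
  ⟨hf.1.const_smul c, fun τ x => by
    rw [wordOp_smul hf.1, Pi.smul_apply, norm_smul]
    gcongr
    exact hf.2 τ x⟩

theorem wordOp (hf : WordBdd w f) (σ : List (ι ⊕ ι)) :
    WordBdd (fun n => w (n + σ.length)) (wordOp σ f) :=
  ⟨hf.1.wordOp σ, fun τ x => by
    rw [← wordOp_append, ← List.length_append]
    exact hf.2 _ x⟩

theorem letterOp (hf : WordBdd w f) (ℓ : ι ⊕ ι) :
    WordBdd (fun n => w (n + 1)) (letterOp ℓ f) := hf.wordOp [ℓ]

theorem bound (hf : WordBdd w f) (x : EuclideanSpace ℝ ι) : ‖f x‖ ≤ w 0 := hf.2 [] x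

end WordBdd

/-! ### Mean value and Taylor estimates -/

theorem norm_fderiv_le_of_letterOp {C : ℝ} (hC : 0 ≤ C) {x : EuclideanSpace ℝ ι}
    (h : ∀ i, ‖letterOp (.inr i) f x‖ ≤ C) : ‖fderiv ℝ f x‖ ≤ Fintype.card ι * C := by
  refine ContinuousLinearMap.opNorm_le_bound _ (by positivity) fun k => ?_
  rw [clm_apply_eq_sum]
  refine (norm_sum_le _ _).trans ?_
  calc ∑ i, ‖(k i : ℂ) * fderiv ℝ f x (EuclideanSpace.basisFun ι ℝ i)‖
      ≤ ∑ _i : ι, ‖k‖ * C := by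
        gcongr with i
        rw [norm_mul, Complex.norm_real]
        exact mul_le_mul (abs_coord_le_norm k i) (h i) (norm_nonneg _) (norm_nonneg _)
    _ = _ := by simp; ring

theorem norm_sub_le_of_letterOp {C : ℝ} (hC : 0 ≤ C) (hf : ContDiff ℝ ∞ f)
    (h : ∀ i x, ‖letterOp (.inr i) f x‖ ≤ C) (x y : EuclideanSpace ℝ ι) :
    ‖f y - f x‖ ≤ Fintype.card ι * C * ‖y - x‖ :=
  convex_univ.norm_image_sub_le_of_norm_fderiv_le (𝕜 := ℝ) (fun z _ => hf.diffAt z)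
    (fun z _ => norm_fderiv_le_of_letterOp hC fun i => h i z) (Set.mem_univ _) (Set.mem_univ _)

/-- Taylor's formula of order two, with the remainder controlled by the second derivatives. -/
theorem norm_taylor_le {C : ℝ} (hC : 0 ≤ C) (hf : ContDiff ℝ ∞ f)
    (h : ∀ i j x, ‖letterOp (.inr i) (letterOp (.inr j) f) x‖ ≤ C)
    (x k : EuclideanSpace ℝ ι) :
    ‖f (x + k) - f x - ∑ i, (k i : ℂ) * letterOp (.inr i) f x‖
      ≤ (Fintype.card ι) ^ 2 * C * ‖k‖ ^ 2 := by
  have h1 : ∀ y ∈ Metric.closedBall x ‖k‖,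
      ‖fderiv ℝ f y - fderiv ℝ f x‖ ≤ Fintype.card ι * (Fintype.card ι * C * ‖k‖) := by
    intro y hy
    refine ContinuousLinearMap.opNorm_le_bound _ (by positivity) fun z => ?_
    rw [clm_apply_eq_sum]
    refine (norm_sum_le _ _).trans ?_
    calc ∑ i, ‖(z i : ℂ) * (fderiv ℝ f y - fderiv ℝ f x) (EuclideanSpace.basisFun ι ℝ i)‖
        ≤ ∑ _i : ι, ‖z‖ * (Fintype.card ι * C * ‖k‖) := by
          gcongr with i
          rw [norm_mul, Complex.norm_real]
          refine mul_le_mul (abs_coord_le_norm z i) ?_ (norm_nonneg _) (norm_nonneg _)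
          refine (norm_sub_le_of_letterOp hC (hf.letterOp (.inr i)) (fun j => h j i) x y).trans ?_
          gcongr
          simpa [dist_eq_norm] using hy
      _ = _ := by simp; ring
  -- This form of the mean value inequality compares `f` with its linearization at `x`; `h1` bounds
  -- the derivative of the difference on the ball.
  have h2 := (convex_closedBall x ‖k‖).norm_image_sub_le_of_norm_fderiv_le' (𝕜 := ℝ)
    (fun z _ => hf.diffAt z) h1
    (Metric.mem_closedBall_self (norm_nonneg _)) (y := x + k) (by simp)
  rw [add_sub_cancel_left, clm_apply_eq_sum] at h2
  refine h2.trans (le_of_eq ?_)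
  ring

/-- The absolute value matters only when `ι` is empty: there are then no words of positive length,
and `w` may be negative there. -/
theorem WordBdd.norm_taylor_le (hf : WordBdd w f) (τ : List (ι ⊕ ι)) (x k : EuclideanSpace ℝ ι) :
    ‖_root_.wordOp τ f (x + k) - _root_.wordOp τ f x
        - ∑ i, (k i : ℂ) * _root_.wordOp (.inr i :: τ) f x‖
      ≤ (Fintype.card ι) ^ 2 * |w (τ.length + 2)| * ‖k‖ ^ 2 :=
  _root_.norm_taylor_le (abs_nonneg _) (hf.1.wordOp τ)
    (fun i j y => (hf.2 (.inr i :: .inr j :: τ) y).trans (le_abs_self _)) x k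

/-- A quadratic remainder is an inequality, so unlike differentiability it passes directly to
pointwise limits, averages and parameter integrals. All limit objects below are differentiated in
this way. -/
theorem hasFDerivAt_of_quadratic {C : ℝ} {F : EuclideanSpace ℝ ι → ℂ} {c : ι → ℂ}
    {x : EuclideanSpace ℝ ι}
    (h : ∀ k : EuclideanSpace ℝ ι, ‖F (x + k) - F x - ∑ i, (k i : ℂ) * c i‖ ≤ C * ‖k‖ ^ 2) :
    HasFDerivAt F (∑ i, ContinuousLinearMap.smulRightL ℝ (EuclideanSpace ℝ ι) ℂ
      (EuclideanSpace.proj i) (c i)) x := by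
  rw [hasFDerivAt_iff_isLittleO_nhds_zero]
  refine Asymptotics.IsBigO.trans_isLittleO (g := fun k : EuclideanSpace ℝ ι => ‖k‖ ^ 2) ?_
    (Asymptotics.isLittleO_norm_pow_id one_lt_two)
  refine Asymptotics.IsBigO.of_bound C (Filter.Eventually.of_forall fun k => ?_)
  simpa using h k

/-- A family of functions that is closed under multiplication by the coordinates and under partial
derivatives consists of smooth functions, and words act on it through the index. -/
theorem contDiff_and_wordOp_of_family {X : Type*} (P : X → Prop)
    (Φ : X → EuclideanSpace ℝ ι → ℂ) (act : ι ⊕ ι → X → X) (hP : ∀ ℓ a, P a → P (act ℓ a))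
    (hM : ∀ a, P a → ∀ i x, (x i : ℂ) * Φ a x = Φ (act (.inl i) a) x)
    (hD : ∀ a, P a → ∃ C : ℝ, ∀ x k : EuclideanSpace ℝ ι,
      ‖Φ a (x + k) - Φ a x - ∑ i, (k i : ℂ) * Φ (act (.inr i) a) x‖ ≤ C * ‖k‖ ^ 2)
    {a : X} (ha : P a) :
    ContDiff ℝ ∞ (Φ a) ∧ ∀ τ : List (ι ⊕ ι), wordOp τ (Φ a) = Φ (τ.foldr act a) := by
  have hd : ∀ a, P a → ∀ x, HasFDerivAt (Φ a)
      (∑ i, ContinuousLinearMap.smulRightL ℝ (EuclideanSpace ℝ ι) ℂ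
      (EuclideanSpace.proj i) (Φ (act (.inr i) a) x)) x := by
    intro a ha x
    obtain ⟨C, hC⟩ := hD a ha
    exact hasFDerivAt_of_quadratic (C := C) (hC x)
  have hsmooth : ∀ n : ℕ, ∀ a, P a → ContDiff ℝ n (Φ a) := by
    intro n
    induction n with
    | zero =>
      intro a ha
      rw [Nat.cast_zero, contDiff_zero]
      exact continuous_iff_continuousAt.2 fun x => (hd a ha x).continuousAt
    | succ n ih =>
      intro a ha
      rw [Nat.cast_succ, contDiff_succ_iff_fderiv]
      refine ⟨fun x => (hd a ha x).differentiableAt, by simp, ?_⟩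
      -- The derivative is a finite combination of members of the family, which closes the induction
      -- on the order of smoothness.
      have : fderiv ℝ (Φ a) = fun x => ∑ i,
          ContinuousLinearMap.smulRightL ℝ (EuclideanSpace ℝ ι) ℂ
          (EuclideanSpace.proj i) (Φ (act (.inr i) a) x) := by
        ext1 x
        exact (hd a ha x).fderiv
      rw [this]
      exact ContDiff.sum fun i _ => (ContinuousLinearMap.contDiff _).comp (ih _ (hP _ _ ha))
  refine ⟨contDiff_infty.2 fun n => hsmooth n a ha, fun τ => ?_⟩
  have hPτ : ∀ τ : List (ι ⊕ ι), P (τ.foldr act a) := by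
    intro τ
    induction τ with
    | nil => exact ha
    | cons ℓ τ ih => exact hP _ _ ih
  induction τ with
  | nil => rfl
  | cons ℓ τ ih =>
    rw [wordOp_cons, ih]
    rcases ℓ with i | i <;> ext x
    · exact hM _ (hPτ τ) i x
    · classical
      rw [letterOp_inr, (hd _ (hPτ τ) x).fderiv]
      simp [List.foldr_cons, ite_smul]

/-- The case of a family that is indexed by the words themselves. -/
theorem wordBdd_of_family (Φ : List (ι ⊕ ι) → EuclideanSpace ℝ ι → ℂ)
    (hM : ∀ τ i x, (x i : ℂ) * Φ τ x = Φ (.inl i :: τ) x)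
    (hD : ∀ τ, ∃ C : ℝ, ∀ x k : EuclideanSpace ℝ ι,
      ‖Φ τ (x + k) - Φ τ x - ∑ i, (k i : ℂ) * Φ (.inr i :: τ) x‖ ≤ C * ‖k‖ ^ 2)
    (hw : ∀ τ x, ‖Φ τ x‖ ≤ w τ.length) :
    WordBdd w (Φ []) ∧ ∀ τ, wordOp τ (Φ []) = Φ τ := by
  obtain ⟨h1, h2⟩ := contDiff_and_wordOp_of_family (fun _ => True) Φ List.cons
    (fun _ _ _ => trivial) (fun τ _ => hM τ) (fun τ _ => hD τ) (a := []) trivial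
  simp only [List.foldr_cons_nil] at h2
  exact ⟨⟨h1, fun τ x => by rw [h2]; exact hw τ x⟩, h2⟩

/-! ### Decay and integrability -/

/-- The constant that controls `(1 + ∑ |x_i|)^m |f(x)|` in terms of the word bounds of `f`. -/
def decayBound (ι : Type) [Fintype ι] : ℕ → (ℕ → ℝ) → ℝ
  | 0, w => w 0
  | m + 1, w => decayBound ι m w + Fintype.card ι * decayBound ι m (fun n => w (n + 1))

/-- Each factor `1 + ∑ |x_i|` is traded for one multiplication letter: expanded, it produces `f`
itself and the functions `x_i f`, whose weight is shifted by one. -/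
theorem WordBdd.decay (m : ℕ) : ∀ {w : ℕ → ℝ} {f : EuclideanSpace ℝ ι → ℂ}, WordBdd w f →
    ∀ x, (1 + ∑ i, |x i|) ^ m * ‖f x‖ ≤ decayBound ι m w := by
  induction m with
  | zero => intro w f hf x; simpa [decayBound] using hf.bound x
  | succ m ih =>
    intro w f hf x
    have h1 : (1 + ∑ i, |x i|) ^ (m + 1) * ‖f x‖ = (1 + ∑ i, |x i|) ^ m * ‖f x‖
        + ∑ i, (1 + ∑ i, |x i|) ^ m * ‖_root_.letterOp (.inl i) f x‖ := by
      simp only [letterOp_inl, norm_mul, Complex.norm_real, Real.norm_eq_abs]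
      rw [← Finset.mul_sum, ← Finset.sum_mul]
      ring
    rw [h1, decayBound]
    refine add_le_add (ih hf x) ((Finset.sum_le_sum fun i _ => ih (hf.letterOp (.inl i)) x).trans ?_)
    simp

theorem norm_le_sum_abs (x : EuclideanSpace ℝ ι) : ‖x‖ ≤ ∑ i, |x i| := by
  conv_lhs => rw [← sum_coord_smul_basisFun x]
  refine (norm_sum_le _ _).trans (le_of_eq ?_)
  simp [norm_smul]

theorem WordBdd.norm_le_rpow (hf : WordBdd w f) (x : EuclideanSpace ℝ ι) :
    ‖f x‖ ≤ decayBound ι (Fintype.card ι + 1) w * (1 + ‖x‖) ^ (-((Fintype.card ι + 1 : ℕ) : ℝ)) := by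
  rw [Real.rpow_neg (by positivity), Real.rpow_natCast, ← div_eq_mul_inv,
    le_div_iff₀ (by positivity), mul_comm]
  refine le_trans ?_ (hf.decay _ x)
  gcongr
  exact norm_le_sum_abs x

/-- The exponent is the dimension plus one, the least integer power that is integrable. -/
theorem integrable_decay (ι : Type) [Fintype ι] :
    Integrable fun x : EuclideanSpace ℝ ι => (1 + ‖x‖) ^ (-((Fintype.card ι + 1 : ℕ) : ℝ)) :=
  integrable_one_add_norm (by simp)

theorem WordBdd.integrable (hf : WordBdd w f) : Integrable f :=
  ((integrable_decay ι).const_mul _).mono' hf.1.continuous.aestronglyMeasurable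
    (Filter.Eventually.of_forall hf.norm_le_rpow)

theorem WordBdd.integrable_mul (hf : WordBdd w f) (hg : WordBdd v g) :
    Integrable fun x => f x * g x :=
  hf.integrable.mul_bdd (c := v 0) hg.1.continuous.aestronglyMeasurable
    (Filter.Eventually.of_forall hg.bound)

/-- Complex conjugation preserves word bounds. -/
theorem WordBdd.conj (hf : WordBdd w f) : WordBdd w fun x => (starRingEnd ℂ) (f x) := by
  refine (wordBdd_of_family (fun τ x => (starRingEnd ℂ) (_root_.wordOp τ f x)) (fun τ i x => ?_)
    (fun τ => ⟨(Fintype.card ι) ^ 2 * |w (τ.length + 2)|, fun x k => ?_⟩) (fun τ x => ?_)).1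
  · simp [wordOp_cons, letterOp_inl]
  · have := hf.norm_taylor_le τ x k
    rw [← Complex.norm_conj] at this
    simpa [map_sum] using this
  · rw [Complex.norm_conj]
    exact hf.2 τ x

end Words

/-! ### Approximation of functionals on compact convex sets -/

section HahnBanach

open Topology

variable {E : Type} [AddCommGroup E] [Module ℂ E] [TopologicalSpace E]

/-- Separation of a point from a compact convex set in a weak topology. -/
theorem exists_separating_of_pairing {X Y : Type} [AddCommGroup X] [Module ℂ X]
    [AddCommGroup Y] [Module ℂ Y] (B : X →ₗ[ℂ] Y →ₗ[ℂ] ℂ) (hinj : Function.Injective B)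
    (Ψ : E →ₗ[ℝ] X) (hΨ : ∀ y, Continuous fun f => B (Ψ f) y) {K : Set E} (hK : IsCompact K)
    (hconv : Convex ℝ K) {x : X} (hx : ∀ f ∈ K, Ψ f ≠ x) :
    ∃ (y : Y) (r : ℝ), (∀ f ∈ K, (B (Ψ f) y).re < r) ∧ r < (B x y).re := by
  have : T2Space (WeakBilin B) := (WeakBilin.isEmbedding hinj).t2Space
  let Ψ' : E →ₗ[ℝ] WeakBilin B := Ψ
  have hΨ' : Continuous Ψ' := WeakBilin.continuous_of_continuous_eval B hΨ
  -- Injectivity of `B` makes the weak topology Hausdorff, so the compact image of `K` is closed and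
  -- can be separated; continuous functionals of the weak topology come from `Y`.
  obtain ⟨G, r, hG1, hG2⟩ := RCLike.geometric_hahn_banach_closed_point (𝕜 := ℂ)
    (E := WeakBilin B) (x := x) (hconv.linear_image Ψ') (hK.image hΨ').isClosed
    (by rintro ⟨f, hf, h⟩; exact hx f hf h)
  obtain ⟨y, rfl⟩ := LinearMap.dualEmbedding_surjective B G
  exact ⟨y, r, fun f hf => hG1 _ ⟨f, hf, rfl⟩, hG2⟩

/-- On a compact convex balanced set every continuous functional is a uniform limit of functionals
from a given separating subspace of the dual. -/
theorem exists_mem_norm_sub_le_of_separating (F : Submodule ℂ (StrongDual ℂ E))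
    (hsep : ∀ f : E, (∀ v ∈ F, v f = 0) → f = 0) (u : StrongDual ℂ E) {K : Set E}
    (hK : IsCompact K) (hconv : Convex ℝ K) (hbal : Balanced ℂ K) {ε : ℝ} (hε : 0 < ε) :
    ∃ v ∈ F, ∀ f ∈ K, ‖u f - v f‖ ≤ ε := by
  rcases K.eq_empty_or_nonempty with rfl | hne
  · exact ⟨0, F.zero_mem, by simp⟩
  have h0 : (0 : E) ∈ K := hbal.zero_mem hne
  -- The graph of `u` over `K` is compact and convex in the topology that `F` and the last
  -- coordinate induce on `E × ℂ`. A functional `(f, z) ↦ v f + c z` that separates it from `(0, ε)`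
  -- has `c ≠ 0`, and `-v / c` is the approximant.
  let B : (E × ℂ) →ₗ[ℂ] (F × ℂ) →ₗ[ℂ] ℂ := LinearMap.mk₂ ℂ (fun p q => q.1.1 p.1 + q.2 * p.2)
    (fun p p' q => by simp [mul_add]; ring) (fun c p q => by simp; ring)
    (fun p q q' => by simp [add_mul]; ring) (fun c p q => by simp; ring)
  have hB : ∀ p q, B p q = q.1.1 p.1 + q.2 * p.2 := fun _ _ => rfl
  have hinj : Function.Injective B := by
    refine (injective_iff_map_eq_zero B).2 fun p hp => ?_
    have h1 : ∀ q, B p q = 0 := fun q => by rw [hp]; rfl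
    refine Prod.ext (hsep _ fun v hv => ?_) ?_
    · simpa [hB] using h1 (⟨v, hv⟩, 0)
    · simpa [hB] using h1 (0, 1)
  let Ψ : E →ₗ[ℝ] E × ℂ :=
    { toFun := fun f => ((f, u f) : E × ℂ)
      map_add' := fun f g => by rw [map_add]; rfl
      map_smul' := fun c f => by
        have : u (c • f) = c • u f := by
          rw [← Complex.coe_smul, map_smul, Complex.coe_smul]
        rw [this]; rfl }
  have hΨ : ∀ q, Continuous fun f => B (Ψ f) q := by
    intro q
    change Continuous fun f => q.1.1 f + q.2 * u f
    exact q.1.1.continuous.add (continuous_const.mul u.continuous)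
  have hdisj : ∀ f ∈ K, Ψ f ≠ ((0 : E), (ε : ℂ)) := by
    intro f _ hf
    have h1 : f = 0 := congrArg Prod.fst hf
    have h2 : u f = ε := congrArg Prod.snd hf
    rw [h1, map_zero] at h2
    exact hε.ne (by exact_mod_cast h2)
  obtain ⟨q, r, hG1, hG2⟩ := exists_separating_of_pairing (X := E × ℂ) (Y := F × ℂ) B hinj Ψ hΨ hK hconv
    hdisj
  have hG1' : ∀ f ∈ K, (q.1.1 f + q.2 * u f).re < r := fun f hf => hG1 f hf
  have hG2' : r < (q.2 * ε).re := by
    have : r < (q.1.1 0 + q.2 * ε).re := hG2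
    simpa using this
  have hq : q.2 ≠ 0 := by
    intro h
    have h1 := hG1' 0 h0
    rw [h] at hG2'
    simp at h1 hG2'
    linarith
  refine ⟨-(q.2⁻¹ • q.1.1), F.neg_mem (F.smul_mem _ q.1.2), fun f hf => ?_⟩
  set z : ℂ := q.1.1 f + q.2 * u f with hz
  have h1 : ‖z‖ ≤ ‖q.2‖ * ε := by
    rcases eq_or_ne z 0 with h | h
    · rw [h, norm_zero]; positivity
    -- Separation controls real parts only. Since `K` is balanced, `f` may be rotated by the phase
    -- of `z`, which gives the modulus.
    set c : ℂ := (starRingEnd ℂ) z / ‖z‖ with hc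
    have hz0 : (‖z‖ : ℂ) ≠ 0 := by simpa using h
    have hcn : ‖c‖ ≤ 1 := by
      rw [hc, norm_div, Complex.norm_conj, Complex.norm_real, norm_norm, div_self (by simpa using h)]
    have h2 := hG1' (c • f) (hbal c hcn ⟨f, hf, rfl⟩)
    have h3 : q.1.1 (c • f) + q.2 * u (c • f) = ‖z‖ := by
      rw [map_smul, map_smul, smul_eq_mul, smul_eq_mul]
      have : c * q.1.1 f + q.2 * (c * u f) = c * z := by rw [hz]; ring
      rw [this, hc, div_mul_eq_mul_div, ← Complex.normSq_eq_conj_mul_self,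
        Complex.normSq_eq_norm_sq, div_eq_iff hz0]
      push_cast
      ring
    rw [h3, Complex.ofReal_re] at h2
    refine (h2.trans hG2').le.trans ((Complex.re_le_norm _).trans ?_)
    rw [norm_mul, Complex.norm_real, Real.norm_of_nonneg hε.le]
  have h4 : u f - (-(q.2⁻¹ • q.1.1)) f = q.2⁻¹ * z := by
    rw [hz]
    simp
    field_simp
    ring
  rw [h4, norm_mul, norm_inv, inv_mul_le_iff₀ (by simpa using hq)]
  exact h1

end HahnBanach

/-! ### Spaces of test functions that are described by word bounds -/

/-- The stability properties of a class of weight sequences that are used below. -/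
structure IsWeightClass (W : Set (ℕ → ℝ)) : Prop where
  add : ∀ {w v : ℕ → ℝ}, w ∈ W → v ∈ W → (fun n => w n + v n) ∈ W
  shift : ∀ {w : ℕ → ℝ}, w ∈ W → (fun n => w (n + 1)) ∈ W
  scale : ∀ {w : ℕ → ℝ}, w ∈ W → ∀ C A : ℝ, 0 ≤ C → 0 ≤ A → (fun n => C * A ^ n * w n) ∈ W
  conv : ∀ {w v : ℕ → ℝ}, w ∈ W → v ∈ W → (∀ n, 0 ≤ w n) → (∀ n, 0 ≤ v n) →
    (fun n => ∑ j ∈ Finset.range (n + 1), w j * v (n - j)) ∈ W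
  split : ∀ {w : ℕ → ℝ}, w ∈ W → ∃ v ∈ W, (∀ n, 0 < v n) ∧ ∀ m n, w (m + n) ≤ v m * v n

/-- The topological vector space `E`, identified with a space of functions by `J`, is described by
the weight sequences in `W`: its elements are the functions with word bounds in `W`, its bounded
sets are those that are uniformly so bounded, and seminorms that are bounded on bounded sets are
continuous. -/
structure IsTestSpace {ι : Type} [Fintype ι] (W : Set (ℕ → ℝ)) {E : Type} [AddCommGroup E]
    [Module ℂ E] [TopologicalSpace E] (J : E →ₗ[ℂ] (EuclideanSpace ℝ ι → ℂ)) : Prop where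
  injective : Function.Injective J
  exists_eq : ∀ {w f}, w ∈ W → WordBdd w f → ∃ e, J e = f
  isVonNBounded_iff : ∀ B : Set E, Bornology.IsVonNBounded ℂ B ↔ ∃ w ∈ W, ∀ e ∈ B, WordBdd w (J e)
  continuous_seminorm : ∀ p : Seminorm ℂ E,
    (∀ w ∈ W, ∃ C : ℝ, ∀ e, WordBdd w (J e) → p e ≤ C) → Continuous p

/-- Splitting at length zero: `w n = w (0 + n) ≤ v 0 * v n`. -/
theorem IsWeightClass.exists_pos {W : Set (ℕ → ℝ)} (hW : IsWeightClass W) {w : ℕ → ℝ}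
    (hw : w ∈ W) : ∃ v ∈ W, (∀ n, 0 < v n) ∧ ∀ n, w n ≤ v n := by
  obtain ⟨v, hv, hpos, hle⟩ := hW.split hw
  refine ⟨_, hW.scale hv (v 0) 1 (hpos 0).le zero_le_one, fun n => ?_, fun n => ?_⟩
  · simpa using mul_pos (hpos 0) (hpos n)
  · simpa using hle 0 n

theorem IsWeightClass.shift_add {W : Set (ℕ → ℝ)} (hW : IsWeightClass W) {w : ℕ → ℝ}
    (hw : w ∈ W) (k : ℕ) : (fun n => w (n + k)) ∈ W := by
  induction k with
  | zero => exact hw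
  | succ k ih =>
    have := hW.shift ih
    simpa only [add_right_comm _ 1 k, add_assoc] using this

theorem IsWeightClass.decayBound {W : Set (ℕ → ℝ)} (hW : IsWeightClass W) (ι : Type) [Fintype ι]
    (m : ℕ) : ∀ {w : ℕ → ℝ}, w ∈ W → (fun n => decayBound ι m fun k => w (k + n)) ∈ W := by
  induction m with
  | zero => intro w hw; simpa [_root_.decayBound] using hw
  | succ m ih =>
    intro w hw
    have h1 := hW.add (ih hw) (hW.scale (hW.shift (ih hw)) (Fintype.card ι) 1 (by positivity)
      zero_le_one)
    simpa [_root_.decayBound, add_right_comm, add_assoc, add_comm, add_left_comm] using h1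

namespace IsTestSpace

open Topology Filter

variable {ι : Type} [Fintype ι] {W : Set (ℕ → ℝ)} {E : Type} [AddCommGroup E]
  [Module ℂ E] {J : E →ₗ[ℂ] (EuclideanSpace ℝ ι → ℂ)} {w : ℕ → ℝ}

theorem convex_setOf_wordBdd : Convex ℝ {e | WordBdd w (J e)} := by
  intro e he f hf a b ha hb hab
  rw [Set.mem_ofPred_eq, ← Complex.coe_smul, ← Complex.coe_smul, map_add, map_smul, map_smul]
  refine ((he.smul (a : ℂ)).add (hf.smul (b : ℂ))).mono fun n => le_of_eq ?_
  rw [Complex.norm_real, Complex.norm_real, Real.norm_of_nonneg ha, Real.norm_of_nonneg hb,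
    ← add_mul, hab, one_mul]

theorem balanced_setOf_wordBdd (hw : ∀ n, 0 ≤ w n) : Balanced ℂ {e | WordBdd w (J e)} := by
  rintro c hc _ ⟨e, he, rfl⟩
  change WordBdd w (J (c • e))
  rw [map_smul]
  exact (he.smul c).mono fun n => mul_le_of_le_one_left (hw n) hc

variable [TopologicalSpace E]

theorem isVonNBounded (hE : IsTestSpace W J) (hw : w ∈ W) :
    Bornology.IsVonNBounded ℂ {e | WordBdd w (J e)} :=
  (hE.isVonNBounded_iff _).2 ⟨w, hw, fun _ h => h⟩

theorem exists_wordBdd [ContinuousSMul ℂ E] (hE : IsTestSpace W J) (e : E) :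
    ∃ w ∈ W, WordBdd w (J e) := by
  obtain ⟨w, hw, h⟩ := (hE.isVonNBounded_iff {e}).1 (Bornology.isVonNBounded_singleton e)
  exact ⟨w, hw, h e rfl⟩

/-- A continuous functional is bounded on sets with uniform word bounds. -/
theorem exists_norm_le (hE : IsTestSpace W J) (u : StrongDual ℂ E) (hw : w ∈ W) :
    ∃ C : ℝ, 0 ≤ C ∧ ∀ e, WordBdd w (J e) → ‖u e‖ ≤ C := by
  have h := (hE.isVonNBounded hw).image u
  obtain ⟨C, hC⟩ := isBounded_iff_forall_norm_le.1 ((NormedSpace.isVonNBounded_iff ℂ).1 h)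
  exact ⟨|C|, abs_nonneg _, fun e he => (hC _ ⟨e, he, rfl⟩).trans (le_abs_self C)⟩

/-- Small multiples of sets with uniform word bounds are contained in a neighbourhood of zero. -/
theorem exists_pos_mem (hE : IsTestSpace W J) (hw : w ∈ W) {U : Set E} (hU : U ∈ 𝓝 (0 : E)) :
    ∃ ε > 0, ∀ e, WordBdd (fun n => ε * w n) (J e) → e ∈ U := by
  have h := hE.isVonNBounded hw hU
  obtain ⟨r, h⟩ := absorbs_iff_norm.1 h
  set R : ℝ := max r 1
  have hR : 0 < R := lt_max_of_lt_right one_pos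
  refine ⟨R⁻¹, by positivity, fun e he => ?_⟩
  have h1 := h (R : ℂ) (by
    rw [Complex.norm_real, Real.norm_of_nonneg hR.le]; exact le_max_left _ _) (a := (R : ℂ) • e) (by
    have h2 := he.smul (R : ℂ)
    rw [Set.mem_ofPred_eq, map_smul]
    refine h2.mono fun n => le_of_eq ?_
    rw [Complex.norm_real, Real.norm_of_nonneg hR.le]
    field_simp)
  rwa [Set.smul_mem_smul_set_iff₀ (by exact_mod_cast hR.ne')] at h1

/-- A neighbourhood of zero contains all functions with word bounds `ε 2^n v n`. For words of length
at least `N` the gain `2^n` beats `ε⁻¹`, so the common weight already suffices; finitely many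
shorter words remain. -/
theorem tendsto_zero_of_uniform (hW : IsWeightClass W) (hE : IsTestSpace W J) (hw : w ∈ W)
    {α : Type*} {l : Filter α} {g : α → E} (hg : ∀ᶠ a in l, WordBdd w (J (g a)))
    (h : ∀ τ, ∀ ε > 0, ∀ᶠ a in l, ∀ x, ‖wordOp τ (J (g a)) x‖ ≤ ε) : Tendsto g l (𝓝 0) := by
  obtain ⟨v, hv, hpos, hle⟩ := hW.exists_pos hw
  have hv2 := hW.scale hv 1 2 zero_le_one zero_le_two
  intro U hU
  obtain ⟨ε, hε, hεU⟩ := hE.exists_pos_mem hv2 hU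
  obtain ⟨N, hN⟩ := pow_unbounded_of_one_lt ε⁻¹ (one_lt_two : (1 : ℝ) < 2)
  have h1 : ∀ᶠ a in l, ∀ τ ∈ {τ : List (ι ⊕ ι) | τ.length < N}, ∀ x,
      ‖wordOp τ (J (g a)) x‖ ≤ ε * (1 * 2 ^ τ.length * v τ.length) :=
    (eventually_all_finite (List.finite_length_lt _ N)).2 fun τ _ => h τ _ (by
      have := hpos τ.length
      positivity)
  refine mem_map.2 ?_
  filter_upwards [hg, h1] with a ha1 ha2
  refine hεU _ ⟨ha1.1, fun τ x => ?_⟩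
  rcases lt_or_ge τ.length N with hτ | hτ
  · exact ha2 τ hτ x
  · refine (ha1.2 τ x).trans ((hle _).trans ?_)
    have h2 : ε⁻¹ ≤ 2 ^ τ.length := hN.le.trans (pow_le_pow_right₀ one_le_two hτ)
    rw [inv_le_iff_one_le_mul₀ hε] at h2
    have := hpos τ.length
    nlinarith

/-- On sets with uniform word bounds, pointwise convergence of all derivatives implies
convergence. -/
theorem tendsto_zero_of_pointwise (hW : IsWeightClass W) (hE : IsTestSpace W J) (hw : w ∈ W)
    {α : Type*} {l : Filter α} {g : α → E} (hg : ∀ᶠ a in l, WordBdd w (J (g a)))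
    (h : ∀ τ x, Tendsto (fun a => wordOp τ (J (g a)) x) l (𝓝 0)) : Tendsto g l (𝓝 0) := by
  refine tendsto_zero_of_uniform hW hE hw hg fun τ ε hε => ?_
  -- `D` serves twice: as a Lipschitz constant, so that a finite `δ`-net handles the ball of radius
  -- `D / ε`, and as a bound for `‖x‖` times the function, which handles the complement.
  set D : ℝ := Fintype.card ι * |w (τ.length + 1)| with hD
  have hD0 : 0 ≤ D := by positivity
  set δ : ℝ := ε / (2 * (D + 1)) with hδ
  have hδ0 : 0 < δ := by positivity
  obtain ⟨t, _, htfin, htcov⟩ :=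
    (isCompact_closedBall (0 : EuclideanSpace ℝ ι) (D / ε)).finite_cover_balls hδ0
  have h1 : ∀ᶠ a in l, ∀ y ∈ t, ‖wordOp τ (J (g a)) y‖ ≤ ε / 2 := by
    refine (eventually_all_finite htfin).2 fun y _ => ?_
    have := (h τ y).norm
    rw [norm_zero] at this
    exact (this.eventually (gt_mem_nhds (half_pos hε))).mono fun _ => le_of_lt
  filter_upwards [hg, h1] with a ha1 ha2 x
  by_cases hx : ‖x‖ ≤ D / ε
  · obtain ⟨y, hy, hxy⟩ := Set.mem_iUnion₂.1 (htcov (by simpa using hx : x ∈ Metric.closedBall 0 (D / ε)))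
    have h2 := norm_sub_le_of_letterOp (abs_nonneg (w (τ.length + 1))) (ha1.1.wordOp τ)
      (fun i z => (ha1.2 (.inr i :: τ) z).trans (le_abs_self _)) y x
    rw [← hD] at h2
    have h3 : ‖x - y‖ ≤ δ := by
      rw [← dist_eq_norm]; exact (Metric.mem_ball.1 hxy).le
    have h4 : D * ‖x - y‖ ≤ ε / 2 := by
      calc D * ‖x - y‖ ≤ (D + 1) * δ := by gcongr; linarith
        _ = ε / 2 := by rw [hδ]; field_simp
    calc ‖wordOp τ (J (g a)) x‖
        = ‖wordOp τ (J (g a)) x - wordOp τ (J (g a)) y + wordOp τ (J (g a)) y‖ := by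
          rw [sub_add_cancel]
      _ ≤ ε / 2 + ε / 2 := (norm_add_le _ _).trans (add_le_add (h2.trans h4) (ha2 y hy))
      _ = ε := add_halves ε
  · push Not at hx
    have h2 : ‖x‖ * ‖wordOp τ (J (g a)) x‖ ≤ D := by
      calc ‖x‖ * ‖wordOp τ (J (g a)) x‖ ≤ (∑ i, |x i|) * ‖wordOp τ (J (g a)) x‖ := by
            gcongr; exact norm_le_sum_abs x
        _ = ∑ i, ‖wordOp (.inl i :: τ) (J (g a)) x‖ := by
            rw [Finset.sum_mul]
            simp [wordOp_cons, letterOp_inl]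
        _ ≤ ∑ _i : ι, |w (τ.length + 1)| :=
            Finset.sum_le_sum fun i _ => (ha1.2 (.inl i :: τ) x).trans (le_abs_self _)
        _ = D := by simp [hD]
    rw [div_lt_iff₀ hε] at hx
    by_contra hcon
    push Not at hcon
    have hx0 : 0 < ‖x‖ := by
      rcases (norm_nonneg x).eq_or_lt with h0 | h0
      · rw [← h0] at hx; linarith
      · exact h0
    nlinarith

/-- Sets with uniform word bounds are compact. -/
theorem isCompact_setOf_wordBdd [IsTopologicalAddGroup E] (hW : IsWeightClass W)
    (hE : IsTestSpace W J) (hw : w ∈ W) : IsCompact {e | WordBdd w (J e)} := by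
  rw [isCompact_iff_ultrafilter_le_nhds]
  intro U hU
  rw [le_principal_iff] at hU
  -- All values of all words converge along the ultrafilter. The limits inherit the letter relations
  -- and the uniform Taylor remainders, hence are the words of one smooth limit function.
  have hlim : ∀ τ x, ∃ z, Tendsto (fun e => wordOp τ (J e) x) U (𝓝 z) := by
    intro τ x
    obtain ⟨z, _, hz⟩ := (isCompact_closedBall (0 : ℂ) (w τ.length)).ultrafilter_le_nhds
      (U.map fun e => wordOp τ (J e) x) (by
        rw [le_principal_iff]
        refine mem_map.2 (mem_of_superset hU fun e he => ?_)
        simpa using he.2 τ x)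
    exact ⟨z, hz⟩
  choose Φ hΦ using hlim
  obtain ⟨h1, h2⟩ := wordBdd_of_family (w := w) Φ
    (fun τ i x => tendsto_nhds_unique ((hΦ τ x).const_mul (x i : ℂ)) (hΦ (.inl i :: τ) x))
    (fun τ => ⟨(Fintype.card ι) ^ 2 * |w (τ.length + 2)|, fun x k =>
      le_of_tendsto ((((hΦ τ (x + k)).sub (hΦ τ x)).sub (tendsto_finsetSum _ fun i _ =>
        (hΦ (.inr i :: τ) x).const_mul (k i : ℂ))).norm)
        (mem_of_superset hU fun e he => he.norm_taylor_le τ x k)⟩)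
    (fun τ x => le_of_tendsto (hΦ τ x).norm (mem_of_superset hU fun e he => he.2 τ x))
  obtain ⟨e, he⟩ := hE.exists_eq hw h1
  refine ⟨e, by rwa [Set.mem_ofPred_eq, he], ?_⟩
  have h3 : Tendsto (fun e' => e' - e) U (𝓝 0) := by
    refine tendsto_zero_of_pointwise hW hE (w := fun n => w n + ‖(-1 : ℂ)‖ * w n)
      (hW.add hw (by simpa using hw)) ?_ fun τ x => ?_
    · refine mem_of_superset hU fun e' he' => ?_
      have := he'.add (h1.smul (-1))
      rw [← he, ← map_smul, ← map_add] at this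
      simpa [sub_eq_add_neg] using this
    · have h4 := (hΦ τ x).sub_const (Φ τ x)
      rw [sub_self] at h4
      refine h4.congr' (mem_of_superset hU fun e' he' => ?_)
      change wordOp τ (J e') x - Φ τ x = wordOp τ (J (e' - e)) x
      rw [map_sub, wordOp_sub he'.1 (by rw [he]; exact h1.1), he, h2]
      rfl
  have h4 := h3.add_const e
  simp only [sub_add_cancel, zero_add] at h4
  exact h4

/-- Evaluation at a point is continuous. -/
theorem continuous_eval [IsTopologicalAddGroup E] (hE : IsTestSpace W J) (x : EuclideanSpace ℝ ι) :
    Continuous fun e => J e x := by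
  let L : E →ₗ[ℂ] ℂ := LinearMap.proj x ∘ₗ J
  have h1 : Continuous ((normSeminorm ℂ ℂ).comp L) :=
    hE.continuous_seminorm _ fun w _ => ⟨w 0, fun e he => he.bound x⟩
  refine continuous_of_continuousAt_zero L ?_
  rw [ContinuousAt, map_zero, tendsto_zero_iff_norm_tendsto_zero]
  have h2 := h1.tendsto 0
  rw [map_zero] at h2
  exact h2

/-- The functionals `g ↦ ∫ f g` are dense in the strong dual. -/
theorem denseRange_toDual [IsTopologicalAddGroup E] [ContinuousSMul ℂ E] (hW : IsWeightClass W)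
    (hE : IsTestSpace W J) (D : E → StrongDual ℂ E) (hD : ∀ f g, D f g = ∫ x, J f x * J g x) :
    DenseRange D := by
  have hint : ∀ f g, Integrable fun x => J f x * J g x := fun f g => by
    obtain ⟨w, _, hf⟩ := hE.exists_wordBdd f
    obtain ⟨v, _, hg⟩ := hE.exists_wordBdd g
    exact hf.integrable_mul hg
  let F : Submodule ℂ (StrongDual ℂ E) :=
    { carrier := Set.range D
      zero_mem' := ⟨0, by ext g; simp [hD]⟩
      add_mem' := by
        rintro _ _ ⟨f, rfl⟩ ⟨g, rfl⟩
        refine ⟨f + g, ?_⟩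
        ext k
        simp only [hD, map_add, Pi.add_apply, add_mul, add_apply]
        exact integral_add (hint _ _) (hint _ _)
      smul_mem' := by
        rintro c _ ⟨f, rfl⟩
        refine ⟨c • f, ?_⟩
        ext k
        simp only [hD, map_smul, Pi.smul_apply, smul_eq_mul, mul_assoc,
          smul_apply]
        exact integral_const_mul _ _ }
  -- Testing `f` against its own conjugate gives `∫ |f|² = 0`; the conjugate satisfies the same word
  -- bounds.
  have hsep : ∀ f : E, (∀ v ∈ F, v f = 0) → f = 0 := by
    intro f hf
    obtain ⟨w, hw, hfw⟩ := hE.exists_wordBdd f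
    obtain ⟨g, hg⟩ := hE.exists_eq hw hfw.conj
    have h1 := hf (D g) ⟨g, rfl⟩
    rw [hD, hg] at h1
    have h2 : ∀ x, (starRingEnd ℂ) (J f x) * J f x = ((‖J f x‖ ^ 2 : ℝ) : ℂ) := fun x => by
      rw [← Complex.normSq_eq_conj_mul_self, Complex.normSq_eq_norm_sq]
    simp only [h2] at h1
    rw [integral_complex_ofReal] at h1
    have h3 : ∫ x, ‖J f x‖ ^ 2 = 0 := by exact_mod_cast h1
    have hcont : Continuous fun x => ‖J f x‖ ^ 2 := hfw.1.continuous.norm.pow 2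
    have hi : Integrable fun x => ‖J f x‖ ^ 2 := by
      have := (hfw.conj.integrable_mul hfw).norm
      simp only [h2, Complex.norm_real] at this
      simpa using this
    rw [integral_eq_zero_iff_of_nonneg (fun x => by positivity) hi,
      hcont.ae_eq_iff_eq _ continuous_zero] at h3
    refine hE.injective ?_
    ext x
    simpa using congrFun h3 x
  intro u
  rw [mem_closure_iff_nhds]
  intro U hU
  have hU0 : (fun v => v + u) ⁻¹' U ∈ 𝓝 (0 : StrongDual ℂ E) :=
    (continuous_add_const u).continuousAt.preimage_mem_nhds (by simpa using hU)
  obtain ⟨⟨S, r⟩, ⟨hS, hr⟩, hsub⟩ := (ContinuousLinearMap.hasBasis_nhds_zero_of_basis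
    Metric.nhds_basis_closedBall).mem_iff.1 hU0
  -- The bounded set `S` of a basic strong neighbourhood is enclosed in a compact convex balanced
  -- set; a positive weight is needed for balancedness.
  obtain ⟨w, hw, hSw⟩ := (hE.isVonNBounded_iff S).1 hS
  obtain ⟨v, hv, hpos, hle⟩ := hW.exists_pos hw
  obtain ⟨_, ⟨f, rfl⟩, hf⟩ := exists_mem_norm_sub_le_of_separating F hsep u
    (isCompact_setOf_wordBdd hW hE hv) convex_setOf_wordBdd
    (balanced_setOf_wordBdd fun n => (hpos n).le) hr
  refine ⟨D f, ?_, f, rfl⟩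
  have h1 : D f - u ∈ (fun v => v + u) ⁻¹' U := hsub fun x hx => by
    rw [mem_closedBall_zero_iff, sub_apply, norm_sub_rev]
    exact hf x ((hSw x hx).mono hle)
  simpa using h1

end IsTestSpace

/-! ### Phase space coordinates, slices and tensor products -/

section Phase

variable {d : ℕ}

/-- The point `(x, ξ)` of phase space as a linear function of the pair. -/
def phaseCLM (d : ℕ) : EuclideanSpace ℝ (Fin d) × EuclideanSpace ℝ (Fin d) →L[ℝ]
    EuclideanSpace ℝ (Fin d ⊕ Fin d) :=
  LinearMap.toContinuousLinearMap
    { toFun := fun p => phasePoint p.1 p.2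
      map_add' := fun p q => by ext (i | i) <;> rfl
      map_smul' := fun c p => by ext (i | i) <;> rfl }

/-- The first component of a point of phase space. -/
def phaseFst (d : ℕ) : EuclideanSpace ℝ (Fin d ⊕ Fin d) →L[ℝ] EuclideanSpace ℝ (Fin d) :=
  LinearMap.toContinuousLinearMap
    { toFun := fun v => WithLp.toLp 2 fun i => v (.inl i)
      map_add' := fun p q => by ext i; rfl
      map_smul' := fun c p => by ext i; rfl }

/-- The second component of a point of phase space. -/
def phaseSnd (d : ℕ) : EuclideanSpace ℝ (Fin d ⊕ Fin d) →L[ℝ] EuclideanSpace ℝ (Fin d) :=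
  LinearMap.toContinuousLinearMap
    { toFun := fun v => WithLp.toLp 2 fun i => v (.inr i)
      map_add' := fun p q => by ext i; rfl
      map_smul' := fun c p => by ext i; rfl }

theorem phaseCLM_apply (p : EuclideanSpace ℝ (Fin d) × EuclideanSpace ℝ (Fin d)) :
    phaseCLM d p = phasePoint p.1 p.2 := rfl

theorem phaseFst_coord (v : EuclideanSpace ℝ (Fin d ⊕ Fin d)) (i : Fin d) :
    phaseFst d v i = v (.inl i) := rfl

theorem phaseSnd_coord (v : EuclideanSpace ℝ (Fin d ⊕ Fin d)) (i : Fin d) :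
    phaseSnd d v i = v (.inr i) := rfl

theorem phasePoint_inl (x ξ : EuclideanSpace ℝ (Fin d)) (i : Fin d) :
    phasePoint x ξ (.inl i) = x i := rfl

theorem phasePoint_inr (x ξ : EuclideanSpace ℝ (Fin d)) (i : Fin d) :
    phasePoint x ξ (.inr i) = ξ i := rfl

theorem phaseFst_phasePoint (x ξ : EuclideanSpace ℝ (Fin d)) :
    phaseFst d (phasePoint x ξ) = x := rfl

theorem phaseSnd_phasePoint (x ξ : EuclideanSpace ℝ (Fin d)) :
    phaseSnd d (phasePoint x ξ) = ξ := rfl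

theorem phasePoint_eta (v : EuclideanSpace ℝ (Fin d ⊕ Fin d)) :
    phasePoint (phaseFst d v) (phaseSnd d v) = v := by
  ext (i | i) <;> rfl

theorem phaseFst_basis_inl (i : Fin d) :
    phaseFst d (EuclideanSpace.basisFun _ ℝ (.inl i)) = EuclideanSpace.basisFun _ ℝ i := by
  ext j; simp [phaseFst_coord]

theorem phaseFst_basis_inr (i : Fin d) :
    phaseFst d (EuclideanSpace.basisFun _ ℝ (.inr i)) = 0 := by
  ext j; simp [phaseFst_coord]

theorem phaseSnd_basis_inl (i : Fin d) :
    phaseSnd d (EuclideanSpace.basisFun _ ℝ (.inl i)) = 0 := by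
  ext j; simp [phaseSnd_coord]

theorem phaseSnd_basis_inr (i : Fin d) :
    phaseSnd d (EuclideanSpace.basisFun _ ℝ (.inr i)) = EuclideanSpace.basisFun _ ℝ i := by
  ext j; simp [phaseSnd_coord]

theorem phaseCLM_zero_basis (i : Fin d) :
    phaseCLM d (0, EuclideanSpace.basisFun _ ℝ i) = EuclideanSpace.basisFun _ ℝ (.inr i) := by
  ext (j | j) <;> simp [phaseCLM_apply, phasePoint_inl, phasePoint_inr]

/-- The function `y ↦ k (x, y)`. -/
def slice (k : EuclideanSpace ℝ (Fin d ⊕ Fin d) → ℂ) (x y : EuclideanSpace ℝ (Fin d)) : ℂ :=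
  k (phasePoint x y)

theorem hasFDerivAt_phasePoint_right (x y : EuclideanSpace ℝ (Fin d)) :
    HasFDerivAt (fun y => phasePoint x y)
      (phaseCLM d ∘L ContinuousLinearMap.inr ℝ _ _) y :=
  (phaseCLM d).hasFDerivAt.comp y (hasFDerivAt_prodMk_right x y)

theorem contDiff_slice {k : EuclideanSpace ℝ (Fin d ⊕ Fin d) → ℂ} (hk : ContDiff ℝ ∞ k)
    (x : EuclideanSpace ℝ (Fin d)) : ContDiff ℝ ∞ (slice k x) :=
  hk.comp ((phaseCLM d).contDiff.comp (contDiff_prodMk_right x))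

theorem letterOp_slice {k : EuclideanSpace ℝ (Fin d ⊕ Fin d) → ℂ} (hk : ContDiff ℝ ∞ k)
    (x : EuclideanSpace ℝ (Fin d)) (ℓ : Fin d ⊕ Fin d) :
    letterOp ℓ (slice k x) = slice (letterOp (ℓ.map Sum.inr Sum.inr) k) x := by
  rcases ℓ with i | i <;> ext y
  · rfl
  · have h := (hk.diffAt (phasePoint x y)).hasFDerivAt.comp y (hasFDerivAt_phasePoint_right x y)
    rw [letterOp_inr]
    change fderiv ℝ (k ∘ fun y => phasePoint x y) y _ = _
    rw [h.fderiv]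
    simp only [ContinuousLinearMap.comp_apply, ContinuousLinearMap.inr_apply, phaseCLM_zero_basis]
    rfl

theorem wordOp_slice {k : EuclideanSpace ℝ (Fin d ⊕ Fin d) → ℂ} (hk : ContDiff ℝ ∞ k)
    (x : EuclideanSpace ℝ (Fin d)) (τ : List (Fin d ⊕ Fin d)) :
    wordOp τ (slice k x) = slice (wordOp (τ.map (Sum.map Sum.inr Sum.inr)) k) x := by
  induction τ with
  | nil => rfl
  | cons ℓ τ ih => rw [wordOp_cons, ih, letterOp_slice (hk.wordOp _)]; rfl

theorem WordBdd.slice {k : EuclideanSpace ℝ (Fin d ⊕ Fin d) → ℂ} {w : ℕ → ℝ} (hk : WordBdd w k)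
    (x : EuclideanSpace ℝ (Fin d)) : WordBdd w (slice k x) :=
  ⟨contDiff_slice hk.1 x, fun τ y => by
    rw [wordOp_slice hk.1]
    exact (hk.2 _ _).trans (by simp)⟩

/-- The function `g ⊗ f` on phase space. -/
def tensor (g f : EuclideanSpace ℝ (Fin d) → ℂ) (v : EuclideanSpace ℝ (Fin d ⊕ Fin d)) : ℂ :=
  g (phaseFst d v) * f (phaseSnd d v)

theorem contDiff_tensor {g f : EuclideanSpace ℝ (Fin d) → ℂ} (hg : ContDiff ℝ ∞ g)
    (hf : ContDiff ℝ ∞ f) : ContDiff ℝ ∞ (tensor g f) :=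
  (hg.comp (phaseFst d).contDiff).mul (hf.comp (phaseSnd d).contDiff)

theorem fderiv_tensor {g f : EuclideanSpace ℝ (Fin d) → ℂ} (hg : ContDiff ℝ ∞ g)
    (hf : ContDiff ℝ ∞ f) (v k : EuclideanSpace ℝ (Fin d ⊕ Fin d)) :
    fderiv ℝ (tensor g f) v k = fderiv ℝ g (phaseFst d v) (phaseFst d k) * f (phaseSnd d v)
      + g (phaseFst d v) * fderiv ℝ f (phaseSnd d v) (phaseSnd d k) := by
  have h1 := (hg.diffAt (phaseFst d v)).hasFDerivAt.comp v (phaseFst d).hasFDerivAt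
  have h2 := (hf.diffAt (phaseSnd d v)).hasFDerivAt.comp v (phaseSnd d).hasFDerivAt
  have h3 : HasFDerivAt (tensor g f) _ v := h1.mul h2
  rw [h3.fderiv]
  simp
  ring

/-- Every coordinate and every partial derivative of phase space belongs to just one of the two
variables, so it passes the other factor as a constant. -/
theorem letterOp_tensor {g f : EuclideanSpace ℝ (Fin d) → ℂ} (hg : ContDiff ℝ ∞ g)
    (hf : ContDiff ℝ ∞ f) (ℓ : (Fin d ⊕ Fin d) ⊕ (Fin d ⊕ Fin d)) :
    (∃ m, letterOp ℓ (tensor g f) = tensor (letterOp m g) f) ∨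
      ∃ m, letterOp ℓ (tensor g f) = tensor g (letterOp m f) := by
  rcases ℓ with (i | i) | (i | i)
  · refine Or.inl ⟨.inl i, ?_⟩
    ext v
    simp [letterOp_inl, tensor, phaseFst_coord, mul_assoc]
  · refine Or.inr ⟨.inl i, ?_⟩
    ext v
    simp [letterOp_inl, tensor, phaseSnd_coord, mul_left_comm]
  · refine Or.inl ⟨.inr i, ?_⟩
    ext v
    rw [letterOp_inr, fderiv_tensor hg hf, phaseFst_basis_inl, phaseSnd_basis_inl]
    simp [letterOp_inr, tensor]
  · refine Or.inr ⟨.inr i, ?_⟩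
    ext v
    rw [letterOp_inr, fderiv_tensor hg hf, phaseFst_basis_inr, phaseSnd_basis_inr]
    simp [letterOp_inr, tensor]

theorem wordOp_tensor {g f : EuclideanSpace ℝ (Fin d) → ℂ} (hg : ContDiff ℝ ∞ g)
    (hf : ContDiff ℝ ∞ f) (τ : List ((Fin d ⊕ Fin d) ⊕ (Fin d ⊕ Fin d))) :
    ∃ τ₁ τ₂, τ₁.length + τ₂.length = τ.length ∧
      wordOp τ (tensor g f) = tensor (wordOp τ₁ g) (wordOp τ₂ f) := by
  induction τ with
  | nil => exact ⟨[], [], rfl, rfl⟩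
  | cons ℓ τ ih =>
    obtain ⟨τ₁, τ₂, hl, h⟩ := ih
    rw [wordOp_cons, h]
    rcases letterOp_tensor (hg.wordOp τ₁) (hf.wordOp τ₂) ℓ with ⟨m, hm⟩ | ⟨m, hm⟩
    · exact ⟨m :: τ₁, τ₂, by simp [← hl]; ring, hm⟩
    · exact ⟨τ₁, m :: τ₂, by simp [← hl]; ring, hm⟩

/-- The length of a word does not determine how its letters are shared between the factors, so the
bound sums over all splittings of the length. -/
theorem WordBdd.tensor {g f : EuclideanSpace ℝ (Fin d) → ℂ} {w v : ℕ → ℝ} (hg : WordBdd w g)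
    (hf : WordBdd v f) (hw : ∀ n, 0 ≤ w n) (hv : ∀ n, 0 ≤ v n) :
    WordBdd (fun n => ∑ j ∈ Finset.range (n + 1), w j * v (n - j)) (tensor g f) := by
  refine ⟨contDiff_tensor hg.1 hf.1, fun τ x => ?_⟩
  obtain ⟨τ₁, τ₂, hl, h⟩ := wordOp_tensor hg.1 hf.1 τ
  rw [h, _root_.tensor, norm_mul]
  refine le_trans (mul_le_mul (hg.2 τ₁ _) (hf.2 τ₂ _) (norm_nonneg _) (hw _)) ?_
  have : τ₂.length = τ.length - τ₁.length := by omega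
  rw [this]
  exact Finset.single_le_sum (f := fun j => w j * v (τ.length - j))
    (fun j _ => mul_nonneg (hw _) (hv _)) (Finset.mem_range.2 (by omega))

end Phase

/-! ### Linear substitutions and averages -/

section Pullback

variable {ι : Type} [Fintype ι] {G : EuclideanSpace ℝ ι → ℂ} {w : ℕ → ℝ}

/-- The matrix that describes how letters commute with the substitution of `L`, whose left inverse
is `R`. -/
def pullbackCoef (L R : EuclideanSpace ℝ ι →L[ℝ] EuclideanSpace ℝ ι) : ι ⊕ ι → ι → ℝ
  | .inl i, j => R (EuclideanSpace.basisFun ι ℝ j) i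
  | .inr i, j => L (EuclideanSpace.basisFun ι ℝ i) j

/-- The letter of the same kind as a given one and with index `j`. -/
def letterAt (ℓ : ι ⊕ ι) (j : ι) : ι ⊕ ι := ℓ.map (fun _ => j) (fun _ => j)

/-- The coordinates of `v` are linear in those of `L v` through the left inverse `R`, and
derivatives transform by the chain rule through `L`. Neither kind of letter is converted into the
other. -/
theorem letterOp_pullback {L R : EuclideanSpace ℝ ι →L[ℝ] EuclideanSpace ℝ ι}
    (hRL : ∀ v, R (L v) = v) (hG : ContDiff ℝ ∞ G) (ℓ : ι ⊕ ι) :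
    letterOp ℓ (fun v => G (L v))
      = ∑ j, (pullbackCoef L R ℓ j : ℂ) • fun v => letterOp (letterAt ℓ j) G (L v) := by
  rcases ℓ with i | i <;> ext v
  · have h : v i = ∑ j, R (EuclideanSpace.basisFun ι ℝ j) i * L v j := by
      conv_lhs => rw [← hRL v, ← sum_coord_smul_basisFun (L v)]
      simp [map_sum, mul_comm]
    rw [letterOp_inl, h]
    simp only [Finset.sum_apply, Pi.smul_apply, smul_eq_mul, letterAt, Sum.map_inl, letterOp_inl,
      pullbackCoef]
    push_cast
    rw [Finset.sum_mul]
    simp only [mul_assoc]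
  · have h := (hG.diffAt (L v)).hasFDerivAt.comp v L.hasFDerivAt
    rw [letterOp_inr]
    change fderiv ℝ (G ∘ L) v _ = _
    rw [h.fderiv, ContinuousLinearMap.comp_apply, clm_apply_eq_sum]
    simp [letterAt, letterOp_inr, pullbackCoef]

theorem contDiff_pullback (L : EuclideanSpace ℝ ι →L[ℝ] EuclideanSpace ℝ ι)
    (hG : ContDiff ℝ ∞ G) : ContDiff ℝ ∞ fun v => G (L v) := hG.comp L.contDiff

theorem wordOp_concat_pullback {L R : EuclideanSpace ℝ ι →L[ℝ] EuclideanSpace ℝ ι}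
    (hRL : ∀ v, R (L v) = v) (hG : ContDiff ℝ ∞ G) (τ : List (ι ⊕ ι)) (ℓ : ι ⊕ ι)
    (v : EuclideanSpace ℝ ι) :
    wordOp (τ ++ [ℓ]) (fun v => G (L v)) v = ∑ j, (pullbackCoef L R ℓ j : ℂ) *
      wordOp τ (fun v => letterOp (letterAt ℓ j) G (L v)) v := by
  rw [wordOp_concat, letterOp_pullback hRL hG, wordOp_sum]
  · simp only [Finset.sum_apply]
    refine Finset.sum_congr rfl fun j _ => ?_
    rw [wordOp_smul (contDiff_pullback L (hG.letterOp _))]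
    rfl
  · exact fun j => (contDiff_pullback L (hG.letterOp _)).const_smul (pullbackCoef L R ℓ j : ℂ)

theorem WordBdd.pullback {L R : EuclideanSpace ℝ ι →L[ℝ] EuclideanSpace ℝ ι}
    (hRL : ∀ v, R (L v) = v) {A : ℝ} (hA : 0 ≤ A) (hcoef : ∀ ℓ j, |pullbackCoef L R ℓ j| ≤ A)
    (hG : WordBdd w G) :
    WordBdd (fun n => 1 * (Fintype.card ι * A) ^ n * w n) fun v => G (L v) := by
  refine ⟨contDiff_pullback L hG.1, fun τ x => ?_⟩
  -- The last letter acts on the function before all others, so it is the one that meets the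
  -- substitution. Each such letter costs `card ι` terms with coefficients at most `A`.
  induction τ using List.reverseRecOn generalizing G w with
  | nil => simpa using! hG.bound (L x)
  | append_singleton τ ℓ ih =>
    rw [wordOp_concat_pullback hRL hG.1]
    refine (norm_sum_le _ _).trans ?_
    calc _ ≤ ∑ _j : ι, A * (1 * (Fintype.card ι * A) ^ τ.length * w (τ.length + 1)) := by
          gcongr with j
          rw [norm_mul, Complex.norm_real]
          exact mul_le_mul (hcoef ℓ j) (ih (hG.letterOp _)) (norm_nonneg _) hA
      _ = _ := by
          simp [pow_succ]
          ring

theorem continuous_wordOp_pullback {L R : ℝ → EuclideanSpace ℝ ι →L[ℝ] EuclideanSpace ℝ ι}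
    (hRL : ∀ t v, R t (L t v) = v) (hL : ∀ v, Continuous fun t => L t v)
    (hR : ∀ v, Continuous fun t => R t v) (hG : ContDiff ℝ ∞ G) (τ : List (ι ⊕ ι))
    (x : EuclideanSpace ℝ ι) : Continuous fun t => wordOp τ (fun v => G (L t v)) x := by
  induction τ using List.reverseRecOn generalizing G with
  | nil => exact hG.continuous.comp (hL x)
  | append_singleton τ ℓ ih =>
    simp only [wordOp_concat_pullback (hRL _) hG]
    refine continuous_finsetSum _ fun j _ => Continuous.mul ?_ (ih (hG.letterOp _))
    refine Complex.continuous_ofReal.comp ?_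
    rcases ℓ with i | i
    · exact (EuclideanSpace.proj i : EuclideanSpace ℝ ι →L[ℝ] ℝ).continuous.comp (hR _)
    · exact (EuclideanSpace.proj j : EuclideanSpace ℝ ι →L[ℝ] ℝ).continuous.comp (hL _)

/-- Averages of functions with uniform word bounds. -/
theorem WordBdd.average {H : ℝ → EuclideanSpace ℝ ι → ℂ}
    (hH : ∀ t ∈ Set.Icc (0 : ℝ) 1, WordBdd w (H t))
    (hc : ∀ τ x, Continuous fun t => _root_.wordOp τ (H t) x) :
    WordBdd w fun x => ∫ t in (0 : ℝ)..1, H t x := by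
  have hi : ∀ τ x, IntervalIntegrable (fun t => _root_.wordOp τ (H t) x) volume 0 1 :=
    fun τ x => (hc τ x).intervalIntegrable _ _
  have hbound : ∀ {F : ℝ → ℂ} {C : ℝ}, (∀ t ∈ Set.Icc (0 : ℝ) 1, ‖F t‖ ≤ C) →
      ‖∫ t in (0 : ℝ)..1, F t‖ ≤ C := by
    intro F C hF
    have := intervalIntegral.norm_integral_le_of_norm_le_const (a := (0 : ℝ)) (b := 1) (f := F)
      (C := C) fun t ht => hF t (by
        rw [Set.uIoc_of_le zero_le_one] at ht
        exact ⟨ht.1.le, ht.2⟩)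
    simpa using this
  refine (wordBdd_of_family (fun τ x => ∫ t in (0 : ℝ)..1, _root_.wordOp τ (H t) x)
    (fun τ i x => ?_) (fun τ => ⟨(Fintype.card ι) ^ 2 * |w (τ.length + 2)|, fun x k => ?_⟩)
    (fun τ x => hbound fun t ht => (hH t ht).2 τ x)).1
  · exact (intervalIntegral.integral_const_mul (x i : ℂ) _).symm
  · have hs : IntervalIntegrable
        (fun t => ∑ i, (k i : ℂ) * _root_.wordOp (.inr i :: τ) (H t) x) volume 0 1 :=
      (continuous_finsetSum _ fun i _ => continuous_const.mul (hc _ _)).intervalIntegrable _ _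
    simp_rw [← intervalIntegral.integral_const_mul]
    rw [← intervalIntegral.integral_sub (hi _ _) (hi _ _),
      ← intervalIntegral.integral_finsetSum fun i _ => (hi _ _).const_mul _,
      ← intervalIntegral.integral_sub ((hi _ _).sub (hi _ _))
        hs]
    exact hbound fun t ht => (hH t ht).norm_taylor_le τ x k

end Pullback

/-! ### The partial Fourier transform -/

section PartialFourier

variable {d : ℕ}

/-- The plane wave `e^{i⟨z,ξ⟩}`. -/
def planeWave (z ξ : EuclideanSpace ℝ (Fin d)) : ℂ := Complex.exp (Complex.I * (inner ℝ z ξ : ℝ))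

theorem norm_planeWave (z ξ : EuclideanSpace ℝ (Fin d)) : ‖planeWave z ξ‖ = 1 := by
  rw [planeWave, mul_comm, Complex.norm_exp_ofReal_mul_I]

theorem planeWave_comm (z ξ : EuclideanSpace ℝ (Fin d)) : planeWave z ξ = planeWave ξ z := by
  rw [planeWave, planeWave, real_inner_comm]

theorem hasFDerivAt_planeWave (z ξ : EuclideanSpace ℝ (Fin d)) :
    HasFDerivAt (planeWave z)
      (planeWave z ξ • (Complex.I • Complex.ofRealCLM ∘L innerSL ℝ z)) ξ :=
  ((Complex.I • Complex.ofRealCLM ∘L innerSL ℝ z).hasFDerivAt (x := ξ)).cexp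

theorem contDiff_planeWave (z : EuclideanSpace ℝ (Fin d)) : ContDiff ℝ ∞ (planeWave z) :=
  (Complex.I • Complex.ofRealCLM ∘L innerSL ℝ z).contDiff.cexp

theorem inner_basisFun (z : EuclideanSpace ℝ (Fin d)) (i : Fin d) :
    inner ℝ z (EuclideanSpace.basisFun _ ℝ i) = z i := by
  rw [real_inner_comm]
  simp [EuclideanSpace.inner_single_left]

theorem continuous_planeWave :
    Continuous fun p : EuclideanSpace ℝ (Fin d) × EuclideanSpace ℝ (Fin d) =>
      planeWave p.1 p.2 := by
  unfold planeWave
  fun_prop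

/-- The integrand of the partial Fourier transform. -/
def fourierIntegrand (a : EuclideanSpace ℝ (Fin d ⊕ Fin d) → ℂ) (ξ : EuclideanSpace ℝ (Fin d))
    (v : EuclideanSpace ℝ (Fin d ⊕ Fin d)) : ℂ :=
  a (phasePoint (phaseFst d v) ξ) * planeWave (phaseSnd d v) ξ

/-- The inverse Fourier transform in the second variable,
`(2π)^{-d} ∫ a(x, ξ) e^{i⟨z,ξ⟩} dξ` at the point `(x, z)`. -/
def partialFourier (a : EuclideanSpace ℝ (Fin d ⊕ Fin d) → ℂ)
    (v : EuclideanSpace ℝ (Fin d ⊕ Fin d)) : ℂ :=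
  ((2 * Real.pi : ℝ) ^ d : ℂ)⁻¹ * ∫ ξ, fourierIntegrand a ξ v

/-- The operation on the symbol that corresponds to a letter applied to the partial Fourier
transform. -/
def fourierAct : (Fin d ⊕ Fin d) ⊕ (Fin d ⊕ Fin d) →
    (EuclideanSpace ℝ (Fin d ⊕ Fin d) → ℂ) → EuclideanSpace ℝ (Fin d ⊕ Fin d) → ℂ
  | .inl (.inl i), a => letterOp (.inl (.inl i)) a
  | .inl (.inr i), a => Complex.I • letterOp (.inr (.inr i)) a
  | .inr (.inl i), a => letterOp (.inr (.inl i)) a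
  | .inr (.inr i), a => Complex.I • letterOp (.inl (.inr i)) a

variable {a : EuclideanSpace ℝ (Fin d ⊕ Fin d) → ℂ} {w : ℕ → ℝ}

theorem WordBdd.fourierAct (ha : WordBdd w a) (ℓ : (Fin d ⊕ Fin d) ⊕ (Fin d ⊕ Fin d)) :
    WordBdd (fun n => w (n + 1)) (fourierAct ℓ a) := by
  have h : ∀ m, WordBdd (fun n => w (n + 1)) (Complex.I • _root_.letterOp m a) := fun m =>
    ((ha.letterOp m).smul Complex.I).mono fun n => by simp
  rcases ℓ with (i | i) | (i | i)
  exacts [ha.letterOp (.inl (.inl i)), h _, ha.letterOp (.inr (.inl i)), h _]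

theorem WordBdd.foldr_fourierAct (ha : WordBdd w a)
    (τ : List ((Fin d ⊕ Fin d) ⊕ (Fin d ⊕ Fin d))) :
    WordBdd (fun n => w (n + τ.length)) (τ.foldr _root_.fourierAct a) := by
  induction τ with
  | nil => exact ha
  | cons ℓ τ ih =>
    refine (ih.fourierAct ℓ).mono fun n => le_of_eq ?_
    simp only [List.length_cons]
    congr 1
    ring

theorem contDiff_fourierIntegrand (ha : ContDiff ℝ ∞ a) (ξ : EuclideanSpace ℝ (Fin d)) :
    ContDiff ℝ ∞ (fourierIntegrand a ξ) := by
  have h1 : ContDiff ℝ ∞ fun v => a (phaseCLM d (phaseFst d v, ξ)) :=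
    ha.comp ((phaseCLM d).contDiff.comp ((phaseFst d).contDiff.prodMk contDiff_const))
  have h2 : ContDiff ℝ ∞ fun v => planeWave (phaseSnd d v) ξ := by
    simp_rw [planeWave_comm _ ξ]
    exact (contDiff_planeWave ξ).comp (phaseSnd d).contDiff
  exact h1.mul h2

/-- Derivative letters already act through the symbol under the integral sign. Multiplication by the
second variable does so only after an integration by parts, in `WordBdd.mul_partialFourier`. -/
theorem letterOp_fourierIntegrand (ha : ContDiff ℝ ∞ a) (ξ : EuclideanSpace ℝ (Fin d))
    (i : Fin d ⊕ Fin d) :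
    letterOp (.inr i) (fourierIntegrand a ξ) = fourierIntegrand (fourierAct (.inr i) a) ξ := by
  have h : ∀ v k, fderiv ℝ (fourierIntegrand a ξ) v k =
      fderiv ℝ a (phasePoint (phaseFst d v) ξ) (phasePoint (phaseFst d k) 0)
        * planeWave (phaseSnd d v) ξ + a (phasePoint (phaseFst d v) ξ) *
        (planeWave (phaseSnd d v) ξ * (Complex.I * (inner ℝ ξ (phaseSnd d k) : ℝ))) := by
    intro v k
    have h0 : HasFDerivAt (fun v => (phaseFst d v, ξ)) ((phaseFst d).prod 0) v :=
      (phaseFst d).hasFDerivAt.prodMk (hasFDerivAt_const ξ v)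
    have h1 : HasFDerivAt (fun v => a (phasePoint (phaseFst d v) ξ))
        ((fderiv ℝ a (phasePoint (phaseFst d v) ξ)) ∘L
          (phaseCLM d ∘L (phaseFst d).prod 0)) v :=
      (ha.diffAt (phasePoint (phaseFst d v) ξ)).hasFDerivAt.comp v
        ((phaseCLM d).hasFDerivAt.comp v h0)
    have h2 : HasFDerivAt (fun v => planeWave (phaseSnd d v) ξ)
        ((planeWave ξ (phaseSnd d v) • (Complex.I • Complex.ofRealCLM ∘L innerSL ℝ ξ)) ∘L
          phaseSnd d) v := by
      simp_rw [planeWave_comm _ ξ]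
      exact (hasFDerivAt_planeWave ξ _).comp v (phaseSnd d).hasFDerivAt
    have h3 : HasFDerivAt (fourierIntegrand a ξ) _ v := h1.mul h2
    rw [h3.fderiv]
    simp [phaseCLM_apply, planeWave_comm ξ]
    ring
  have hbasis : ∀ i : Fin d, phasePoint (EuclideanSpace.basisFun _ ℝ i) 0
      = EuclideanSpace.basisFun (Fin d ⊕ Fin d) ℝ (.inl i) := by
    intro i
    ext (j | j) <;> simp [phasePoint_inl, phasePoint_inr]
  have hzero : phasePoint (0 : EuclideanSpace ℝ (Fin d)) 0 = 0 := by
    ext (j | j) <;> rfl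
  rcases i with i | i <;> ext v
  · rw [letterOp_inr, h, phaseFst_basis_inl, phaseSnd_basis_inl, hbasis]
    simp [fourierIntegrand, fourierAct, letterOp_inr]
  · rw [letterOp_inr, h, phaseFst_basis_inr, phaseSnd_basis_inr, inner_basisFun, hzero]
    simp [fourierIntegrand, fourierAct, letterOp_inl, phasePoint_inr]
    ring

/-- The majorant is integrable in `ξ` and independent of `v`, so it serves for convergence, uniform
bounds and Taylor remainders alike. -/
theorem WordBdd.norm_fourierIntegrand_le (ha : WordBdd w a) (ξ : EuclideanSpace ℝ (Fin d))
    (v : EuclideanSpace ℝ (Fin d ⊕ Fin d)) :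
    ‖fourierIntegrand a ξ v‖ ≤ decayBound (Fin d) (d + 1) w *
      (1 + ‖ξ‖) ^ (-((d + 1 : ℕ) : ℝ)) := by
  rw [fourierIntegrand, norm_mul, norm_planeWave, mul_one]
  simpa [_root_.slice] using (ha.slice (phaseFst d v)).norm_le_rpow ξ

theorem integrable_fourierWeight (d : ℕ) : Integrable fun ξ : EuclideanSpace ℝ (Fin d) =>
    (1 + ‖ξ‖) ^ (-((d + 1 : ℕ) : ℝ)) := by
  simpa using integrable_decay (Fin d)

theorem WordBdd.integrable_fourierIntegrand (ha : WordBdd w a)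
    (v : EuclideanSpace ℝ (Fin d ⊕ Fin d)) : Integrable fun ξ => fourierIntegrand a ξ v :=
  ((integrable_fourierWeight d).const_mul _).mono'
    ((contDiff_slice ha.1 _).continuous.mul (contDiff_planeWave _).continuous).aestronglyMeasurable
    (Filter.Eventually.of_forall fun ξ => ha.norm_fourierIntegrand_le ξ v)

/-- The factor by which the partial Fourier transform changes bounds. -/
def fourierConst (d : ℕ) : ℝ :=
  ‖((2 * Real.pi : ℝ) ^ d : ℂ)⁻¹‖ *
    ∫ ξ : EuclideanSpace ℝ (Fin d), (1 + ‖ξ‖) ^ (-((d + 1 : ℕ) : ℝ))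

theorem fourierConst_nonneg (d : ℕ) : 0 ≤ fourierConst d :=
  mul_nonneg (norm_nonneg _) (integral_nonneg fun _ => by positivity)

theorem WordBdd.norm_partialFourier_le (ha : WordBdd w a)
    (v : EuclideanSpace ℝ (Fin d ⊕ Fin d)) :
    ‖partialFourier a v‖ ≤ fourierConst d * decayBound (Fin d) (d + 1) w := by
  rw [partialFourier, norm_mul, fourierConst, mul_assoc]
  refine mul_le_mul_of_nonneg_left ?_ (norm_nonneg _)
  rw [← integral_mul_const]
  refine norm_integral_le_of_norm_le ((integrable_fourierWeight d).mul_const _)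
    (Filter.Eventually.of_forall fun ξ => ?_)
  rw [mul_comm]
  exact ha.norm_fourierIntegrand_le ξ v

/-- A coordinate of the first variable is constant in the integral. For the second variable, `i z_i
e^{i⟨z,ξ⟩}` is a `ξ`-derivative of the plane wave, and integration by parts moves this derivative to
the symbol. -/
theorem WordBdd.mul_partialFourier (ha : WordBdd w a) (i : Fin d ⊕ Fin d)
    (v : EuclideanSpace ℝ (Fin d ⊕ Fin d)) :
    (v i : ℂ) * partialFourier a v = partialFourier (_root_.fourierAct (.inl i) a) v := by
  rw [partialFourier, partialFourier, mul_left_comm]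
  congr 1
  rcases i with i | i
  · rw [← integral_const_mul]
    refine integral_congr_ae (Filter.Eventually.of_forall fun ξ => ?_)
    simp [fourierIntegrand, _root_.fourierAct, letterOp_inl, phasePoint_inl, phaseFst_coord,
      mul_assoc]
  · set x := phaseFst d v
    set z := phaseSnd d v
    have hs := ha.slice x
    have hD : ∀ ξ, fderiv ℝ (planeWave z) ξ (EuclideanSpace.basisFun _ ℝ i)
        = Complex.I * z i * planeWave z ξ := fun ξ => by
      rw [(hasFDerivAt_planeWave z ξ).fderiv]
      simp only [smul_apply, ContinuousLinearMap.comp_apply, innerSL_apply_apply,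
        inner_basisFun, smul_eq_mul, Complex.ofRealCLM_apply]
      ring
    have hslice : ∀ ξ, fderiv ℝ (_root_.slice a x) ξ (EuclideanSpace.basisFun _ ℝ i)
        = _root_.letterOp (.inr (.inr i)) a (phasePoint x ξ) := fun ξ =>
      congrFun (letterOp_slice ha.1 x (.inr i)) ξ
    have hpw : Continuous (planeWave z) := (contDiff_planeWave z).continuous
    have hbd : ∀ {f : EuclideanSpace ℝ (Fin d) → ℂ}, Integrable f →
        Integrable fun ξ => f ξ * planeWave z ξ := fun hf =>
      hf.mul_bdd (c := 1) hpw.aestronglyMeasurable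
        (Filter.Eventually.of_forall fun ξ => (norm_planeWave z ξ).le)
    have key := integral_mul_fderiv_eq_neg_fderiv_mul_of_integrable
      (μ := (volume : Measure (EuclideanSpace ℝ (Fin d)))) (f := _root_.slice a x)
      (g := planeWave z) (v := EuclideanSpace.basisFun _ ℝ i)
      (hbd (hs.letterOp (.inr i)).integrable)
      (by
        simp only [hD]
        have := (hbd hs.integrable).const_mul (Complex.I * z i)
        refine this.congr (Filter.Eventually.of_forall fun ξ => ?_)
        simp only
        ring)
      (hbd hs.integrable) (fun ξ _ => hs.1.diffAt ξ)
      (fun ξ _ => (hasFDerivAt_planeWave z ξ).differentiableAt)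
    simp only [hD, hslice] at key
    have e1 : ∫ ξ, _root_.slice a x ξ * (Complex.I * z i * planeWave z ξ)
        = Complex.I * z i * ∫ ξ, fourierIntegrand a ξ v := by
      rw [← integral_const_mul]
      refine integral_congr_ae (Filter.Eventually.of_forall fun ξ => ?_)
      simp only [_root_.slice, fourierIntegrand, x, z]
      ring
    have e2 : ∫ ξ, fourierIntegrand (_root_.fourierAct (.inl (.inr i)) a) ξ v
        = Complex.I * ∫ ξ, _root_.letterOp (.inr (.inr i)) a (phasePoint x ξ) * planeWave z ξ := by
      rw [← integral_const_mul]
      refine integral_congr_ae (Filter.Eventually.of_forall fun ξ => ?_)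
      simp [_root_.fourierAct, fourierIntegrand, x, z]
      ring
    rw [e1] at key
    rw [e2]
    have hv : v (.inr i) = z i := rfl
    rw [hv]
    linear_combination (-Complex.I) * key + ((z i : ℂ) * ∫ ξ, fourierIntegrand a ξ v) *
      (Complex.I_mul_I)

/-- Taylor's formula holds for the integrand at each `ξ`, with second derivatives bounded by an
integrable function of `ξ`. Integrating the inequality replaces differentiation under the integral
sign. -/
theorem WordBdd.partialFourier_taylor (ha : WordBdd w a) :
    ∃ C : ℝ, ∀ v k : EuclideanSpace ℝ (Fin d ⊕ Fin d),
      ‖partialFourier a (v + k) - partialFourier a v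
        - ∑ i, (k i : ℂ) * partialFourier (_root_.fourierAct (.inr i) a) v‖ ≤ C * ‖k‖ ^ 2 := by
  set D := |decayBound (Fin d) (d + 1) fun n => w (n + 2)| with hD
  refine ⟨fourierConst d * ((Fintype.card (Fin d ⊕ Fin d)) ^ 2 * D), fun v k => ?_⟩
  have hi := ha.integrable_fourierIntegrand
  have hi' : ∀ i, Integrable fun ξ => (k i : ℂ) *
      fourierIntegrand (_root_.fourierAct (.inr i) a) ξ v :=
    fun i => ((ha.fourierAct (.inr i)).integrable_fourierIntegrand v).const_mul _
  have e : partialFourier a (v + k) - partialFourier a v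
      - ∑ i, (k i : ℂ) * partialFourier (_root_.fourierAct (.inr i) a) v
      = ((2 * Real.pi : ℝ) ^ d : ℂ)⁻¹ * ∫ ξ, (fourierIntegrand a ξ (v + k) - fourierIntegrand a ξ v
        - ∑ i, (k i : ℂ) * fourierIntegrand (_root_.fourierAct (.inr i) a) ξ v) := by
    have hsub : Integrable fun ξ => fourierIntegrand a ξ (v + k) - fourierIntegrand a ξ v :=
      (hi _).sub (hi _)
    rw [integral_sub hsub (integrable_finsetSum _ fun i _ => hi' i),
      integral_sub (hi _) (hi _), integral_finsetSum _ fun i _ => hi' i, mul_sub, mul_sub,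
      Finset.mul_sum]
    simp only [partialFourier, integral_const_mul, mul_left_comm]
  rw [e, norm_mul, fourierConst, mul_assoc, mul_assoc]
  refine mul_le_mul_of_nonneg_left ?_ (norm_nonneg _)
  rw [← integral_mul_const]
  refine norm_integral_le_of_norm_le ((integrable_fourierWeight d).mul_const _)
    (Filter.Eventually.of_forall fun ξ => ?_)
  have h := _root_.norm_taylor_le (C := D * (1 + ‖ξ‖) ^ (-((d + 1 : ℕ) : ℝ)))
    (by positivity) (contDiff_fourierIntegrand ha.1 ξ) (fun i j x => by
      rw [letterOp_fourierIntegrand ha.1, letterOp_fourierIntegrand (ha.fourierAct _).1]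
      refine (((ha.fourierAct (.inr j)).fourierAct (.inr i)).norm_fourierIntegrand_le ξ x).trans ?_
      gcongr
      exact le_abs_self _) v k
  simp only [letterOp_fourierIntegrand ha.1] at h
  refine h.trans (le_of_eq ?_)
  ring

/-- The functions with some word bound form a family closed under `fourierAct`, so a word on the
transform is the transform of an acted-on symbol of shifted weight. The factor `1 ^ n` only puts the
weight in the form of `IsWeightClass.scale`. -/
theorem WordBdd.partialFourier (ha : WordBdd w a) :
    WordBdd (fun n => fourierConst d * 1 ^ n * decayBound (Fin d) (d + 1) fun k => w (k + n))
      (partialFourier a) := by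
  obtain ⟨h1, h2⟩ := contDiff_and_wordOp_of_family
    (fun a : EuclideanSpace ℝ (Fin d ⊕ Fin d) → ℂ => ∃ w, WordBdd w a) _root_.partialFourier
    _root_.fourierAct (fun ℓ a ⟨w, ha⟩ => ⟨_, ha.fourierAct ℓ⟩)
    (fun a ⟨w, ha⟩ i x => ha.mul_partialFourier i x) (fun a ⟨w, ha⟩ => ha.partialFourier_taylor)
    ⟨w, ha⟩
  refine ⟨h1, fun τ x => ?_⟩
  rw [h2, one_pow, mul_one]
  exact (ha.foldr_fourierAct τ).norm_partialFourier_le x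

end PartialFourier

/-! ### Kernels of Born-Jordan operators and the Born-Jordan distribution -/

section BornJordan

variable {d : ℕ}

/-- The substitution `(x, y) ↦ ((1-t)x + ty, x - y)`. -/
def shear (d : ℕ) (t : ℝ) :
    EuclideanSpace ℝ (Fin d ⊕ Fin d) →L[ℝ] EuclideanSpace ℝ (Fin d ⊕ Fin d) :=
  phaseCLM d ∘L ((1 - t) • phaseFst d + t • phaseSnd d).prod (phaseFst d - phaseSnd d)

/-- The substitution `(x, z) ↦ (x + tz, x - (1-t)z)`, the inverse of `shear`. -/
def unshear (d : ℕ) (t : ℝ) :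
    EuclideanSpace ℝ (Fin d ⊕ Fin d) →L[ℝ] EuclideanSpace ℝ (Fin d ⊕ Fin d) :=
  phaseCLM d ∘L (phaseFst d + t • phaseSnd d).prod (phaseFst d - (1 - t) • phaseSnd d)

theorem shear_apply (t : ℝ) (v : EuclideanSpace ℝ (Fin d ⊕ Fin d)) :
    shear d t v = phasePoint ((1 - t) • phaseFst d v + t • phaseSnd d v)
      (phaseFst d v - phaseSnd d v) := rfl

theorem unshear_apply (t : ℝ) (v : EuclideanSpace ℝ (Fin d ⊕ Fin d)) :
    unshear d t v = phasePoint (phaseFst d v + t • phaseSnd d v)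
      (phaseFst d v - (1 - t) • phaseSnd d v) := rfl

theorem unshear_shear (t : ℝ) (v : EuclideanSpace ℝ (Fin d ⊕ Fin d)) :
    unshear d t (shear d t v) = v := by
  rw [unshear_apply, shear_apply, phaseFst_phasePoint, phaseSnd_phasePoint]
  conv_rhs => rw [← phasePoint_eta v]
  congr 1 <;> module

theorem shear_unshear (t : ℝ) (v : EuclideanSpace ℝ (Fin d ⊕ Fin d)) :
    shear d t (unshear d t v) = v := by
  rw [unshear_apply, shear_apply, phaseFst_phasePoint, phaseSnd_phasePoint]
  conv_rhs => rw [← phasePoint_eta v]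
  congr 1 <;> module

theorem continuous_phasePoint : Continuous fun p : EuclideanSpace ℝ (Fin d) ×
    EuclideanSpace ℝ (Fin d) => phasePoint p.1 p.2 := (phaseCLM d).continuous

theorem continuous_shear :
    Continuous fun p : ℝ × EuclideanSpace ℝ (Fin d ⊕ Fin d) => shear d p.1 p.2 := by
  simp only [shear_apply]
  exact continuous_phasePoint.comp (f := fun p : ℝ × EuclideanSpace ℝ (Fin d ⊕ Fin d) =>
    ((1 - p.1) • phaseFst d p.2 + p.1 • phaseSnd d p.2, phaseFst d p.2 - phaseSnd d p.2))
    (by fun_prop)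

theorem continuous_unshear :
    Continuous fun p : ℝ × EuclideanSpace ℝ (Fin d ⊕ Fin d) => unshear d p.1 p.2 := by
  simp only [unshear_apply]
  exact continuous_phasePoint.comp (f := fun p : ℝ × EuclideanSpace ℝ (Fin d ⊕ Fin d) =>
    (phaseFst d p.2 + p.1 • phaseSnd d p.2, phaseFst d p.2 - (1 - p.1) • phaseSnd d p.2))
    (by fun_prop)

theorem continuous_shear_left (v : EuclideanSpace ℝ (Fin d ⊕ Fin d)) :
    Continuous fun t => shear d t v := by
  simp only [shear_apply]
  exact continuous_phasePoint.comp (f := fun t : ℝ =>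
    ((1 - t) • phaseFst d v + t • phaseSnd d v, phaseFst d v - phaseSnd d v)) (by fun_prop)

theorem continuous_unshear_left (v : EuclideanSpace ℝ (Fin d ⊕ Fin d)) :
    Continuous fun t => unshear d t v := by
  simp only [unshear_apply]
  exact continuous_phasePoint.comp (f := fun t : ℝ =>
    (phaseFst d v + t • phaseSnd d v, phaseFst d v - (1 - t) • phaseSnd d v)) (by fun_prop)

theorem abs_shear_le {t : ℝ} (ht : t ∈ Set.Icc (0 : ℝ) 1) (v : EuclideanSpace ℝ (Fin d ⊕ Fin d))
    (j : Fin d ⊕ Fin d) : |shear d t v j| ≤ 2 * ‖v‖ ∧ |unshear d t v j| ≤ 2 * ‖v‖ := by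
  have h := abs_coord_le_norm v
  have hpt : ∀ {s a b : ℝ}, s ∈ Set.Icc (0 : ℝ) 1 → |a| ≤ ‖v‖ → |b| ≤ ‖v‖ →
      |a + s * b| ≤ 2 * ‖v‖ ∧ |a - s * b| ≤ 2 * ‖v‖ := by
    intro s a b hs ha hb
    have h1 : |s * b| ≤ ‖v‖ := by
      rw [abs_mul, abs_of_nonneg hs.1]
      exact (mul_le_of_le_one_left (abs_nonneg b) hs.2).trans hb
    exact ⟨(abs_add_le _ _).trans (by linarith), (abs_sub _ _).trans (by linarith)⟩
  have h1 : (1 : ℝ) ∈ Set.Icc (0 : ℝ) 1 := ⟨zero_le_one, le_rfl⟩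
  have ht' : 1 - t ∈ Set.Icc (0 : ℝ) 1 := ⟨by linarith [ht.2], by linarith [ht.1]⟩
  rcases j with j | j
  · refine ⟨?_, (hpt ht (h (.inl j)) (h (.inr j))).1⟩
    change |(1 - t) * v (.inl j) + t * v (.inr j)| ≤ _
    refine (hpt ht (a := (1 - t) * v (.inl j)) ?_ (h (.inr j))).1
    rw [abs_mul, abs_of_nonneg ht'.1]
    exact (mul_le_of_le_one_left (abs_nonneg _) ht'.2).trans (h _)
  · refine ⟨?_, (hpt ht' (h (.inl j)) (h (.inr j))).2⟩
    change |v (.inl j) - v (.inr j)| ≤ _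
    simpa using (hpt h1 (h (.inl j)) (h (.inr j))).2

/-- Both `t` and `1 - t` lie in `[0, 1]`. The bound is uniform in `t`, which is what lets the
average over `t` keep a single weight. -/
theorem pullbackCoef_shear_le {t : ℝ} (ht : t ∈ Set.Icc (0 : ℝ) 1)
    (ℓ : (Fin d ⊕ Fin d) ⊕ (Fin d ⊕ Fin d)) (j : Fin d ⊕ Fin d) :
    |pullbackCoef (shear d t) (unshear d t) ℓ j| ≤ 2 ∧
      |pullbackCoef (unshear d t) (shear d t) ℓ j| ≤ 2 := by
  have h : ∀ i j : Fin d ⊕ Fin d,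
      |shear d t (EuclideanSpace.basisFun _ ℝ i) j| ≤ 2 ∧
        |unshear d t (EuclideanSpace.basisFun _ ℝ i) j| ≤ 2 := fun i j => by
    simpa using abs_shear_le ht (EuclideanSpace.basisFun _ ℝ i) j
  rcases ℓ with i | i
  exacts [⟨(h j i).2, (h j i).1⟩, h i j]

/-- The distribution kernel of `Op_BJ(a)`. -/
def bornJordanKernel (a : EuclideanSpace ℝ (Fin d ⊕ Fin d) → ℂ)
    (v : EuclideanSpace ℝ (Fin d ⊕ Fin d)) : ℂ :=
  ∫ t in (0 : ℝ)..1, partialFourier a (shear d t v)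

/-- The average of `g ⊗ f` over the substitutions `unshear d t`. -/
def averagedTensor (g f : EuclideanSpace ℝ (Fin d) → ℂ)
    (v : EuclideanSpace ℝ (Fin d ⊕ Fin d)) : ℂ :=
  ∫ t in (0 : ℝ)..1, tensor g f (unshear d t v)

/-- The (cross) Born-Jordan distribution of `g` and `f`. -/
def bornJordanDistribution (g f : EuclideanSpace ℝ (Fin d) → ℂ) :
    EuclideanSpace ℝ (Fin d ⊕ Fin d) → ℂ :=
  partialFourier (averagedTensor g f)

variable {a : EuclideanSpace ℝ (Fin d ⊕ Fin d) → ℂ} {f g : EuclideanSpace ℝ (Fin d) → ℂ}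
  {w v : ℕ → ℝ}

theorem WordBdd.averagedTensor (hg : WordBdd w g) (hf : WordBdd v f) (hw : ∀ n, 0 ≤ w n)
    (hv : ∀ n, 0 ≤ v n) :
    WordBdd (fun n => 1 * (Fintype.card (Fin d ⊕ Fin d) * 2) ^ n *
      ∑ j ∈ Finset.range (n + 1), w j * v (n - j)) (_root_.averagedTensor g f) := by
  have h := hg.tensor hf hw hv
  have h1 : ∀ t ∈ Set.Icc (0 : ℝ) 1, WordBdd _ fun v => _root_.tensor g f (unshear d t v) :=
    fun t ht => h.pullback (shear_unshear t) zero_le_two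
      fun ℓ j => (pullbackCoef_shear_le ht ℓ j).2
  have h2 : ∀ τ x, Continuous fun t => _root_.wordOp τ (fun v => _root_.tensor g f (unshear d t v)) x := fun τ x => continuous_wordOp_pullback (L := unshear d) (R := shear d) shear_unshear
    continuous_unshear_left continuous_shear_left h.1 τ x
  exact WordBdd.average h1 h2

theorem WordBdd.bornJordanKernel (ha : WordBdd w a) :
    WordBdd (fun n => 1 * (Fintype.card (Fin d ⊕ Fin d) * 2) ^ n *
      (fourierConst d * 1 ^ n * decayBound (Fin d) (d + 1) fun k => w (k + n)))
      (_root_.bornJordanKernel a) := by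
  have h := ha.partialFourier
  have h1 : ∀ t ∈ Set.Icc (0 : ℝ) 1, WordBdd _ fun v => _root_.partialFourier a (shear d t v) :=
    fun t ht => h.pullback (unshear_shear t) zero_le_two
      fun ℓ j => (pullbackCoef_shear_le ht ℓ j).1
  have h2 : ∀ τ x, Continuous fun t => _root_.wordOp τ (fun v => _root_.partialFourier a (shear d t v)) x := fun τ x => continuous_wordOp_pullback (L := shear d) (R := unshear d) unshear_shear
    continuous_shear_left continuous_unshear_left h.1 τ x
  exact WordBdd.average h1 h2

theorem IsWeightClass.fourier {W : Set (ℕ → ℝ)} (hW : IsWeightClass W) (d : ℕ) (hw : w ∈ W) :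
    (fun n => fourierConst d * 1 ^ n * _root_.decayBound (Fin d) (d + 1) fun k => w (k + n)) ∈ W :=
  hW.scale (hW.decayBound _ _ hw) _ _ (fourierConst_nonneg d) zero_le_one

theorem IsWeightClass.exists_bornJordanKernel {W : Set (ℕ → ℝ)} (hW : IsWeightClass W) (d : ℕ)
    (hw : w ∈ W) : ∃ w' ∈ W, ∀ a : EuclideanSpace ℝ (Fin d ⊕ Fin d) → ℂ, WordBdd w a →
      WordBdd w' (bornJordanKernel a) :=
  ⟨_, hW.scale (hW.fourier d hw) 1 (Fintype.card (Fin d ⊕ Fin d) * 2) zero_le_one (by positivity),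
    fun _ ha => ha.bornJordanKernel⟩

/-- The new weight depends only on the given weights and not on the functions: pairs of bounded sets
go to bounded sets, which yields continuity of the quantization. -/
theorem IsWeightClass.exists_bornJordanDistribution {W : Set (ℕ → ℝ)} (hW : IsWeightClass W)
    (d : ℕ) (hw : w ∈ W) (hv : v ∈ W) : ∃ w' ∈ W, ∀ g f : EuclideanSpace ℝ (Fin d) → ℂ,
      WordBdd w g → WordBdd v f → WordBdd w' (bornJordanDistribution g f) := by
  obtain ⟨w₁, hw₁, hpos, hle⟩ := hW.exists_pos hw
  obtain ⟨v₁, hv₁, hpos', hle'⟩ := hW.exists_pos hv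
  have h := hW.conv hw₁ hv₁ (fun n => (hpos n).le) (fun n => (hpos' n).le)
  exact ⟨_, hW.fourier d (hW.scale h 1 (Fintype.card (Fin d ⊕ Fin d) * 2) zero_le_one
    (by positivity)), fun g f hg hf => ((hg.mono hle).averagedTensor (hf.mono hle')
      (fun n => (hpos n).le) (fun n => (hpos' n).le)).partialFourier⟩

/-! ### Integral identities -/

theorem measurePreserving_phasePoint : MeasurePreserving
    (fun p : EuclideanSpace ℝ (Fin d) × EuclideanSpace ℝ (Fin d) => phasePoint p.1 p.2) := by
  have h1 := (PiLp.volume_preserving_ofLp (Fin d)).prod (PiLp.volume_preserving_ofLp (Fin d))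
  have h2 := volume_measurePreserving_sumPiEquivProdPi_symm fun _ : Fin d ⊕ Fin d => ℝ
  have h3 := (PiLp.volume_preserving_toLp (Fin d ⊕ Fin d)).comp (h2.comp h1)
  convert h3 using 1
  · ext p (i | i) <;> rfl
  · rfl

theorem measurableEmbedding_phasePoint : MeasurableEmbedding
    (fun p : EuclideanSpace ℝ (Fin d) × EuclideanSpace ℝ (Fin d) => phasePoint p.1 p.2) :=
  continuous_phasePoint.measurableEmbedding fun _ _ h =>
    Prod.ext (congrArg (phaseFst d) h) (congrArg (phaseSnd d) h)

theorem integral_phasePoint (F : EuclideanSpace ℝ (Fin d ⊕ Fin d) → ℂ) :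
    ∫ v, F v = ∫ p : EuclideanSpace ℝ (Fin d) × EuclideanSpace ℝ (Fin d), F (phasePoint p.1 p.2) :=
  (measurePreserving_phasePoint.integral_comp measurableEmbedding_phasePoint F).symm

theorem integral_integral_phasePoint {F : EuclideanSpace ℝ (Fin d ⊕ Fin d) → ℂ}
    (hF : Integrable F) : ∫ v, F v = ∫ x, ∫ y, F (phasePoint x y) := by
  rw [integral_phasePoint, Measure.volume_eq_prod, integral_prod]
  exact (measurePreserving_phasePoint.integrable_comp_emb measurableEmbedding_phasePoint).2 hF

/-- The substitution is a composition of coordinate swaps with two maps that move one variable by a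
translation or by a reflected translation depending on the other. Each preserves the measure. -/
theorem integral_unshear (t : ℝ) (F : EuclideanSpace ℝ (Fin d ⊕ Fin d) → ℂ) :
    ∫ v, F (unshear d t v) = ∫ v, F v := by
  let V := EuclideanSpace ℝ (Fin d)
  have h1 : MeasurePreserving (fun p : V × V => (p.1, p.2 + t • p.1)) :=
    (MeasurePreserving.id volume).skew_product (g := fun x z => z + t • x) (by fun_prop)
      (Filter.Eventually.of_forall fun x => (measurePreserving_add_right volume (t • x)).map_eq)
  have h2 : MeasurePreserving (fun p : V × V => (p.1, p.1 - p.2)) :=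
    (MeasurePreserving.id volume).skew_product (g := fun x z => x - z) (by fun_prop)
      (Filter.Eventually.of_forall fun x => (volume.measurePreserving_sub_left x).map_eq)
  have hsw : MeasurePreserving (Prod.swap : V × V → V × V) := Measure.measurePreserving_swap
  have h3 := (h2.comp (hsw.comp (h1.comp hsw)))
  have h4 : MeasurableEmbedding ((fun p : V × V => (p.1, p.1 - p.2)) ∘
      (Prod.swap ∘ ((fun p : V × V => (p.1, p.2 + t • p.1)) ∘ Prod.swap))) := by
    refine Continuous.measurableEmbedding (by fun_prop) ?_
    rintro ⟨x, z⟩ ⟨x', z'⟩ h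
    simp only [Function.comp_apply, Prod.swap_prod_mk, Prod.mk.injEq] at h
    obtain ⟨h5, h6⟩ := h
    rw [h5] at h6
    have h7 : z = z' := by simpa using h6
    rw [h7] at h5
    exact Prod.ext (by simpa using h5) h7
  rw [integral_phasePoint F, ← h3.integral_comp h4, integral_phasePoint]
  refine integral_congr_ae (Filter.Eventually.of_forall fun p => ?_)
  simp only [unshear_apply, phaseFst_phasePoint, phaseSnd_phasePoint, Function.comp_apply,
    Prod.fst_swap, Prod.snd_swap]
  congr 2
  module

/-- The integrand is absolutely integrable in `(y, ξ)`, and carrying out the `ξ`-integral inside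
gives the partial Fourier transform at `((1-t)x + ty, x - y)`. -/
theorem WordBdd.shubinOp_eq (ha : WordBdd w a) (hf : WordBdd v f) (t : ℝ)
    (x : EuclideanSpace ℝ (Fin d)) :
    shubinOp t a f x = ∫ y, _root_.partialFourier a (shear d t (phasePoint x y)) * f y := by
  have hint : Integrable (fun p : EuclideanSpace ℝ (Fin d) × EuclideanSpace ℝ (Fin d) =>
      f p.1 * fourierIntegrand a p.2 (shear d t (phasePoint x p.1)))
      (volume.prod volume) := by
    refine (hf.integrable.norm.mul_prod ((integrable_fourierWeight d).const_mul
      (decayBound (Fin d) (d + 1) w))).mono' (Continuous.aestronglyMeasurable ?_)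
      (Filter.Eventually.of_forall fun p => ?_)
    · refine (hf.1.continuous.comp continuous_fst).mul ?_
      refine (ha.1.continuous.comp (continuous_phasePoint.comp (g := fun p =>
        phasePoint p.1 p.2) (f := fun p : EuclideanSpace ℝ (Fin d) × EuclideanSpace ℝ (Fin d) =>
          (phaseFst d (shear d t (phasePoint x p.1)), p.2)) ?_)).mul
        (continuous_planeWave.comp (f := fun p : EuclideanSpace ℝ (Fin d) ×
          EuclideanSpace ℝ (Fin d) => (phaseSnd d (shear d t (phasePoint x p.1)), p.2)) ?_)
      all_goals
        refine Continuous.prodMk (ContinuousLinearMap.continuous _ |>.comp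
          ((shear d t).continuous.comp (continuous_phasePoint.comp
            (continuous_const.prodMk continuous_fst)))) continuous_snd
    · rw [norm_mul]
      gcongr
      exact ha.norm_fourierIntegrand_le _ _
  have e : shubinOp t a f x = ((2 * Real.pi : ℝ) ^ d : ℂ)⁻¹ *
      ∫ p : EuclideanSpace ℝ (Fin d) × EuclideanSpace ℝ (Fin d),
        f p.1 * fourierIntegrand a p.2 (shear d t (phasePoint x p.1)) := by
    rw [shubinOp]
    congr 1
    refine integral_congr_ae (Filter.Eventually.of_forall fun p => ?_)
    simp only [fourierIntegrand, shear_apply, phaseFst_phasePoint, phaseSnd_phasePoint, planeWave]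
    ring
  rw [e, Measure.volume_eq_prod, integral_prod _ hint, ← integral_const_mul]
  refine integral_congr_ae (Filter.Eventually.of_forall fun y => ?_)
  simp only [_root_.partialFourier, integral_const_mul]
  ring

theorem uIoc_zero_one_integrable {X : Type*} [TopologicalSpace X] [MeasurableSpace X]
    [OpensMeasurableSpace X] [SecondCountableTopology X] {μ : Measure X} [SFinite μ]
    {F : ℝ × X → ℂ} (hF : Continuous F) {b : X → ℝ} (hb : Integrable b μ)
    (h : ∀ t x, ‖F (t, x)‖ ≤ b x) :
    Integrable F ((volume.restrict (Set.uIoc (0 : ℝ) 1)).prod μ) := by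
  have h1 : Integrable (fun _ : ℝ => (1 : ℝ)) (volume.restrict (Set.uIoc (0 : ℝ) 1)) := by
    rw [Set.uIoc_of_le zero_le_one]
    exact integrable_const _
  refine (h1.mul_prod hb).mono' hF.aestronglyMeasurable
    (Filter.Eventually.of_forall fun p => ?_)
  rw [one_mul]
  exact h p.1 p.2

theorem WordBdd.bornJordanOp_eq (ha : WordBdd w a) (hf : WordBdd v f)
    (x : EuclideanSpace ℝ (Fin d)) :
    bornJordanOp a f x = ∫ y, _root_.bornJordanKernel a (phasePoint x y) * f y := by
  have hp := ha.partialFourier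
  simp only [bornJordanOp, ha.shubinOp_eq hf]
  rw [intervalIntegral_integral_swap]
  · refine integral_congr_ae (Filter.Eventually.of_forall fun y => ?_)
    exact intervalIntegral.integral_mul_const (𝕜 := ℂ) (f y) _
  · refine uIoc_zero_one_integrable ?_ (hf.integrable.norm.const_mul
      (fourierConst d * 1 ^ 0 * decayBound (Fin d) (d + 1) fun k => w (k + 0))) fun t y => ?_
    · refine (hp.1.continuous.comp (continuous_shear.comp (continuous_fst.prodMk ?_))).mul
        (hf.1.continuous.comp continuous_snd)
      exact continuous_phasePoint.comp (continuous_const.prodMk continuous_snd)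
    · simp only [Function.uncurry, norm_mul]
      gcongr
      exact hp.bound _

/-- The partial Fourier transform is symmetric. -/
theorem WordBdd.integral_partialFourier_mul (ha : WordBdd w a)
    {b : EuclideanSpace ℝ (Fin d ⊕ Fin d) → ℂ} (hb : WordBdd v b) :
    ∫ p, _root_.partialFourier a p * b p = ∫ p, a p * _root_.partialFourier b p := by
  rw [integral_integral_phasePoint (ha.partialFourier.integrable_mul hb),
    integral_integral_phasePoint (ha.integrable_mul hb.partialFourier)]
  refine integral_congr_ae (Filter.Eventually.of_forall fun x => ?_)
  have ha' := ha.slice x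
  have hb' := hb.slice x
  have hint : Integrable (Function.uncurry fun z ξ : EuclideanSpace ℝ (Fin d) =>
      _root_.slice a x ξ * _root_.slice b x z * planeWave z ξ) (volume.prod volume) := by
    refine (hb'.integrable.mul_prod ha'.integrable).norm.mono' (Continuous.aestronglyMeasurable ?_)
      (Filter.Eventually.of_forall fun p => ?_)
    · exact ((ha'.1.continuous.comp continuous_snd).mul (hb'.1.continuous.comp continuous_fst)).mul
        continuous_planeWave
    · simp [Function.uncurry, norm_planeWave, mul_comm]
  have e1 : ∀ z, _root_.partialFourier a (phasePoint x z) * b (phasePoint x z) =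
      ((2 * Real.pi : ℝ) ^ d : ℂ)⁻¹ *
        ∫ ξ, _root_.slice a x ξ * _root_.slice b x z * planeWave z ξ := by
    intro z
    rw [_root_.partialFourier, mul_assoc, ← integral_mul_const]
    congr 1
    refine integral_congr_ae (Filter.Eventually.of_forall fun ξ => ?_)
    simp only [fourierIntegrand, _root_.slice, phaseFst_phasePoint, phaseSnd_phasePoint]
    ring
  have e2 : ∀ ξ, a (phasePoint x ξ) * _root_.partialFourier b (phasePoint x ξ) =
      ((2 * Real.pi : ℝ) ^ d : ℂ)⁻¹ *
        ∫ z, _root_.slice a x ξ * _root_.slice b x z * planeWave z ξ := by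
    intro ξ
    rw [_root_.partialFourier, mul_left_comm, ← integral_const_mul]
    congr 1
    refine integral_congr_ae (Filter.Eventually.of_forall fun z => ?_)
    simp only [fourierIntegrand, _root_.slice, phaseFst_phasePoint, phaseSnd_phasePoint,
      planeWave_comm ξ]
    ring
  simp only [e1, e2, integral_const_mul]
  rw [integral_integral_swap hint]

/-- Pair the kernel with `g ⊗ f`, transfer the shear to the tensor by a measure preserving
substitution, average in `t`, and use the symmetry of the partial Fourier transform. All dependence
on `a` then sits in one pairing, which has a meaning for functionals too. -/
theorem WordBdd.integral_bornJordanOp_mul (ha : WordBdd w a) (hf : WordBdd v f) {u : ℕ → ℝ}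
    (hg : WordBdd u g) :
    ∫ x, bornJordanOp a f x * g x = ∫ p, a p * bornJordanDistribution g f p := by
  have hp := ha.partialFourier
  have hT := (hg.mono fun n => le_abs_self (u n)).tensor (hf.mono fun n => le_abs_self (v n))
    (fun n => abs_nonneg _) (fun n => abs_nonneg _)
  have hA := (hg.mono fun n => le_abs_self (u n)).averagedTensor
    (hf.mono fun n => le_abs_self (v n)) (fun n => abs_nonneg _) (fun n => abs_nonneg _)
  calc ∫ x, bornJordanOp a f x * g x
      = ∫ x, ∫ y, _root_.bornJordanKernel a (phasePoint x y) * _root_.tensor g f (phasePoint x y) := by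
        refine integral_congr_ae (Filter.Eventually.of_forall fun x => ?_)
        simp only [ha.bornJordanOp_eq hf, ← integral_mul_const]
        refine integral_congr_ae (Filter.Eventually.of_forall fun y => ?_)
        simp only [_root_.tensor, phaseFst_phasePoint, phaseSnd_phasePoint]
        ring
    _ = ∫ p, _root_.bornJordanKernel a p * _root_.tensor g f p :=
        (integral_integral_phasePoint (ha.bornJordanKernel.integrable_mul hT)).symm
    _ = ∫ p, ∫ t in (0 : ℝ)..1, _root_.partialFourier a (shear d t p) * _root_.tensor g f p := by
        refine integral_congr_ae (Filter.Eventually.of_forall fun p => ?_)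
        exact (intervalIntegral.integral_mul_const (𝕜 := ℂ) (_root_.tensor g f p) _).symm
    _ = ∫ t in (0 : ℝ)..1, ∫ p, _root_.partialFourier a (shear d t p) * _root_.tensor g f p := by
        refine (intervalIntegral_integral_swap (uIoc_zero_one_integrable ?_
          (hT.integrable.norm.const_mul
            (fourierConst d * 1 ^ 0 * decayBound (Fin d) (d + 1) fun k => w (k + 0))) fun t y => ?_)).symm
        · exact (hp.1.continuous.comp continuous_shear).mul (hT.1.continuous.comp continuous_snd)
        · simp only [Function.uncurry, norm_mul]
          gcongr
          exact hp.bound _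
    _ = ∫ t in (0 : ℝ)..1, ∫ p, _root_.partialFourier a p * _root_.tensor g f (unshear d t p) := by
        congr 1
        ext t
        -- Substituting `unshear d t p` for the variable undoes the shear in the first factor.
        rw [← integral_unshear t]
        simp only [shear_unshear]
    _ = ∫ p, ∫ t in (0 : ℝ)..1, _root_.partialFourier a p * _root_.tensor g f (unshear d t p) := by
        refine intervalIntegral_integral_swap (uIoc_zero_one_integrable ?_
          (hp.integrable.norm.mul_const
            (∑ j ∈ Finset.range (0 + 1), |u j| * |v (0 - j)|)) fun t y => ?_)
        · exact (hp.1.continuous.comp continuous_snd).mul (hT.1.continuous.comp continuous_unshear)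
        · simp only [Function.uncurry, norm_mul]
          gcongr
          exact hT.bound _
    _ = ∫ p, _root_.partialFourier a p * _root_.averagedTensor g f p := by
        refine integral_congr_ae (Filter.Eventually.of_forall fun p => ?_)
        exact intervalIntegral.integral_const_mul (𝕜 := ℂ) (_root_.partialFourier a p) _
    _ = _ := ha.integral_partialFourier_mul hA

end BornJordan

/-! ### Commutation relations -/

section Commutation

variable {ι : Type} [Fintype ι] {f : EuclideanSpace ℝ ι → ℂ}

theorem letterOp_inr_comm (hf : ContDiff ℝ ∞ f) (i j : ι) :
    letterOp (.inr i) (letterOp (.inr j) f) = letterOp (.inr j) (letterOp (.inr i) f) := by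
  have h : ∀ i j x, letterOp (.inr i) (letterOp (.inr j) f) x =
      fderiv ℝ (fderiv ℝ f) x (EuclideanSpace.basisFun ι ℝ i) (EuclideanSpace.basisFun ι ℝ j) := by
    intro i j x
    have hd : DifferentiableAt ℝ (fderiv ℝ f) x :=
      ((hf.fderiv_right (m := ∞) (by simp)).differentiable (by simp)) x
    change fderiv ℝ (fun y => fderiv ℝ f y (EuclideanSpace.basisFun ι ℝ j)) x _ = _
    rw [fderiv_clm_apply hd (differentiableAt_const _)]
    simp
  ext x
  rw [h, h]
  exact ((contDiff_infty.1 hf 2).contDiffAt.isSymmSndFDerivAt (by simp)) _ _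

theorem letterOp_inr_inl [DecidableEq ι] (hf : ContDiff ℝ ∞ f) (i j : ι) :
    letterOp (.inr i) (letterOp (.inl j) f) =
      letterOp (.inl j) (letterOp (.inr i) f) + (if i = j then (1 : ℂ) else 0) • f := by
  ext x
  have h1 : HasFDerivAt (fun x : EuclideanSpace ℝ ι => ((x j : ℝ) : ℂ))
      (Complex.ofRealCLM.comp (EuclideanSpace.proj j : EuclideanSpace ℝ ι →L[ℝ] ℝ)) x :=
    (Complex.ofRealCLM.comp (EuclideanSpace.proj j : EuclideanSpace ℝ ι →L[ℝ] ℝ)).hasFDerivAt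
  have h2 := (h1.mul (hf.diffAt x).hasFDerivAt).fderiv
  rw [letterOp_inr]
  change fderiv ℝ (fun x : EuclideanSpace ℝ ι => ((x j : ℝ) : ℂ) * f x) x _ = _
  erw [h2]
  by_cases hij : i = j
  · subst hij
    simp [letterOp_inl, letterOp_inr]
  · simp [letterOp_inl, letterOp_inr, hij]

end Commutation

/-! ### The general theorem -/

namespace IsTestSpace

open Topology Filter

section Basic

variable {ι : Type} [Fintype ι] {W : Set (ℕ → ℝ)} {E : Type} [AddCommGroup E]
  [Module ℂ E] [TopologicalSpace E] {J : E →ₗ[ℂ] (EuclideanSpace ℝ ι → ℂ)} {w : ℕ → ℝ}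

/-- By homogeneity the bound is linear in the size of the weight. It is applied with `c` of order
`‖h‖²`, to push a Taylor remainder through a functional. -/
theorem exists_norm_le_mul (hE : IsTestSpace W J) (u : StrongDual ℂ E) (hw : w ∈ W) :
    ∃ C : ℝ, 0 ≤ C ∧ ∀ c : ℝ, 0 ≤ c → ∀ e, WordBdd (fun n => c * w n) (J e) → ‖u e‖ ≤ C * c := by
  obtain ⟨C, hC0, hC⟩ := hE.exists_norm_le u hw
  refine ⟨C, hC0, fun c hc e he => ?_⟩
  rcases hc.eq_or_lt with rfl | hc
  · have h1 : J e = 0 := by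
      ext x
      simpa using he.bound x
    rw [hE.injective (h1.trans (map_zero J).symm)]
    simp
  · have h1 := hC (((c⁻¹ : ℝ) : ℂ) • e) (by
      rw [map_smul]
      refine (he.smul _).mono fun n => le_of_eq ?_
      rw [Complex.norm_real, Real.norm_of_nonneg (by positivity)]
      field_simp)
    rw [map_smul, norm_smul, Complex.norm_real, Real.norm_of_nonneg (by positivity),
      inv_mul_le_iff₀ hc] at h1
    linarith

/-- Linear functionals that are bounded on bounded sets are continuous. -/
theorem continuous_functional [IsTopologicalAddGroup E] (hE : IsTestSpace W J) (L : E →ₗ[ℂ] ℂ)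
    (hL : ∀ w ∈ W, ∃ C : ℝ, ∀ e, WordBdd w (J e) → ‖L e‖ ≤ C) : Continuous L := by
  have h1 : Continuous ((normSeminorm ℂ ℂ).comp L) := hE.continuous_seminorm _ hL
  refine continuous_of_continuousAt_zero L ?_
  rw [ContinuousAt, map_zero, tendsto_zero_iff_norm_tendsto_zero]
  have h2 := h1.tendsto 0
  rw [map_zero] at h2
  exact h2

/-- Linear maps to a strong dual that are bounded on bounded sets are continuous. -/
theorem continuous_of_strongDual [IsTopologicalAddGroup E] [ContinuousSMul ℂ E]
    (hE : IsTestSpace W J) {F : Type} [AddCommGroup F] [Module ℂ F] [TopologicalSpace F]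
    (L : E →ₗ[ℂ] StrongDual ℂ F)
    (hL : ∀ w ∈ W, ∀ S : Set F, Bornology.IsVonNBounded ℂ S →
      ∃ C : ℝ, ∀ e, WordBdd w (J e) → ∀ g ∈ S, ‖L e g‖ ≤ C) : Continuous L := by
  refine continuous_of_continuousAt_zero L ?_
  rw [ContinuousAt, map_zero, (ContinuousLinearMap.hasBasis_nhds_zero_of_basis
    Metric.nhds_basis_closedBall).tendsto_right_iff]
  rintro ⟨S, r⟩ ⟨hS, hr⟩
  -- The supremum of these seminorms over `S` is bounded on bounded sets, hence a continuous
  -- seminorm, and it measures exactly uniform smallness on `S`.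
  let p : S → Seminorm ℂ E := fun g =>
    (normSeminorm ℂ ℂ).comp (σ₁₂ := RingHom.id ℂ)
      { toFun := fun e => L e g
        map_add' := by simp
        map_smul' := by simp }
  have hp : ∀ g e, p g e = ‖L e g‖ := fun _ _ => rfl
  have hbdd : ∀ e, BddAbove (Set.range fun g => p g e) := by
    intro e
    obtain ⟨w, hw, he⟩ := hE.exists_wordBdd e
    obtain ⟨C, hC⟩ := hL w hw S hS
    exact ⟨C, by rintro _ ⟨g, rfl⟩; exact hC e he g g.2⟩
  have hcont : Continuous (⨆ g, p g : Seminorm ℂ E) := by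
    refine hE.continuous_seminorm _ fun w hw => ?_
    obtain ⟨C, hC⟩ := hL w hw S hS
    refine ⟨max C 0, fun e he => ?_⟩
    rw [Seminorm.iSup_apply (Seminorm.bddAbove_range_iff.2 hbdd)]
    exact Real.iSup_le (fun g => (hC e he g g.2).trans (le_max_left _ _)) (le_max_right _ _)
  have h1 := hcont.tendsto 0
  rw [map_zero] at h1
  filter_upwards [h1.eventually (gt_mem_nhds hr)] with e he g hg
  rw [Seminorm.iSup_apply (Seminorm.bddAbove_range_iff.2 hbdd)] at he
  rw [mem_closedBall_zero_iff]
  exact (le_ciSup (hbdd e) ⟨g, hg⟩).trans he.le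

open Classical in
/-- The element of the test space that is given by a function. -/
def ofFun (J : E →ₗ[ℂ] (EuclideanSpace ℝ ι → ℂ)) (f : EuclideanSpace ℝ ι → ℂ) : E :=
  if h : ∃ e, J e = f then h.choose else 0

theorem apply_ofFun (hE : IsTestSpace W J) (hw : w ∈ W) {f : EuclideanSpace ℝ ι → ℂ}
    (hf : WordBdd w f) : J (ofFun J f) = f := by
  have h := hE.exists_eq hw hf
  rw [ofFun, dif_pos h]
  exact h.choose_spec

theorem ofFun_eq (hE : IsTestSpace W J) {f : EuclideanSpace ℝ ι → ℂ} {e : E} (h : J e = f) :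
    ofFun J f = e := by
  have h' : ∃ e, J e = f := ⟨e, h⟩
  refine hE.injective ?_
  rw [ofFun, dif_pos h', h'.choose_spec, h]

end Basic

end IsTestSpace

/-! ### Operators with kernels in the test space -/

section KernelOperator

open Topology Filter

variable {d : ℕ} {k : EuclideanSpace ℝ (Fin d ⊕ Fin d) → ℂ} {w : ℕ → ℝ}

theorem norm_phasePoint_zero (h : EuclideanSpace ℝ (Fin d)) : ‖phasePoint h 0‖ = ‖h‖ := by
  simp [EuclideanSpace.norm_eq, phasePoint]

theorem phasePoint_add_left (x h y : EuclideanSpace ℝ (Fin d)) :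
    phasePoint (x + h) y = phasePoint x y + phasePoint h 0 := by
  ext (i | i) <;> simp [phasePoint]

/-- A derivative in the first block of variables commutes with every letter of the second block: the
commutator with a coordinate of a different index is zero. -/
theorem wordOp_map_inr_letterOp_inl (hk : ContDiff ℝ ∞ k) (i : Fin d) (τ : List (Fin d ⊕ Fin d)) :
    wordOp (τ.map (Sum.map Sum.inr Sum.inr)) (letterOp (.inr (.inl i)) k) =
      letterOp (.inr (.inl i)) (wordOp (τ.map (Sum.map Sum.inr Sum.inr)) k) := by
  induction τ with
  | nil => rfl
  | cons ℓ τ ih =>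
    rw [List.map_cons, wordOp_cons, ih, wordOp_cons]
    rcases ℓ with j | j
    · have := letterOp_inr_inl (hk.wordOp (τ.map (Sum.map Sum.inr Sum.inr))) (Sum.inl i)
        (Sum.inr j)
      rw [Sum.map_inl, this]
      simp
    · exact letterOp_inr_comm (hk.wordOp _) _ _

/-- Taylor's formula for the slices of a function on phase space. -/
theorem WordBdd.slice_taylor (hk : WordBdd w k) (x h : EuclideanSpace ℝ (Fin d)) :
    WordBdd (fun n => (Fintype.card (Fin d ⊕ Fin d)) ^ 2 * ‖h‖ ^ 2 * |w (n + 2)|)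
      (_root_.slice k (x + h) - _root_.slice k x
        - ∑ i, (h i : ℂ) • _root_.slice (_root_.letterOp (.inr (.inl i)) k) x) := by
  have hs : ∀ i, ContDiff ℝ ∞
      ((h i : ℂ) • _root_.slice (_root_.letterOp (.inr (.inl i)) k) x) := fun i =>
    (contDiff_slice (hk.1.letterOp (.inr (.inl i))) x).const_smul (h i : ℂ)
  have hs' : ContDiff ℝ ∞
      (∑ i, (h i : ℂ) • _root_.slice (_root_.letterOp (.inr (.inl i)) k) x) := by
    have : (∑ i, (h i : ℂ) • _root_.slice (_root_.letterOp (.inr (.inl i)) k) x) =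
      fun y => ∑ i, ((h i : ℂ) • _root_.slice (_root_.letterOp (.inr (.inl i)) k) x) y := by
      ext; simp
    rw [this]
    exact ContDiff.sum fun i _ => hs i
  have h1 := contDiff_slice hk.1 (x + h)
  have h2 := contDiff_slice hk.1 x
  have h12 : ContDiff ℝ ∞ (_root_.slice k (x + h) - _root_.slice k x) := h1.sub h2
  refine ⟨h12.sub hs', fun τ y => ?_⟩
  rw [wordOp_sub h12 hs', wordOp_sub h1 h2, wordOp_sum _ hs, wordOp_slice hk.1,
    wordOp_slice hk.1]
  simp only [wordOp_smul (contDiff_slice (hk.1.letterOp _) x), wordOp_slice (hk.1.letterOp _),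
    wordOp_map_inr_letterOp_inl hk.1]
  -- The increment `(h, 0)` has no second component, so only derivatives in the first block survive.
  have h3 := hk.norm_taylor_le (τ.map (Sum.map Sum.inr Sum.inr)) (phasePoint x y) (phasePoint h 0)
  rw [Fintype.sum_sum_type, norm_phasePoint_zero, List.length_map, ← phasePoint_add_left] at h3
  simp only [phasePoint_inl, phasePoint_inr, PiLp.zero_apply, Complex.ofReal_zero, zero_mul,
    Finset.sum_const_zero, add_zero] at h3
  refine le_trans (le_of_eq ?_) (h3.trans (le_of_eq (by ring)))
  simp [_root_.slice, wordOp_cons]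

namespace IsTestSpace

variable {W : Set (ℕ → ℝ)} {E : Type} [AddCommGroup E] [Module ℂ E] [TopologicalSpace E]
  {J : E →ₗ[ℂ] (EuclideanSpace ℝ (Fin d) → ℂ)}

/-- The function `x ↦ ⟨u, k(x, ·)⟩`. -/
def kernelApply (J : E →ₗ[ℂ] (EuclideanSpace ℝ (Fin d) → ℂ))
    (k : EuclideanSpace ℝ (Fin d ⊕ Fin d) → ℂ) (u : StrongDual ℂ E)
    (x : EuclideanSpace ℝ (Fin d)) : ℂ :=
  u (ofFun J (slice k x))

/-- Letters in `x` pass inside `u`: multiplications by linearity, derivatives because the Taylor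
remainder of `x ↦ k(x, ·)` has word bounds of order `‖h‖²`, so that `u` of it is of order `‖h‖²`. -/
theorem wordOp_kernelApply (hW : IsWeightClass W) (hE : IsTestSpace W J) (hw : w ∈ W)
    (hk : WordBdd w k) (u : StrongDual ℂ E) : ContDiff ℝ ∞ (kernelApply J k u) ∧
      ∀ τ, wordOp τ (kernelApply J k u) =
        kernelApply J (wordOp (τ.map (Sum.map Sum.inl Sum.inl)) k) u := by
  have h := contDiff_and_wordOp_of_family
    (fun k : EuclideanSpace ℝ (Fin d ⊕ Fin d) → ℂ => ∃ w ∈ W, WordBdd w k)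
    (fun k => kernelApply J k u) (fun ℓ k => letterOp (ℓ.map Sum.inl Sum.inl) k)
    (fun ℓ k ⟨w, hw, hk⟩ => ⟨_, hW.shift hw, hk.letterOp _⟩) ?_ ?_ ⟨w, hw, hk⟩
  · refine ⟨h.1, fun τ => (h.2 τ).trans ?_⟩
    congr 1
    rw [wordOp, List.foldr_map]
  · rintro k ⟨w, hw, hk⟩ i x
    have h1 : ofFun J (slice (letterOp (.inl (.inl i)) k) x) = (x i : ℂ) • ofFun J (slice k x) := by
      refine hE.ofFun_eq ?_
      rw [map_smul, hE.apply_ofFun hw (hk.slice x)]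
      rfl
    change (x i : ℂ) * u _ = u _
    rw [Sum.map_inl, h1, map_smul, smul_eq_mul]
  · rintro k ⟨w, hw, hk⟩
    obtain ⟨v, hv, hpos, hle⟩ := hW.exists_pos hw
    have hk' := hk.mono hle
    obtain ⟨C, hC0, hC⟩ := hE.exists_norm_le_mul u (hW.shift_add hv 2)
    refine ⟨C * Fintype.card (Fin d ⊕ Fin d) ^ 2, fun x h => ?_⟩
    have h1 : J (ofFun J (slice k (x + h)) - ofFun J (slice k x)
        - ∑ i, (h i : ℂ) • ofFun J (slice (letterOp (.inr (.inl i)) k) x)) =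
        slice k (x + h) - slice k x - ∑ i, (h i : ℂ) • slice (letterOp (.inr (.inl i)) k) x := by
      rw [map_sub, map_sub, map_sum, hE.apply_ofFun hw (hk.slice x),
        hE.apply_ofFun hw (hk.slice (x + h))]
      simp only [map_smul, hE.apply_ofFun (hW.shift hw) ((hk.letterOp _).slice x)]
    have h2 := hC (Fintype.card (Fin d ⊕ Fin d) ^ 2 * ‖h‖ ^ 2) (by positivity) _ (by
      rw [h1]
      refine (hk'.slice_taylor x h).mono fun n => le_of_eq ?_
      rw [abs_of_pos (hpos _)])
    rw [map_sub, map_sub, map_sum] at h2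
    simp only [map_smul, smul_eq_mul] at h2
    exact h2.trans (le_of_eq (by ring))

/-- A word in `x` uses up `|τ|` letters of the kernel; by the splitting of the weight this costs a
factor `v |τ|` and leaves slices with weight `v`. Smallness of `u` on one bounded set thus becomes
smallness of the image, which is continuity. -/
theorem wordBdd_kernelApply (hW : IsWeightClass W) (hE : IsTestSpace W J) (hw : w ∈ W)
    (hk : WordBdd w k) {v : ℕ → ℝ} (hpos : ∀ n, 0 < v n) (hle : ∀ m n, w (m + n) ≤ v m * v n)
    (u : StrongDual ℂ E) {ε : ℝ} (hu : ∀ e, WordBdd v (J e) → ‖u e‖ ≤ ε) :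
    WordBdd (fun n => ε * v n) (kernelApply J k u) := by
  obtain ⟨h1, h2⟩ := wordOp_kernelApply hW hE hw hk u
  refine ⟨h1, fun τ x => ?_⟩
  rw [h2]
  set k' := wordOp (τ.map (Sum.map Sum.inl Sum.inl)) k with hk'
  have h3 : WordBdd (fun n => w (n + τ.length)) k' := by
    simpa using hk.wordOp (τ.map (Sum.map Sum.inl Sum.inl))
  have h4 : J (ofFun J (slice k' x)) = slice k' x :=
    hE.apply_ofFun (hW.shift_add hw _) (h3.slice x)
  have hvτ := hpos τ.length
  have h5 := hu ((((v τ.length)⁻¹ : ℝ) : ℂ) • ofFun J (slice k' x)) (by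
    rw [map_smul, h4]
    refine ((h3.slice x).smul _).mono fun n => ?_
    rw [Complex.norm_real, Real.norm_of_nonneg (by positivity), inv_mul_le_iff₀ hvτ, mul_comm]
    exact hle n _)
  rw [map_smul, norm_smul, Complex.norm_real, Real.norm_of_nonneg (by positivity),
    inv_mul_le_iff₀ hvτ, mul_comm] at h5
  exact h5

/-- The operator with kernel `k`, as a continuous map from the dual to the test space. -/
theorem exists_kernelOperator [IsTopologicalAddGroup E] [ContinuousSMul ℂ E]
    (hW : IsWeightClass W) (hE : IsTestSpace W J) (hw : w ∈ W) (hk : WordBdd w k) :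
    ∃ T : StrongDual ℂ E →L[ℂ] E, ∀ u x, J (T u) x = u (ofFun J (slice k x)) := by
  obtain ⟨v, hv, hpos, hle⟩ := hW.split hw
  have hJ : ∀ u, J (ofFun J (kernelApply J k u)) = kernelApply J k u := by
    intro u
    obtain ⟨C, hC0, hC⟩ := hE.exists_norm_le u hv
    have hCv : (fun n => C * v n) ∈ W := by simpa using hW.scale hv C 1 hC0 zero_le_one
    exact hE.apply_ofFun hCv (wordBdd_kernelApply hW hE hw hk hpos hle u hC)
  let T : StrongDual ℂ E →ₗ[ℂ] E :=
    { toFun := fun u => ofFun J (kernelApply J k u)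
      map_add' := fun u u' => hE.ofFun_eq (by rw [map_add, hJ, hJ]; rfl)
      map_smul' := fun c u => hE.ofFun_eq (by rw [map_smul, hJ]; rfl) }
  refine ⟨⟨T, ?_⟩, fun u x => congrFun (hJ u) x⟩
  refine continuous_of_continuousAt_zero T ?_
  rw [ContinuousAt, map_zero]
  intro U hU
  obtain ⟨ε, hε, hεU⟩ := hE.exists_pos_mem hv hU
  refine mem_map.2 (mem_of_superset ((ContinuousLinearMap.hasBasis_nhds_zero_of_basis
    Metric.nhds_basis_closedBall).mem_of_mem (i := ({e | WordBdd v (J e)}, ε))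
      ⟨hE.isVonNBounded hv, hε⟩) fun u hu => hεU _ ?_)
  change WordBdd _ (J (ofFun J (kernelApply J k u)))
  rw [hJ]
  exact wordBdd_kernelApply hW hE hw hk hpos hle u fun e he => by
    simpa using hu e he

end IsTestSpace

end KernelOperator

/-! ### Bilinearity of the Born-Jordan distribution -/

section Bilinear

variable {d : ℕ} {f f' g g' : EuclideanSpace ℝ (Fin d) → ℂ} {w v w' v' : ℕ → ℝ}
  {a b : EuclideanSpace ℝ (Fin d ⊕ Fin d) → ℂ}

theorem partialFourier_add (ha : WordBdd w a) (hb : WordBdd v b) :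
    partialFourier (a + b) = partialFourier a + partialFourier b := by
  ext p
  simp only [partialFourier, Pi.add_apply]
  rw [← mul_add, ← integral_add (ha.integrable_fourierIntegrand p) (hb.integrable_fourierIntegrand p)]
  congr 2
  ext ξ
  simp only [fourierIntegrand, Pi.add_apply]
  ring

theorem partialFourier_smul (c : ℂ) : partialFourier (c • a) = c • partialFourier a := by
  ext p
  simp only [partialFourier, Pi.smul_apply, smul_eq_mul]
  rw [mul_left_comm, ← integral_const_mul c]
  congr 1
  refine integral_congr_ae (Filter.Eventually.of_forall fun ξ => ?_)
  simp only [fourierIntegrand, Pi.smul_apply, smul_eq_mul]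
  ring

theorem intervalIntegrable_tensor (hg : Continuous g) (hf : Continuous f)
    (p : EuclideanSpace ℝ (Fin d ⊕ Fin d)) :
    IntervalIntegrable (fun t => tensor g f (unshear d t p)) volume 0 1 :=
  (((hg.comp (phaseFst d).continuous).mul (hf.comp (phaseSnd d).continuous)).comp
    (continuous_unshear_left p)).intervalIntegrable _ _

theorem averagedTensor_add_left (hg : Continuous g) (hg' : Continuous g') (hf : Continuous f) :
    averagedTensor (g + g') f = averagedTensor g f + averagedTensor g' f := by
  ext p
  simp only [averagedTensor, Pi.add_apply]
  rw [← intervalIntegral.integral_add (intervalIntegrable_tensor hg hf p)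
    (intervalIntegrable_tensor hg' hf p)]
  simp only [tensor, Pi.add_apply, add_mul]

theorem averagedTensor_add_right (hg : Continuous g) (hf : Continuous f) (hf' : Continuous f') :
    averagedTensor g (f + f') = averagedTensor g f + averagedTensor g f' := by
  ext p
  simp only [averagedTensor, Pi.add_apply]
  rw [← intervalIntegral.integral_add (intervalIntegrable_tensor hg hf p)
    (intervalIntegrable_tensor hg hf' p)]
  simp only [tensor, Pi.add_apply, mul_add]

theorem averagedTensor_smul_left (c : ℂ) :
    averagedTensor (c • g) f = c • averagedTensor g f := by
  ext p
  simp only [averagedTensor, Pi.smul_apply, smul_eq_mul]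
  rw [← intervalIntegral.integral_const_mul]
  simp only [tensor, Pi.smul_apply, smul_eq_mul, mul_assoc]

theorem averagedTensor_smul_right (c : ℂ) :
    averagedTensor g (c • f) = c • averagedTensor g f := by
  ext p
  simp only [averagedTensor, Pi.smul_apply, smul_eq_mul]
  rw [← intervalIntegral.integral_const_mul]
  simp only [tensor, Pi.smul_apply, smul_eq_mul, mul_left_comm]

theorem WordBdd.exists_averagedTensor (hg : WordBdd w g) (hf : WordBdd v f) :
    ∃ u, WordBdd u (_root_.averagedTensor g f) :=
  ⟨_, (hg.mono fun n => le_abs_self (w n)).averagedTensor (hf.mono fun n => le_abs_self (v n))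
    (fun _ => abs_nonneg _) (fun _ => abs_nonneg _)⟩

theorem bornJordanDistribution_add_left (hg : WordBdd w g) (hg' : WordBdd w' g')
    (hf : WordBdd v f) : bornJordanDistribution (g + g') f =
      bornJordanDistribution g f + bornJordanDistribution g' f := by
  obtain ⟨_, h⟩ := hg.exists_averagedTensor hf
  obtain ⟨_, h'⟩ := hg'.exists_averagedTensor hf
  rw [bornJordanDistribution, averagedTensor_add_left hg.1.continuous hg'.1.continuous
    hf.1.continuous, partialFourier_add h h']
  rfl

theorem bornJordanDistribution_add_right (hg : WordBdd w g) (hf : WordBdd v f)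
    (hf' : WordBdd v' f') : bornJordanDistribution g (f + f') =
      bornJordanDistribution g f + bornJordanDistribution g f' := by
  obtain ⟨_, h⟩ := hg.exists_averagedTensor hf
  obtain ⟨_, h'⟩ := hg.exists_averagedTensor hf'
  rw [bornJordanDistribution, averagedTensor_add_right hg.1.continuous hf.1.continuous
    hf'.1.continuous, partialFourier_add h h']
  rfl

theorem bornJordanDistribution_smul_left (c : ℂ) :
    bornJordanDistribution (c • g) f = c • bornJordanDistribution g f := by
  rw [bornJordanDistribution, averagedTensor_smul_left, partialFourier_smul]
  rfl

theorem bornJordanDistribution_smul_right (c : ℂ) :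
    bornJordanDistribution g (c • f) = c • bornJordanDistribution g f := by
  rw [bornJordanDistribution, averagedTensor_smul_right, partialFourier_smul]
  rfl

end Bilinear

/-! ### Extension of Born-Jordan operators -/

namespace IsTestSpace

open Topology Filter

variable {d : ℕ} {W : Set (ℕ → ℝ)}
  {E : Type} [AddCommGroup E] [Module ℂ E] [TopologicalSpace E] [IsTopologicalAddGroup E]
  [ContinuousSMul ℂ E] {J : E →ₗ[ℂ] (EuclideanSpace ℝ (Fin d) → ℂ)}
  {E' : Type} [AddCommGroup E'] [Module ℂ E'] [TopologicalSpace E'] {J' : E' →ₗ[ℂ] (EuclideanSpace ℝ (Fin d ⊕ Fin d) → ℂ)}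

/-- Born-Jordan operators with symbols in the test space are regularizing. -/
theorem exists_bornJordan_regularizing [ContinuousSMul ℂ E'] (hW : IsWeightClass W) (hE : IsTestSpace W J)
    (hE' : IsTestSpace W J') (D : E → StrongDual ℂ E) (hD : ∀ f g, D f g = ∫ x, J f x * J g x)
    (a : E') :
    ∃ T : StrongDual ℂ E →L[ℂ] E, (∀ f x, J (T (D f)) x = bornJordanOp (J' a) (J f) x) ∧
      ∀ T' : StrongDual ℂ E → E, Continuous T' →
        (∀ f x, J (T' (D f)) x = bornJordanOp (J' a) (J f) x) → ∀ u, T' u = T u := by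
  obtain ⟨w, hw, ha⟩ := hE'.exists_wordBdd a
  obtain ⟨w', hw', hK⟩ := hW.exists_bornJordanKernel d hw
  obtain ⟨T, hT⟩ := exists_kernelOperator hW hE hw' (hK _ ha)
  have hTD : ∀ f x, J (T (D f)) x = bornJordanOp (J' a) (J f) x := by
    intro f x
    obtain ⟨v, _, hf⟩ := hE.exists_wordBdd f
    rw [hT, hD, hE.apply_ofFun hw' ((hK _ ha).slice x), ha.bornJordanOp_eq hf]
    simp only [mul_comm (J f _)]
    rfl
  refine ⟨T, hTD, fun T' hT' h u => hE.injective ?_⟩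
  ext x
  -- Evaluations at `x` are compared, so only `ℂ` has to be Hausdorff and `T'` need not be linear.
  exact congrFun ((denseRange_toDual hW hE D hD).equalizer ((hE.continuous_eval x).comp hT')
    ((hE.continuous_eval x).comp T.continuous)
    (funext fun f => (h f x).trans (hTD f x).symm)) u

/-- The identity of `WordBdd.integral_bornJordanOp_mul` is taken as the definition of the form.
Boundedness on pairs of bounded sets is then enough for continuity in each step, since bounded
functionals and bounded maps to the strong dual are continuous. -/
theorem exists_bornJordanForm (hW : IsWeightClass W) (hE : IsTestSpace W J)
    (hE' : IsTestSpace W J') (u : StrongDual ℂ E') :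
    ∃ A : E →L[ℂ] StrongDual ℂ E, ∀ f g, A f g =
      u (ofFun J' (bornJordanDistribution (J g) (J f))) := by
  have hJ : ∀ f g, J' (ofFun J' (bornJordanDistribution (J g) (J f))) =
      bornJordanDistribution (J g) (J f) := by
    intro f g
    obtain ⟨v, hv, hf⟩ := hE.exists_wordBdd f
    obtain ⟨w, hw, hg⟩ := hE.exists_wordBdd g
    obtain ⟨w', hw', h⟩ := hW.exists_bornJordanDistribution d hw hv
    exact hE'.apply_ofFun hw' (h _ _ hg hf)
  have hbdd : ∀ v ∈ W, ∀ w ∈ W, ∃ C : ℝ, ∀ f g, WordBdd v (J f) → WordBdd w (J g) →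
      ‖u (ofFun J' (bornJordanDistribution (J g) (J f)))‖ ≤ C := by
    intro v hv w hw
    obtain ⟨w', hw', h⟩ := hW.exists_bornJordanDistribution d hw hv
    obtain ⟨C, -, hC⟩ := hE'.exists_norm_le u hw'
    exact ⟨C, fun f g hf hg => hC _ (by rw [hJ]; exact h _ _ hg hf)⟩
  let B : E → E →ₗ[ℂ] ℂ := fun f =>
    { toFun := fun g => u (ofFun J' (bornJordanDistribution (J g) (J f)))
      map_add' := fun g g' => by
        obtain ⟨v, hv, hf⟩ := hE.exists_wordBdd f
        obtain ⟨w, hw, hg⟩ := hE.exists_wordBdd g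
        obtain ⟨w', hw', hg'⟩ := hE.exists_wordBdd g'
        rw [← map_add]
        congr 1
        refine hE'.ofFun_eq ?_
        rw [map_add, hJ, hJ, map_add, bornJordanDistribution_add_left hg hg' hf]
      map_smul' := fun c g => by
        rw [RingHom.id_apply, ← map_smul]
        congr 1
        refine hE'.ofFun_eq ?_
        rw [map_smul, hJ, map_smul, bornJordanDistribution_smul_left] }
  have hB : ∀ f, Continuous (B f) := fun f => by
    obtain ⟨v, hv, hf⟩ := hE.exists_wordBdd f
    refine hE.continuous_functional (B f) fun w hw => ?_
    obtain ⟨C, hC⟩ := hbdd v hv w hw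
    exact ⟨C, fun g hg => hC f g hf hg⟩
  let A : E →ₗ[ℂ] StrongDual ℂ E :=
    { toFun := fun f => ⟨B f, hB f⟩
      map_add' := fun f f' => by
        ext g
        change u _ = u _ + u _
        obtain ⟨v, hv, hf⟩ := hE.exists_wordBdd f
        obtain ⟨w, hw, hg⟩ := hE.exists_wordBdd g
        obtain ⟨v', hv', hf'⟩ := hE.exists_wordBdd f'
        rw [← map_add]
        congr 1
        refine hE'.ofFun_eq ?_
        rw [map_add, hJ, hJ, map_add, bornJordanDistribution_add_right hg hf hf']
      map_smul' := fun c f => by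
        ext g
        change u _ = c • u _
        rw [← map_smul]
        congr 1
        refine hE'.ofFun_eq ?_
        rw [map_smul, hJ, map_smul, bornJordanDistribution_smul_right] }
  refine ⟨⟨A, hE.continuous_of_strongDual A fun v hv S hS => ?_⟩, fun _ _ => rfl⟩
  obtain ⟨w, hw, hSw⟩ := (hE.isVonNBounded_iff S).1 hS
  obtain ⟨C, hC⟩ := hbdd v hv w hw
  exact ⟨C, fun f hf g hg => hC f g hf (hSw g hg)⟩

/-- The Born-Jordan quantization of symbols in the dual. -/
theorem exists_bornJordan_quantization [IsTopologicalAddGroup E'] [ContinuousSMul ℂ E']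
    (hW : IsWeightClass W) (hE : IsTestSpace W J)
    (hE' : IsTestSpace W J') (D' : E' → StrongDual ℂ E')
    (hD' : ∀ f g, D' f g = ∫ x, J' f x * J' g x) :
    ∃ T : StrongDual ℂ E' →L[ℂ] E →L[ℂ] StrongDual ℂ E,
      (∀ a f g, T (D' a) f g = ∫ x, bornJordanOp (J' a) (J f) x * J g x) ∧
      ∀ T' : StrongDual ℂ E' → E →L[ℂ] StrongDual ℂ E,
        (∀ f g, Continuous fun u => T' u f g) →
        (∀ a f g, T' (D' a) f g = ∫ x, bornJordanOp (J' a) (J f) x * J g x) → ∀ u, T' u = T u := by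
  choose A hA using fun u => exists_bornJordanForm (J := J) (J' := J') hW hE hE' u
  let T : StrongDual ℂ E' →ₗ[ℂ] E →L[ℂ] StrongDual ℂ E :=
    { toFun := A
      map_add' := fun u u' => by ext f g; simp [hA]
      map_smul' := fun c u => by ext f g; simp [hA] }
  have hT : Continuous T := by
    have hG : IsTopologicalAddGroup (E →L[ℂ] StrongDual ℂ E) := inferInstance
    have := hG.toContinuousAdd
    refine continuous_of_continuousAt_zero T ?_
    rw [ContinuousAt, map_zero, (ContinuousLinearMap.hasBasis_nhds_zero_of_basis
      (ContinuousLinearMap.hasBasis_nhds_zero_of_basis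
        Metric.nhds_basis_closedBall)).tendsto_right_iff]
    rintro ⟨S, S', r⟩ ⟨hS, hS', hr⟩
    obtain ⟨v, hv, hSv⟩ := (hE.isVonNBounded_iff S).1 hS
    obtain ⟨w, hw, hSw⟩ := (hE.isVonNBounded_iff S').1 hS'
    -- All distributions of pairs from `S'` and `S` lie in one bounded set of symbols, and it
    -- suffices that `u` be at most `r` there.
    obtain ⟨w', hw', h⟩ := hW.exists_bornJordanDistribution d hw hv
    refine mem_of_superset ((ContinuousLinearMap.hasBasis_nhds_zero_of_basis
      Metric.nhds_basis_closedBall).mem_of_mem (i := ({e | WordBdd w' (J' e)}, r))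
        ⟨hE'.isVonNBounded hw', hr⟩) fun u hu f hf g hg => ?_
    have h1 := h _ _ (hSw g hg) (hSv f hf)
    change A u f g ∈ _
    rw [hA]
    refine hu _ ?_
    rw [Set.mem_ofPred_eq, hE'.apply_ofFun hw' h1]
    exact h1
  have hTD : ∀ a f g, T (D' a) f g = ∫ x, bornJordanOp (J' a) (J f) x * J g x := by
    intro a f g
    obtain ⟨_, _, ha⟩ := hE'.exists_wordBdd a
    obtain ⟨v, hv, hf⟩ := hE.exists_wordBdd f
    obtain ⟨w, hw, hg⟩ := hE.exists_wordBdd g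
    obtain ⟨w', hw', h⟩ := hW.exists_bornJordanDistribution d hw hv
    rw [ha.integral_bornJordanOp_mul hf hg]
    change A (D' a) f g = _
    rw [hA, hD', hE'.apply_ofFun hw' (h _ _ hg hf)]
  refine ⟨⟨T, hT⟩, hTD, fun T' hT' h u => ?_⟩
  ext f g
  refine congrFun ((denseRange_toDual hW hE' D' hD').equalizer
    (g := fun u => T' u f g) (h := fun u => T u f g) (hT' f g) ?_ (funext fun a => (h a f g).trans (hTD a f g).symm)) u
  change Continuous fun u => A u f g
  simp only [hA]
  exact continuous_eval_const (F := StrongDual ℂ E') _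

end IsTestSpace

/-! ### Weight classes -/

section WeightClasses

/-- The weight `C h^n n!^s`. -/
def gsWeight (s C h : ℝ) (n : ℕ) : ℝ := C * h ^ n * (n ! : ℝ) ^ s

/-- The weights of `𝒮_s`. -/
def roumieuClass (s : ℝ) : Set (ℕ → ℝ) :=
  {w | ∃ C h : ℝ, 0 ≤ C ∧ 0 ≤ h ∧ ∀ n, w n ≤ gsWeight s C h n}

/-- The weights of `Σ_s`. -/
def beurlingClass (s : ℝ) : Set (ℕ → ℝ) :=
  {w | ∀ h : ℝ, 0 < h → ∃ C : ℝ, 0 ≤ C ∧ ∀ n, w n ≤ gsWeight s C h n}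

variable {s C C' h h' A : ℝ} {w v : ℕ → ℝ} {n : ℕ}

theorem gsWeight_nonneg (hC : 0 ≤ C) (hh : 0 ≤ h) (n : ℕ) : 0 ≤ gsWeight s C h n := by
  unfold gsWeight
  positivity

theorem gsWeight_mono (hC : 0 ≤ C) (hCC : C ≤ C') (hh : 0 ≤ h) (hhh : h ≤ h') (n : ℕ) :
    gsWeight s C h n ≤ gsWeight s C' h' n := by
  have : 0 ≤ C' := hC.trans hCC
  unfold gsWeight
  gcongr

/-! ### Factorial inequalities and their effect on the weights -/

theorem factorial_add_le (m n : ℕ) : (m + n)! ≤ 2 ^ (m + n) * (m ! * n !) := by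
  rw [← Nat.add_choose_mul_factorial_mul_factorial m n, mul_assoc]
  exact Nat.mul_le_mul_right _ (Nat.choose_le_two_pow _ _)

theorem factorial_add_rpow_le (hs : 0 ≤ s) (m n : ℕ) :
    ((m + n)! : ℝ) ^ s ≤ (2 ^ s) ^ (m + n) * ((m ! : ℝ) ^ s * (n ! : ℝ) ^ s) := by
  rw [← Real.mul_rpow (by positivity) (by positivity), ← Real.rpow_natCast, ← Real.rpow_mul
    zero_le_two, mul_comm s, Real.rpow_mul zero_le_two, Real.rpow_natCast,
    ← Real.mul_rpow (by positivity) (by positivity)]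
  exact Real.rpow_le_rpow (by positivity) (by exact_mod_cast factorial_add_le m n) hs

theorem factorial_mul_rpow_le (hs : 0 ≤ s) (m n : ℕ) :
    (m ! : ℝ) ^ s * (n ! : ℝ) ^ s ≤ ((m + n)! : ℝ) ^ s := by
  rw [← Real.mul_rpow (by positivity) (by positivity)]
  refine Real.rpow_le_rpow (by positivity) ?_ hs
  exact_mod_cast Nat.le_of_dvd (Nat.factorial_pos _) (Nat.factorial_mul_factorial_dvd_factorial_add m n)

theorem gsWeight_shift_add (hs : 0 ≤ s) (hC : 0 ≤ C) (hh : 0 ≤ h) (n k : ℕ) :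
    gsWeight s C h (n + k) ≤
      gsWeight s (C * (h * 2 ^ s) ^ k * (k ! : ℝ) ^ s) (h * 2 ^ s) n := by
  calc gsWeight s C h (n + k) ≤ C * h ^ (n + k) *
        ((2 ^ s) ^ (n + k) * ((n ! : ℝ) ^ s * (k ! : ℝ) ^ s)) := by
        unfold gsWeight
        gcongr
        exact factorial_add_rpow_le hs n k
    _ = _ := by
        simp only [gsWeight, mul_pow, pow_add]
        ring

theorem gsWeight_conv (hs : 0 ≤ s) (hC : 0 ≤ C) (hC' : 0 ≤ C') (hh : 0 ≤ h)
    (hw : ∀ n, w n ≤ gsWeight s C h n) (hv : ∀ n, v n ≤ gsWeight s C' h n) (hv0 : ∀ n, 0 ≤ v n)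
    (n : ℕ) :
    ∑ j ∈ Finset.range (n + 1), w j * v (n - j) ≤ gsWeight s (C * C') (2 * h) n := by
  have h1 : ∀ j ∈ Finset.range (n + 1), w j * v (n - j) ≤ C * C' * h ^ n * (n ! : ℝ) ^ s := by
    intro j hj
    have hjn : j + (n - j) = n := by
      have := Finset.mem_range.1 hj
      omega
    calc w j * v (n - j) ≤ gsWeight s C h j * gsWeight s C' h (n - j) :=
          mul_le_mul (hw _) (hv _) (hv0 _) (gsWeight_nonneg hC hh _)
      _ = C * C' * h ^ (j + (n - j)) * ((j ! : ℝ) ^ s * ((n - j)! : ℝ) ^ s) := by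
          simp only [gsWeight, pow_add]
          ring
      _ ≤ C * C' * h ^ (j + (n - j)) * ((j + (n - j))! : ℝ) ^ s := by
          gcongr
          exact factorial_mul_rpow_le hs _ _
      _ = _ := by rw [hjn]
  refine (Finset.sum_le_sum h1).trans ?_
  rw [Finset.sum_const, Finset.card_range, nsmul_eq_mul, gsWeight, mul_pow]
  -- The number of splittings of `n` is absorbed by doubling `h`.
  have h2 : ((n + 1 : ℕ) : ℝ) ≤ 2 ^ n := by exact_mod_cast Nat.lt_two_pow_self
  calc ((n + 1 : ℕ) : ℝ) * (C * C' * h ^ n * (n ! : ℝ) ^ s)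
      ≤ 2 ^ n * (C * C' * h ^ n * (n ! : ℝ) ^ s) := by gcongr
    _ = _ := by ring

/-! ### Stability of the three weight classes -/

theorem isWeightClass_univ : IsWeightClass Set.univ where
  add _ _ := trivial
  shift _ := trivial
  scale _ _ _ _ _ := trivial
  conv _ _ _ _ := trivial
  split {w} _ := by
    -- `v n` dominates every `w j` with `j ≤ 2 n`, and `m + n` is at most twice the larger index;
    -- the summand `1` makes the other factor harmless.
    set v : ℕ → ℝ := fun n => 1 + ∑ j ∈ Finset.range (2 * n + 1), |w j| with hv
    have h1 : ∀ n, 1 ≤ v n := fun n =>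
      le_add_of_nonneg_right (Finset.sum_nonneg fun _ _ => abs_nonneg _)
    have h2 : ∀ j n, j ≤ 2 * n → w j ≤ v n := fun j n hj => by
      have := Finset.single_le_sum (f := fun j => |w j|) (fun _ _ => abs_nonneg _)
        (Finset.mem_range.2 (by omega : j < 2 * n + 1))
      exact (le_abs_self _).trans (this.trans (le_add_of_nonneg_left zero_le_one))
    refine ⟨v, trivial, fun n => one_pos.trans_le (h1 n), fun m n => ?_⟩
    rcases le_total m n with hmn | hmn
    · exact (h2 _ n (by omega)).trans (le_mul_of_one_le_left (zero_le_one.trans (h1 n)) (h1 m))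
    · exact (h2 _ m (by omega)).trans (le_mul_of_one_le_right (zero_le_one.trans (h1 m)) (h1 n))

theorem isWeightClass_roumieuClass (hs : 0 ≤ s) : IsWeightClass (roumieuClass s) where
  add := by
    rintro w v ⟨C, h, hC, hh, hw⟩ ⟨C', h', hC', hh', hv⟩
    refine ⟨C + C', max h h', by positivity, le_max_of_le_left hh, fun n => ?_⟩
    refine (add_le_add ((hw n).trans (gsWeight_mono hC le_rfl hh (le_max_left h h') n))
      ((hv n).trans (gsWeight_mono hC' le_rfl hh' (le_max_right h h') n))).trans (le_of_eq ?_)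
    simp only [gsWeight]
    ring
  shift := by
    rintro w ⟨C, h, hC, hh, hw⟩
    exact ⟨_, _, by positivity, by positivity, fun n =>
      (hw _).trans (gsWeight_shift_add hs hC hh n 1)⟩
  scale := by
    rintro w ⟨C, h, hC, hh, hw⟩ C' A hC' hA
    refine ⟨C' * C, A * h, by positivity, by positivity, fun n => ?_⟩
    calc C' * A ^ n * w n ≤ C' * A ^ n * gsWeight s C h n := by gcongr; exact hw n
      _ = _ := by simp only [gsWeight, mul_pow]; ring
  conv := by
    rintro w v ⟨C, h, hC, hh, hw⟩ ⟨C', h', hC', hh', hv⟩ _ hv0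
    exact ⟨_, _, by positivity, by positivity, gsWeight_conv hs hC hC' (le_max_of_le_left hh)
      (fun n => (hw n).trans (gsWeight_mono hC le_rfl hh (le_max_left h h') n))
      (fun n => (hv n).trans (gsWeight_mono hC' le_rfl hh' (le_max_right h h') n)) hv0⟩
  split := by
    rintro w ⟨C, h, hC, hh, hw⟩
    -- The summands `1` give positivity and `C ≤ (C + 1)²`; the factor `2 ^ s` pays for the binomial
    -- coefficient in `(m + n)!`.
    refine ⟨gsWeight s (C + 1) ((h + 1) * 2 ^ s), ⟨_, _, by positivity, by positivity,
      fun n => le_rfl⟩, fun n => by unfold gsWeight; positivity, fun m n => ?_⟩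
    calc w (m + n) ≤ gsWeight s ((C + 1) * (C + 1)) (h + 1) (m + n) :=
          (hw _).trans (gsWeight_mono hC (by nlinarith) hh (by linarith) _)
      _ ≤ (C + 1) * (C + 1) * (h + 1) ^ (m + n) *
            ((2 ^ s) ^ (m + n) * ((m ! : ℝ) ^ s * (n ! : ℝ) ^ s)) := by
          unfold gsWeight
          gcongr
          exact factorial_add_rpow_le hs m n
      _ = _ := by
          simp only [gsWeight, mul_pow, pow_add]
          ring

/-- Rapidly decreasing sequences can be split. -/
theorem exists_split_of_geometric {c : ℕ → ℝ} (hc0 : ∀ n, 0 ≤ c n)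
    (hc : ∀ h : ℝ, 0 < h → ∃ C : ℝ, 0 ≤ C ∧ ∀ n, c n ≤ C * h ^ n) :
    ∃ b : ℕ → ℝ, (∀ n, 0 < b n) ∧ (∀ m n, c (m + n) ≤ b m * b n) ∧
      ∀ h : ℝ, 0 < h → ∃ C : ℝ, 0 ≤ C ∧ ∀ n, b n ≤ C * h ^ n := by
  have hsq : ∀ h : ℝ, 0 < h → h ≤ 1 → ∃ C : ℝ, 0 ≤ C ∧ ∀ n i, √(c (n + i)) ≤ C * h ^ n := by
    intro h hh hh1
    obtain ⟨C, hC0, hC⟩ := hc (h ^ 2) (by positivity)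
    refine ⟨√C, Real.sqrt_nonneg _, fun n i => ?_⟩
    calc √(c (n + i)) ≤ √(C * (h ^ 2) ^ (n + i)) := Real.sqrt_le_sqrt (hC _)
      _ = √C * h ^ (n + i) := by
          rw [Real.sqrt_mul hC0, ← pow_mul, mul_comm 2, pow_mul, Real.sqrt_sq (by positivity)]
      _ ≤ √C * h ^ n := by
          gcongr ?_ * ?_
          exact pow_le_pow_of_le_one hh.le hh1 (Nat.le_add_right _ _)
  have hbdd : ∀ n, BddAbove (Set.range fun i => √(c (n + i))) := by
    intro n
    obtain ⟨C, -, hC⟩ := hsq 1 one_pos le_rfl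
    exact ⟨C * 1 ^ n, by rintro _ ⟨i, rfl⟩; exact hC n i⟩
  have hsup : ∀ n, 0 ≤ ⨆ i, √(c (n + i)) := fun n => Real.iSup_nonneg fun _ => Real.sqrt_nonneg _
  -- Write `c (m + n)` as a product of two square roots: one is at most the supremum attached to
  -- `m`, the other the one attached to `n`. The term `1 / n!` is there for positivity and decays
  -- faster than every geometric sequence.
  refine ⟨fun n => (⨆ i, √(c (n + i))) + 1 / n !, fun n => by have := hsup n; positivity,
    fun m n => ?_, ?_⟩
  · have h1 : √(c (m + n)) ≤ (⨆ i, √(c (m + i))) + 1 / m ! :=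
      (le_ciSup (hbdd m) n).trans (le_add_of_nonneg_right (by positivity))
    have h2 : √(c (m + n)) ≤ (⨆ i, √(c (n + i))) + 1 / n ! := by
      rw [add_comm m n]
      exact (le_ciSup (hbdd n) m).trans (le_add_of_nonneg_right (by positivity))
    calc c (m + n) = √(c (m + n)) * √(c (m + n)) := (Real.mul_self_sqrt (hc0 _)).symm
      _ ≤ _ := mul_le_mul h1 h2 (Real.sqrt_nonneg _) ((Real.sqrt_nonneg _).trans h1)
  · intro h hh
    obtain ⟨C, hC0, hC⟩ := hsq (min h 1) (lt_min hh one_pos) (min_le_right _ _)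
    refine ⟨C + Real.exp h⁻¹, by positivity, fun n => ?_⟩
    rw [add_mul]
    refine add_le_add (ciSup_le fun i => (hC n i).trans ?_) ?_
    · gcongr
      exact min_le_left _ _
    · have h1 := Real.pow_div_factorial_le_exp h⁻¹ (by positivity) n
      calc 1 / (n ! : ℝ) = h⁻¹ ^ n / n ! * h ^ n := by
            rw [inv_pow]
            field_simp
        _ ≤ _ := by gcongr

theorem isWeightClass_beurlingClass (hs : 0 ≤ s) : IsWeightClass (beurlingClass s) where
  add := by
    intro w v hw hv h hh
    obtain ⟨C, hC, hw⟩ := hw h hh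
    obtain ⟨C', hC', hv⟩ := hv h hh
    refine ⟨C + C', by positivity, fun n => (add_le_add (hw n) (hv n)).trans (le_of_eq ?_)⟩
    simp only [gsWeight]
    ring
  shift := by
    intro w hw h hh
    obtain ⟨C, hC, hw⟩ := hw (h / 2 ^ s) (by positivity)
    have h2 : h / 2 ^ s * 2 ^ s = h := div_mul_cancel₀ _ (by positivity)
    have h1 := fun n => (hw _).trans (gsWeight_shift_add hs hC (by positivity) n 1)
    rw [h2] at h1
    exact ⟨_, by positivity, h1⟩
  scale := by
    intro w hw C' A hC' hA h hh
    -- `A + 1` instead of `A` avoids a division by zero.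
    obtain ⟨C, hC, hw⟩ := hw (h / (A + 1)) (by positivity)
    refine ⟨C' * C, by positivity, fun n => ?_⟩
    calc C' * A ^ n * w n ≤ C' * (A + 1) ^ n * gsWeight s C (h / (A + 1)) n := by
          have := gsWeight_nonneg (s := s) hC (by positivity : 0 ≤ h / (A + 1)) n
          refine (mul_le_mul_of_nonneg_left (hw n) (by positivity)).trans ?_
          gcongr
          linarith
      _ = _ := by
          simp only [gsWeight, div_pow]
          field_simp
  conv := by
    intro w v hw hv _ hv0 h hh
    obtain ⟨C, hC, hw⟩ := hw (h / 2) (by positivity)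
    obtain ⟨C', hC', hv⟩ := hv (h / 2) (by positivity)
    refine ⟨C * C', by positivity, fun n =>
      (gsWeight_conv hs hC hC' (by positivity) hw hv hv0 n).trans (le_of_eq ?_)⟩
    rw [mul_div_cancel₀ _ two_ne_zero]
  split := by
    intro w hw
    -- Dividing by `n!^s` leaves a sequence that decreases faster than every geometric one. The
    -- prepared factor `(2 ^ s) ^ n` later pays for splitting `(m + n)!^s`.
    obtain ⟨b, hb0, hb, hb'⟩ := exists_split_of_geometric
      (c := fun n => (2 ^ s) ^ n * (max (w n) 0 / (n ! : ℝ) ^ s)) (fun n => by positivity) (by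
        intro h hh
        obtain ⟨C, hC, hw⟩ := hw (h / 2 ^ s) (by positivity)
        refine ⟨C, hC, fun n => ?_⟩
        have h1 : max (w n) 0 / (n ! : ℝ) ^ s ≤ C * (h / 2 ^ s) ^ n := by
          rw [div_le_iff₀ (by positivity)]
          exact max_le (hw n) (gsWeight_nonneg hC (by positivity) n)
        calc (2 ^ s) ^ n * (max (w n) 0 / (n ! : ℝ) ^ s)
            ≤ (2 ^ s) ^ n * (C * (h / 2 ^ s) ^ n) := by gcongr
          _ = _ := by rw [div_pow]; field_simp)
    refine ⟨fun n => b n * (n ! : ℝ) ^ s, fun h hh => ?_, fun n => mul_pos (hb0 n) (by positivity),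
      fun m n => ?_⟩
    · obtain ⟨C, hC, h1⟩ := hb' h hh
      refine ⟨C, hC, fun n => ?_⟩
      exact mul_le_mul_of_nonneg_right (h1 n) (by positivity)
    · calc w (m + n) ≤ max (w (m + n)) 0 := le_max_left _ _
        _ = max (w (m + n)) 0 / ((m + n)! : ℝ) ^ s * ((m + n)! : ℝ) ^ s := by field_simp
        _ ≤ max (w (m + n)) 0 / ((m + n)! : ℝ) ^ s *
              ((2 ^ s) ^ (m + n) * ((m ! : ℝ) ^ s * (n ! : ℝ) ^ s)) := by
            gcongr
            exact factorial_add_rpow_le hs m n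
        _ = (2 ^ s) ^ (m + n) * (max (w (m + n)) 0 / ((m + n)! : ℝ) ^ s) *
              ((m ! : ℝ) ^ s * (n ! : ℝ) ^ s) := by ring
        _ ≤ b m * b n * ((m ! : ℝ) ^ s * (n ! : ℝ) ^ s) := by
            exact mul_le_mul_of_nonneg_right (hb m n) (by positivity)
        _ = _ := by ring

end WeightClasses

/-! ### Normal ordering of words -/

section NormalOrdering

variable {ι : Type} [Fintype ι] {f : EuclideanSpace ℝ ι → ℂ}

/-- The word in which all multiplications stand to the left of all derivatives. -/
def normalWord (l m : List ι) : List (ι ⊕ ι) := l.map .inl ++ m.map .inr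

/-- Moving a derivative through a block of multiplications. -/
theorem norm_wordOp_inr_normalWord_le (hf : ContDiff ℝ ∞ f) (i : ι) (σ : List (ι ⊕ ι))
    (x : EuclideanSpace ℝ ι) {B₀ B₁ : ℝ} (m : List ι) {n : ℕ} : ∀ k l : List ι,
    (∀ l', l'.length + m.length + 1 = n → ‖wordOp (σ ++ normalWord l' m) f x‖ ≤ B₀) →
    (∀ l', l'.length + m.length = n → ‖wordOp (σ ++ normalWord l' (i :: m)) f x‖ ≤ B₁) →
    k.length + l.length + m.length = n →
    ‖wordOp (σ ++ (k.map .inl ++ .inr i :: normalWord l m)) f x‖ ≤ l.length * B₀ + B₁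
  | k, [], _, h₁, hn => by
    simpa [normalWord] using h₁ k (by simpa using hn)
  | k, j :: l, h₀, h₁, hn => by
    classical
    have ih := norm_wordOp_inr_normalWord_le hf i σ x m (k ++ [j]) l h₀ h₁
      (by simp at hn ⊢; omega)
    have hB : ‖wordOp (σ ++ normalWord (k ++ l) m) f x‖ ≤ B₀ :=
      h₀ (k ++ l) (by simp at hn ⊢; omega)
    -- One step of the commutation `∂_i x_j = x_j ∂_i + δ_ij`; the last term is a normal word, two
    -- letters shorter, behind the same prefix.
    have h1 : wordOp (σ ++ (k.map .inl ++ .inr i :: normalWord (j :: l) m)) f =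
        wordOp (σ ++ ((k ++ [j]).map .inl ++ .inr i :: normalWord l m)) f +
          (if i = j then (1 : ℂ) else 0) • wordOp (σ ++ normalWord (k ++ l) m) f := by
      have hg := hf.wordOp (normalWord l m)
      have e1 : σ ++ (k.map .inl ++ .inr i :: normalWord (j :: l) m) =
          (σ ++ k.map .inl) ++ (.inr i :: .inl j :: normalWord l m) := by
        simp [normalWord]
      have e2 : σ ++ ((k ++ [j]).map .inl ++ .inr i :: normalWord l m) =
          (σ ++ k.map .inl) ++ (.inl j :: .inr i :: normalWord l m) := by
        simp
      have e3 : σ ++ normalWord (k ++ l) m = (σ ++ k.map .inl) ++ normalWord l m := by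
        simp [normalWord]
      have hc : ContDiff ℝ ∞ ((if i = j then (1 : ℂ) else 0) • wordOp (normalWord l m) f) :=
        hg.const_smul (if i = j then (1 : ℂ) else 0)
      rw [e1, e2, e3, wordOp_append, wordOp_append _ (_ :: _), wordOp_append _ (normalWord l m),
        wordOp_cons, wordOp_cons, letterOp_inr_inl hg, wordOp_add ((hg.letterOp _).letterOp _)
          hc, wordOp_smul hg]
      rfl
    rw [h1]
    have hB0 : 0 ≤ B₀ := (norm_nonneg _).trans hB
    refine (norm_add_le _ _).trans ?_
    have h2 : ‖((if i = j then (1 : ℂ) else 0) • wordOp (σ ++ normalWord (k ++ l) m) f) x‖ ≤ B₀ := by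
      split_ifs
      · simpa using hB
      · simpa using hB0
    have h3 := add_le_add ih h2
    refine h3.trans (le_of_eq ?_)
    push_cast [List.length_cons]
    ring

/-- The last letter of the unordered prefix is absorbed into the normal word. A multiplication fits
at once; a derivative must pass all multiplications, and each commutator loses two letters. The
condition `(n + 1) u n ≤ u (n + 2)` pays for all commutators together, so a letter costs a factor
`2`. -/
theorem norm_wordOp_append_normalWord_le (hf : ContDiff ℝ ∞ f) {u : ℕ → ℝ} (hu0 : ∀ n, 0 ≤ u n)
    (hu : ∀ n : ℕ, (n + 1) * u n ≤ u (n + 2)) (x : EuclideanSpace ℝ ι)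
    (h : ∀ l m, ‖wordOp (normalWord l m) f x‖ ≤ u (l.length + m.length)) (τ : List (ι ⊕ ι)) :
    ∀ l m, ‖wordOp (τ ++ normalWord l m) f x‖ ≤
      2 ^ τ.length * u (τ.length + l.length + m.length) := by
  induction τ using List.reverseRecOn with
  | nil => simpa using h
  | append_singleton τ ℓ ih =>
    intro l m
    rcases ℓ with i | i
    · have h1 := ih (i :: l) m
      have e : τ ++ [.inl i] ++ normalWord l m = τ ++ normalWord (i :: l) m := by simp [normalWord]
      have e2 : τ.length + (i :: l).length + m.length =
          (τ ++ [.inl i] : List (ι ⊕ ι)).length + l.length + m.length := by simp; omega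
      rw [e, ← e2]
      refine h1.trans ?_
      have := hu0 (τ.length + (i :: l).length + m.length)
      gcongr
      · exact one_le_two
      · simp
    · have e : τ ++ [.inr i] ++ normalWord l m =
          τ ++ (([] : List ι).map .inl ++ .inr i :: normalWord l m) := by simp
      rw [e]
      set n := l.length + m.length
      have hlen : (τ ++ [.inr i] : List (ι ⊕ ι)).length + l.length + m.length
          = τ.length + n + 1 := by simp [n]; omega
      rw [hlen]
      -- A single derivative has nothing to pass; otherwise the commutator terms have length
      -- `τ.length + n - 1`, here called `N`.
      rcases Nat.eq_zero_or_pos (τ.length + n) with h0 | h0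
      · have hl : l = [] := List.length_eq_zero_iff.1 (by omega)
        have hm : m = [] := List.length_eq_zero_iff.1 (by omega)
        have ht : τ = [] := List.length_eq_zero_iff.1 (by omega)
        subst hl hm ht
        have h1 := h [] [i]
        have := hu0 1
        simp [normalWord] at h1 ⊢
        simp [n]
        linarith
      · obtain ⟨N, hN⟩ : ∃ N, τ.length + n = N + 1 := ⟨τ.length + n - 1, by omega⟩
        have h1 := norm_wordOp_inr_normalWord_le hf i τ x (B₀ := 2 ^ τ.length * u N)
          (B₁ := 2 ^ τ.length * u (N + 2)) m (n := n) [] l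
          (fun l' hl' => by
            have := ih l' m
            rwa [show τ.length + l'.length + m.length = N by omega] at this)
          (fun l' hl' => by
            have := ih l' (i :: m)
            rwa [show τ.length + l'.length + (i :: m).length = N + 2 by simp; omega] at this)
          (by simp [n])
        refine h1.trans ?_
        rw [hN, List.length_append, List.length_singleton, pow_succ]
        have h2 : (l.length : ℝ) * u N ≤ u (N + 2) := by
          refine le_trans ?_ (hu N)
          have : (l.length : ℝ) ≤ N + 1 := by
            rw [← Nat.cast_succ]
            exact_mod_cast (by omega : l.length ≤ N + 1)
          exact mul_le_mul_of_nonneg_right this (hu0 N)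
        calc (l.length : ℝ) * (2 ^ τ.length * u N) + 2 ^ τ.length * u (N + 2)
            = 2 ^ τ.length * (l.length * u N + u (N + 2)) := by ring
          _ ≤ 2 ^ τ.length * (u (N + 2) + u (N + 2)) := by gcongr
          _ = _ := by ring

/-- Bounds for normally ordered words imply bounds for all words. -/
theorem wordBdd_of_normalWord (hf : ContDiff ℝ ∞ f) {u : ℕ → ℝ} (hu0 : ∀ n, 0 ≤ u n)
    (hu : ∀ n : ℕ, (n + 1) * u n ≤ u (n + 2))
    (h : ∀ l m x, ‖wordOp (normalWord l m) f x‖ ≤ u (l.length + m.length)) :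
    WordBdd (fun n => 2 ^ n * u n) f :=
  ⟨hf, fun τ x => by
    simpa [normalWord] using
      norm_wordOp_append_normalWord_le hf hu0 hu x (fun l m => h l m x) τ [] []⟩

end NormalOrdering

/-! ### Words and multi-indices -/

section MultiIndex

variable {ι : Type} [Fintype ι] {f : EuclideanSpace ℝ ι → ℂ}

theorem wordOp_map_inr_perm (hf : ContDiff ℝ ∞ f) {l m : List ι} (h : l.Perm m) :
    wordOp (l.map .inr) f = wordOp (m.map .inr) f := by
  induction h with
  | nil => rfl
  | cons i _ ih => rw [List.map_cons, List.map_cons, wordOp_cons, wordOp_cons, ih]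
  | swap i j l => exact letterOp_inr_comm (hf.wordOp _) _ _
  | trans _ _ ih₁ ih₂ => exact ih₁.trans ih₂

theorem wordOp_map_inl (l : List ι) (f : EuclideanSpace ℝ ι → ℂ) (x : EuclideanSpace ℝ ι) :
    wordOp (l.map .inl) f x = (((l.map fun i => x i).prod : ℝ) : ℂ) * f x := by
  induction l with
  | nil => simp [wordOp_nil]
  | cons i l ih =>
    rw [List.map_cons, wordOp_cons, letterOp_inl, ih]
    push_cast [List.map_cons, List.prod_cons]
    ring

theorem iteratedFDeriv_basis_eq_wordOp (hf : ContDiff ℝ ∞ f) : ∀ (n : ℕ) (σ : Fin n → ι)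
    (x : EuclideanSpace ℝ ι),
    iteratedFDeriv ℝ n f x (fun j => EuclideanSpace.basisFun ι ℝ (σ j)) =
      wordOp ((List.ofFn σ).map .inr) f x
  | 0, σ, x => by simp [wordOp_nil]
  | n + 1, σ, x => by
    have ih := iteratedFDeriv_basis_eq_wordOp hf n (Fin.tail σ)
    rw [List.ofFn_succ, List.map_cons, wordOp_cons, letterOp_inr, iteratedFDeriv_succ_apply_left]
    have hd : DifferentiableAt ℝ (iteratedFDeriv ℝ n f) x :=
      (hf.differentiable_iteratedFDeriv (m := n) (by exact_mod_cast WithTop.coe_lt_top n)) x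
    have h1 : wordOp ((List.ofFn fun j : Fin n => σ j.succ).map .inr) f =
        fun y => iteratedFDeriv ℝ n f y fun j => EuclideanSpace.basisFun ι ℝ (Fin.tail σ j) :=
      funext fun y => (ih y).symm
    rw [h1]
    have h2 := (ContinuousMultilinearMap.apply ℝ (fun _ : Fin n => EuclideanSpace ℝ ι) ℂ
      fun j => EuclideanSpace.basisFun ι ℝ (Fin.tail σ j)).hasFDerivAt.comp x hd.hasFDerivAt
    have h3 := h2.fderiv
    change _ = fderiv ℝ ((ContinuousMultilinearMap.apply ℝ (fun _ : Fin n => EuclideanSpace ℝ ι) ℂ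
      fun j => EuclideanSpace.basisFun ι ℝ (Fin.tail σ j)) ∘ iteratedFDeriv ℝ n f) x _
    rw [h3]
    rfl

variable [DecidableEq ι]

/-- The list of directions in the definition of `multiDeriv` has the right multiplicities. -/
theorem count_directions (α : ι → ℕ) (e : (Σ i, Fin (α i)) ≃ Fin (∑ i, α i)) (i : ι) :
    (List.ofFn fun j => (e.symm j).1).count i = α i := by
  rw [← Multiset.coe_count, ← Fin.univ_val_map, Multiset.count_map]
  have h : (Multiset.filter (fun j => i = (e.symm j).1) Finset.univ.val).card =
      (Finset.univ.filter fun j => i = (e.symm j).1).card := rfl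
  rw [h, Finset.card_equiv e.symm (t := Finset.univ.filter fun p : Σ i, Fin (α i) => i = p.1)
    (by simp)]
  rw [← Finset.univ_sigma_univ, Finset.filter_sigma, Finset.card_sigma,
    Finset.sum_eq_single i]
  · simp
  · intro j _ hj
    simp [hj.symm]
  · simp

theorem wordOp_map_inr_eq_multiDeriv (hf : ContDiff ℝ ∞ f) (l : List ι) (x : EuclideanSpace ℝ ι) :
    wordOp (l.map .inr) f x = multiDeriv (fun i => l.count i) f x := by
  rw [multiDeriv, iteratedFDeriv_basis_eq_wordOp hf]
  refine congrFun (wordOp_map_inr_perm hf (List.perm_iff_count.2 fun i => ?_)) x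
  rw [count_directions]

theorem norm_wordOp_normalWord (hf : ContDiff ℝ ∞ f) (l m : List ι) (x : EuclideanSpace ℝ ι) :
    ‖wordOp (normalWord l m) f x‖ =
      |∏ i, x i ^ l.count i| * ‖multiDeriv (fun i => m.count i) f x‖ := by
  rw [normalWord, wordOp_append, wordOp_map_inl, norm_mul, Complex.norm_real, Real.norm_eq_abs,
    wordOp_map_inr_eq_multiDeriv hf, Finset.prod_list_map_count]
  congr 2
  refine Finset.prod_subset (Finset.subset_univ _) fun i _ hi => ?_
  rw [List.count_eq_zero_of_not_mem (by simpa using hi), pow_zero]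

end MultiIndex

/-! ### Word bounds and Gelfand-Shilov seminorms -/

section GelfandShilovWords

variable {ι : Type} [Fintype ι] {f : EuclideanSpace ℝ ι → ℂ} {s C h h' : ℝ} {w : ℕ → ℝ}

theorem exists_list_count [DecidableEq ι] (α : ι → ℕ) :
    ∃ l : List ι, (∀ i, l.count i = α i) ∧ l.length = ∑ i, α i :=
  ⟨_, count_directions α (Fintype.equivFinOfCardEq (by simp)), List.length_ofFn⟩

theorem sum_count_eq_length [DecidableEq ι] (l : List ι) : ∑ i, l.count i = l.length := by
  simpa using Multiset.sum_count_eq_card (s := Finset.univ) (m := (l : Multiset ι)) (by simp)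

theorem factorial_sum_le {κ : Type*} (t : Finset κ) (α : κ → ℕ) :
    (∑ i ∈ t, α i)! ≤ (2 ^ t.card) ^ (∑ i ∈ t, α i) * ∏ i ∈ t, (α i)! := by
  classical
  induction t using Finset.induction_on with
  | empty => simp
  | insert a t ha ih =>
    rw [Finset.sum_insert ha, Finset.prod_insert ha, Finset.card_insert_of_notMem ha]
    set N := ∑ i ∈ t, α i
    calc (α a + N)! ≤ 2 ^ (α a + N) * ((α a)! * N !) := factorial_add_le _ _
      _ ≤ 2 ^ (α a + N) * ((α a)! * ((2 ^ t.card) ^ (α a + N) * ∏ i ∈ t, (α i)!)) := by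
          gcongr
          refine ih.trans ?_
          gcongr
          · exact Nat.one_le_two_pow
          · omega
      _ = _ := by
          rw [pow_succ, mul_pow]
          ring

/-- Factorials of lengths and products of factorials of multi-indices agree up to geometric factors,
which a change of `h` absorbs. -/
theorem factorial_sum_rpow_le (hs : 0 ≤ s) (α β : ι → ℕ) :
    ((∑ i, α i + ∑ i, β i)! : ℝ) ^ s ≤ (((2 : ℝ) ^ (Fintype.card ι + 1)) ^ s) ^
      (∑ i, α i + ∑ i, β i) * (((∏ i, (α i)! : ℕ) : ℝ) * ((∏ i, (β i)! : ℕ) : ℝ)) ^ s := by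
  have h1 : (∑ i, α i + ∑ i, β i)! ≤ (2 ^ (Fintype.card ι + 1)) ^ (∑ i, α i + ∑ i, β i) *
      ((∏ i, (α i)!) * ∏ i, (β i)!) := by
    refine (factorial_add_le _ _).trans ((Nat.mul_le_mul_left _ (Nat.mul_le_mul
      (factorial_sum_le Finset.univ α) (factorial_sum_le Finset.univ β))).trans (le_of_eq ?_))
    rw [Finset.card_univ, pow_succ 2, mul_pow, pow_add (2 ^ Fintype.card ι)]
    ring
  rw [← Real.rpow_natCast, ← Real.rpow_mul (by positivity), mul_comm s, Real.rpow_mul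
    (by positivity), Real.rpow_natCast, ← Real.mul_rpow (by positivity) (by positivity)]
  exact Real.rpow_le_rpow (by positivity) (by exact_mod_cast h1) hs

/-- This direction needs no commutators and holds for all `s ≥ 0`, because normally ordered words
are among all words. -/
theorem WordBdd.gsQuot_le (hf : WordBdd w f) (hs : 0 ≤ s) (hC : 0 ≤ C) (hh : 0 ≤ h)
    (hw : ∀ n, w n ≤ gsWeight s C h n) (hh' : 0 < h')
    (hle : h * ((2 : ℝ) ^ (Fintype.card ι + 1)) ^ s ≤ h') (α β : ι → ℕ)
    (x : EuclideanSpace ℝ ι) : gsQuot s h' f α β x ≤ C := by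
  classical
  obtain ⟨l, hl, hl'⟩ := exists_list_count β
  obtain ⟨m, hm, hm'⟩ := exists_list_count α
  have h1 := (hf.2 (normalWord l m) x).trans (hw _)
  rw [norm_wordOp_normalWord hf.1] at h1
  simp only [hl, hm] at h1
  have hlen : (normalWord l m).length = ∑ i, α i + ∑ i, β i := by
    simp [normalWord, hl', hm', add_comm]
  rw [hlen] at h1
  rw [gsQuot, div_le_iff₀ (by positivity)]
  refine h1.trans ?_
  calc gsWeight s C h (∑ i, α i + ∑ i, β i) ≤ C * h ^ (∑ i, α i + ∑ i, β i) * _ :=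
        mul_le_mul_of_nonneg_left (factorial_sum_rpow_le hs α β) (by positivity)
    _ = C * ((h * ((2 : ℝ) ^ (Fintype.card ι + 1)) ^ s) ^ (∑ i, α i + ∑ i, β i) *
          (((∏ i, (α i)! : ℕ) : ℝ) * ((∏ i, (β i)! : ℕ) : ℝ)) ^ s) := by
        rw [mul_pow]
        ring
    _ ≤ _ := by gcongr

theorem norm_wordOp_normalWord_le (hs : 0 ≤ s) (hh : 0 < h) (hf : ContDiff ℝ ∞ f)
    (hC : ∀ α β x, gsQuot s h f α β x ≤ C) (l m : List ι) (x : EuclideanSpace ℝ ι) :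
    ‖wordOp (normalWord l m) f x‖ ≤ gsWeight s C h (l.length + m.length) := by
  classical
  have hC0 : 0 ≤ C := (gsQuot_nonneg hh 0 0 x).trans (hC 0 0 x)
  have h1 := hC (fun i => m.count i) (fun i => l.count i) x
  rw [gsQuot, div_le_iff₀ (by positivity), sum_count_eq_length, sum_count_eq_length] at h1
  rw [norm_wordOp_normalWord hf, gsWeight, add_comm l.length, mul_assoc]
  refine h1.trans ?_
  gcongr
  have h2 : (∏ i, (m.count i)!) * ∏ i, (l.count i)! ≤ (m.length + l.length)! := by
    refine le_trans (Nat.mul_le_mul (Nat.le_of_dvd (Nat.factorial_pos _)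
      (Nat.prod_factorial_dvd_factorial_sum _ _)) (Nat.le_of_dvd (Nat.factorial_pos _)
      (Nat.prod_factorial_dvd_factorial_sum _ _))) ?_
    rw [sum_count_eq_length, sum_count_eq_length]
    exact Nat.le_of_dvd (Nat.factorial_pos _) (Nat.factorial_mul_factorial_dvd_factorial_add _ _)
  exact_mod_cast h2

/-- Bounds for Gelfand-Shilov seminorms imply word bounds. -/
theorem wordBdd_of_gsQuot_le (hs : 1 / 2 ≤ s) (hh : 0 < h) {k : ℕ}
    (hk : 1 ≤ h ^ 2 * (k + 1 : ℝ) ^ (2 * s - 1)) (hf : ContDiff ℝ ∞ f)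
    (hC : ∀ α β x, gsQuot s h f α β x ≤ C) :
    WordBdd (gsWeight s (C * ((2 ^ s) ^ k * (k ! : ℝ) ^ s)) (2 * (h * 2 ^ s))) f := by
  have hs0 : 0 ≤ s := by linarith
  have hC0 : 0 ≤ C := (gsQuot_nonneg hh 0 0 0).trans (hC 0 0 0)
  -- The condition on `u` asks that `h² ((n+k+2)(n+k+1))^s` be at least `n + 1`. It follows from `h²
  -- (n+k+1)^{2s-1} ≥ 1`, hence from `hk` as `2s - 1 ≥ 0`. The shift `k` lets small `h` satisfy it
  -- when `s > 1/2`.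
  refine (wordBdd_of_normalWord hf (u := fun n => C * h ^ n * ((n + k)! : ℝ) ^ s)
    (fun n => by positivity) (fun n => ?_) fun l m x => ?_).mono fun n => ?_
  · have e : ((n + 2 + k)! : ℝ) = ((n + k + 2 : ℝ) * (n + k + 1)) * (n + k)! := by
      have h1 : n + 2 + k = n + k + 1 + 1 := by omega
      rw [h1, Nat.factorial_succ, Nat.factorial_succ]
      push_cast
      ring
    have h2 : (n + 1 : ℝ) ≤ h ^ 2 * ((n + k + 2 : ℝ) * (n + k + 1)) ^ s := by
      calc (n + 1 : ℝ) ≤ n + k + 1 := by linarith [Nat.cast_nonneg (α := ℝ) k]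
        _ ≤ h ^ 2 * (k + 1 : ℝ) ^ (2 * s - 1) * (n + k + 1) :=
            le_mul_of_one_le_left (by positivity) hk
        _ ≤ h ^ 2 * (n + k + 1 : ℝ) ^ (2 * s - 1) * (n + k + 1) := by
            have : (0 : ℝ) ≤ n := Nat.cast_nonneg n
            gcongr
            · linarith
            · linarith
        _ = h ^ 2 * ((n + k + 1 : ℝ) * (n + k + 1)) ^ s := by
            rw [← pow_two, ← Real.rpow_natCast (_ : ℝ) 2, ← Real.rpow_natCast (_ : ℝ) 2,
              ← Real.rpow_mul (by positivity), mul_assoc, ← Real.rpow_add_one (by positivity)]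
            norm_num
        _ ≤ _ := by
            gcongr
            norm_num
    change _ ≤ C * h ^ (n + 2) * ((n + 2 + k)! : ℝ) ^ s
    rw [e, Real.mul_rpow (by positivity) (by positivity)]
    calc (n + 1 : ℝ) * (C * h ^ n * ((n + k)! : ℝ) ^ s)
        ≤ h ^ 2 * ((n + k + 2 : ℝ) * (n + k + 1)) ^ s * (C * h ^ n * ((n + k)! : ℝ) ^ s) := by
          gcongr
      _ = _ := by ring
  · refine (norm_wordOp_normalWord_le hs0 hh hf hC l m x).trans ?_
    exact mul_le_mul_of_nonneg_left (Real.rpow_le_rpow (by positivity)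
      (by exact_mod_cast Nat.factorial_le (Nat.le_add_right _ _)) hs0) (by positivity)
  · calc 2 ^ n * (C * h ^ n * ((n + k)! : ℝ) ^ s)
        ≤ 2 ^ n * (C * h ^ n * ((2 ^ s) ^ (n + k) * ((n ! : ℝ) ^ s * (k ! : ℝ) ^ s))) := by
          gcongr
          exact factorial_add_rpow_le hs0 n k
      _ = _ := by
          simp only [gsWeight, mul_pow, pow_add]
          ring

theorem exists_wordBdd_of_gsQuot_le (hs : 1 / 2 ≤ s) (hh : 0 < h) :
    ∃ h' : ℝ, 0 ≤ h' ∧ ∀ (f : EuclideanSpace ℝ ι → ℂ) (C : ℝ), ContDiff ℝ ∞ f →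
      (∀ α β x, gsQuot s h f α β x ≤ C) → WordBdd (gsWeight s C h') f := by
  refine ⟨2 * (max h 1 * 2 ^ s), by positivity, fun f C hf hC => ?_⟩
  have h1 := wordBdd_of_gsQuot_le (h := max h 1) (k := 0) hs (by positivity) (by
    simp only [Nat.cast_zero, zero_add, Real.one_rpow, mul_one]
    exact one_le_pow₀ (le_max_right _ _)) hf (fun α β x => le_trans (by
      unfold gsQuot
      gcongr
      exact le_max_left _ _) (hC α β x))
  simpa using h1

/-- For `s > 1/2` the factor `(k + 1)^{2s-1}` is unbounded, so a large shift compensates any small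
`h`. The strict inequality is indispensable to this argument. -/
theorem exists_wordBdd_of_gsQuot_le_of_lt (hs : 1 / 2 < s) (hh : 0 < h') :
    ∃ h A : ℝ, 0 < h ∧ 0 ≤ A ∧ ∀ (f : EuclideanSpace ℝ ι → ℂ) (C : ℝ), ContDiff ℝ ∞ f →
      (∀ α β x, gsQuot s h f α β x ≤ C) → WordBdd (gsWeight s (C * A) h') f := by
  set h : ℝ := h' / (2 * 2 ^ s) with hh1
  have hh0 : 0 < h := by positivity
  have ht := (tendsto_rpow_atTop (by linarith : 0 < 2 * s - 1)).comp
    (Filter.tendsto_atTop_add_const_right _ (1 : ℝ) tendsto_natCast_atTop_atTop)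
  obtain ⟨k, hk⟩ := (ht.eventually_ge_atTop (h ^ 2)⁻¹).exists
  refine ⟨h, (2 ^ s) ^ k * (k ! : ℝ) ^ s, hh0, by positivity, fun f C hf hC => ?_⟩
  have h1 := wordBdd_of_gsQuot_le (h := h) (k := k) hs.le hh0 (by
    rw [inv_le_iff_one_le_mul₀ (by positivity)] at hk
    rw [mul_comm]
    exact hk) hf hC
  have e : 2 * (h * 2 ^ s) = h' := by
    rw [hh1]
    field_simp
  rwa [e] at h1

end GelfandShilovWords

/-! ### Seminorms that are bounded on bounded sets -/

section Bornological

/-- Countably many seminorms make the space bornological: otherwise there are `e k` with `p (e k) =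
k` and `q k (e k) ≤ 1`. By monotonicity the sequence is bounded for every `q k`, but not for `p`. -/
theorem Seminorm.exists_le_mul_of_bounded {E : Type*} [AddCommGroup E] [Module ℂ E]
    (q : ℕ → Seminorm ℂ E) (hq : Monotone q) (p : Seminorm ℂ E)
    (h : ∀ B : Set E, (∀ k, ∃ C : ℝ, ∀ e ∈ B, q k e ≤ C) → ∃ C : ℝ, ∀ e ∈ B, p e ≤ C) :
    ∃ (k : ℕ) (C : ℝ), 0 ≤ C ∧ ∀ e, p e ≤ C * q k e := by
  by_contra! hcon
  have h1 : ∀ k : ℕ, ∃ e, p e = k ∧ q k e ≤ 1 := by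
    intro k
    obtain ⟨e, he⟩ := hcon k k (Nat.cast_nonneg k)
    have hq0 : 0 ≤ q k e := apply_nonneg _ _
    have hp : 0 < p e := lt_of_le_of_lt (by positivity) he
    refine ⟨((k / p e : ℝ) : ℂ) • e, ?_, ?_⟩
    · rw [map_smul_eq_mul, Complex.norm_real, Real.norm_of_nonneg (by positivity)]
      field_simp
    · rw [map_smul_eq_mul, Complex.norm_real, Real.norm_of_nonneg (by positivity), div_mul_eq_mul_div,
        div_le_one hp]
      exact he.le
  choose e hp hq1 using h1
  obtain ⟨C, hC⟩ := h (Set.range e) fun k => by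
    refine ⟨1 + ∑ j ∈ Finset.range k, q k (e j), ?_⟩
    rintro _ ⟨j, rfl⟩
    have h0 : ∀ j, 0 ≤ q k (e j) := fun j => apply_nonneg _ _
    rcases lt_or_ge j k with hj | hj
    · have := Finset.single_le_sum (f := fun j => q k (e j)) (fun j _ => h0 j)
        (Finset.mem_range.2 hj)
      linarith
    · have h2 : q k (e j) ≤ q j (e j) := hq hj _
      have h3 := Finset.sum_nonneg (s := Finset.range k) fun j _ => h0 j
      linarith [hq1 j]
  obtain ⟨k, hk⟩ := exists_nat_gt C
  have := hC _ ⟨k, rfl⟩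
  rw [hp] at this
  linarith

theorem Seminorm.continuous_of_bounded {E : Type*} [AddCommGroup E] [Module ℂ E]
    [TopologicalSpace E] [IsTopologicalAddGroup E] (q : ℕ → Seminorm ℂ E) (hq : Monotone q)
    (hqc : ∀ k, Continuous (q k)) (p : Seminorm ℂ E)
    (h : ∀ B : Set E, (∀ k, ∃ C : ℝ, ∀ e ∈ B, q k e ≤ C) → ∃ C : ℝ, ∀ e ∈ B, p e ≤ C) :
    Continuous p := by
  obtain ⟨k, C, -, hC⟩ := Seminorm.exists_le_mul_of_bounded q hq p h
  refine Seminorm.continuous_of_continuousAt_zero ?_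
  rw [ContinuousAt, map_zero]
  refine squeeze_zero (fun _ => apply_nonneg _ _) hC ?_
  have := ((hqc k).const_mul C).tendsto 0
  simpa using this

end Bornological

/-! ### The spaces `𝒮_s` are described by word bounds -/

namespace GelfandShilov

variable {s : ℝ} {ι : Type} [Fintype ι]

/-- Elements of `𝒮_s` as functions. -/
def toFunLM (s : ℝ) (ι : Type) [Fintype ι] :
    GelfandShilov s ι →ₗ[ℂ] (EuclideanSpace ℝ ι → ℂ) where
  toFun f := f
  map_add' := coe_add
  map_smul' := coe_smul

theorem contDiff (f : GelfandShilov s ι) : ContDiff ℝ ∞ f := by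
  obtain ⟨h, _, hf⟩ := f.exists_isGS
  exact hf.1

theorem wordOp_smul_apply (c : ℂ) (f : GelfandShilov s ι) (τ : List (ι ⊕ ι))
    (x : EuclideanSpace ℝ ι) : wordOp τ ⇑(c • f) x = c * wordOp τ f x := by
  rw [coe_smul, wordOp_smul f.contDiff]
  rfl

theorem exists_seminorm_le_of_wordBdd (p : Seminorm ℂ (GelfandShilov s ι))
    (hp : ∀ h : ℝ, 0 < h → ∃ C : ℝ, ∀ f : GelfandShilov s ι, IsGS s h f → p f ≤ C * gsNorm s h f)
    (hs : 0 ≤ s) {w : ℕ → ℝ} (hw : w ∈ roumieuClass s) :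
    ∃ C : ℝ, ∀ f : GelfandShilov s ι, WordBdd w f → p f ≤ C := by
  obtain ⟨C, h, hC, hh, hw⟩ := hw
  set h' := h * ((2 : ℝ) ^ (Fintype.card ι + 1)) ^ s + 1
  have hh' : 0 < h' := by positivity
  obtain ⟨A, hA⟩ := hp h' hh'
  refine ⟨|A| * C, fun f hf => ?_⟩
  have h1 := hf.gsQuot_le hs hC hh hw hh' (by linarith)
  have h2 : gsNorm s h' f ≤ C := ciSup_le fun q => h1 _ _ _
  refine (hA f ⟨hf.1, C, h1⟩).trans ?_
  have h3 : 0 ≤ gsNorm s h' f := gsNorm_nonneg hh'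
  exact mul_le_mul (le_abs_self A) h2 h3 (abs_nonneg A)

theorem exists_wordBdd_of_isGS (hs : 1 / 2 ≤ s) {h : ℝ} (hh : 0 < h) :
    ∃ h' : ℝ, 0 ≤ h' ∧ ∀ f : EuclideanSpace ℝ ι → ℂ, IsGS s h f →
      WordBdd (gsWeight s (gsNorm s h f) h') f := by
  obtain ⟨h', hh', H⟩ := exists_wordBdd_of_gsQuot_le (ι := ι) hs hh
  exact ⟨h', hh', fun f hf => H f _ hf.1 hf.le_gsNorm⟩

/-- The seminorm that is the supremum of the values of given words at given points, with weights
that admit arbitrary geometric growth. -/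
theorem exists_seminorm_of_words (hs : 1 / 2 ≤ s) (τ : ℕ → List (ι ⊕ ι))
    (x : ℕ → EuclideanSpace ℝ ι) :
    ∃ p : Seminorm ℂ (GelfandShilov s ι),
      (∀ h : ℝ, 0 < h → ∃ C : ℝ, ∀ f : GelfandShilov s ι, IsGS s h f → p f ≤ C * gsNorm s h f) ∧
      ∀ (k : ℕ) (f : GelfandShilov s ι),
        ‖wordOp (τ k) f (x k)‖ ≤ p f * gsWeight s 1 (k + 1) (τ k).length := by
  have hpos : ∀ k : ℕ, 0 < gsWeight s 1 (k + 1) (τ k).length := fun k => by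
    unfold gsWeight
    positivity
  let q : ℕ → Seminorm ℂ (GelfandShilov s ι) := fun k =>
    Seminorm.of (fun f => ‖wordOp (τ k) f (x k)‖ / gsWeight s 1 (k + 1) (τ k).length)
      (fun f g => by
        have := (hpos k).le
        rw [← add_div, coe_add, wordOp_add f.contDiff g.contDiff]
        gcongr
        exact norm_add_le _ _)
      (fun c f => by rw [wordOp_smul_apply, norm_mul, mul_div_assoc])
  have hq : ∀ k f, q k f = ‖wordOp (τ k) f (x k)‖ / gsWeight s 1 (k + 1) (τ k).length :=
    fun _ _ => rfl
  have hbound : ∀ h : ℝ, 0 < h → ∃ C : ℝ, 0 ≤ C ∧ ∀ f : GelfandShilov s ι, IsGS s h f →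
      ∀ k, q k f ≤ C * gsNorm s h f := by
    intro h hh
    obtain ⟨h', hh', H⟩ := exists_wordBdd_of_isGS (ι := ι) hs hh
    -- For `k ≥ h'` the weight `(k + 1)^n` dominates `h'^n`; the sum covers the finitely many other
    -- `k`.
    refine ⟨1 + ∑ j ∈ Finset.range ⌈h'⌉₊, h' ^ (τ j).length, by positivity, fun f hf k => ?_⟩
    have h0 : 0 ≤ gsNorm s h f := gsNorm_nonneg hh
    have h1 := (H f hf).2 (τ k) (x k)
    have h2 : h' ^ (τ k).length ≤
        (1 + ∑ j ∈ Finset.range ⌈h'⌉₊, h' ^ (τ j).length) * (k + 1 : ℝ) ^ (τ k).length := by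
      have h3 : (1 : ℝ) ≤ (k + 1 : ℝ) ^ (τ k).length := one_le_pow₀ (by simp)
      have h4 : 0 ≤ ∑ j ∈ Finset.range ⌈h'⌉₊, h' ^ (τ j).length := by positivity
      rcases lt_or_ge k ⌈h'⌉₊ with hk | hk
      · have := Finset.single_le_sum (f := fun j => h' ^ (τ j).length)
          (fun j _ => by positivity) (Finset.mem_range.2 hk)
        nlinarith
      · have h5 : h' ^ (τ k).length ≤ (k + 1 : ℝ) ^ (τ k).length := by
          gcongr
          exact (Nat.ceil_le.1 hk).trans (by linarith)
        nlinarith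
    rw [hq, div_le_iff₀ (hpos k)]
    refine h1.trans ?_
    calc gsWeight s (gsNorm s h f) h' (τ k).length
        = h' ^ (τ k).length * (gsNorm s h f * ((τ k).length ! : ℝ) ^ s) := by
          unfold gsWeight; ring
      _ ≤ _ := mul_le_mul_of_nonneg_right h2 (by positivity)
      _ = _ := by unfold gsWeight; ring
  have hbdd : ∀ f : GelfandShilov s ι, BddAbove (Set.range fun k => q k f) := by
    intro f
    obtain ⟨h, hh, hf⟩ := f.exists_isGS
    obtain ⟨C, -, hC⟩ := hbound h hh
    exact ⟨C * gsNorm s h f, by rintro _ ⟨k, rfl⟩; exact hC f hf k⟩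
  have hsup : ∀ f, (⨆ k, q k : Seminorm ℂ (GelfandShilov s ι)) f = ⨆ k, q k f := fun f =>
    Seminorm.iSup_apply (Seminorm.bddAbove_range_iff.2 hbdd)
  refine ⟨⨆ k, q k, fun h hh => ?_, fun k f => ?_⟩
  · obtain ⟨C, -, hC⟩ := hbound h hh
    refine ⟨C, fun f hf => ?_⟩
    rw [hsup]
    exact ciSup_le (hC f hf)
  · rw [hsup, ← div_le_iff₀ (hpos k)]
    exact le_ciSup (hbdd f) k

/-- The substantial point is that a bounded set has a common weight. If not, for each `k` the weight
`k (k+1)^n n!^s` is exceeded by some word at some point, and `exists_seminorm_of_words` turns these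
violations into one continuous seminorm that is unbounded on the set. -/
theorem isTestSpace (hs : 1 / 2 ≤ s) : IsTestSpace (roumieuClass s) (toFunLM s ι) where
  injective := DFunLike.coe_injective
  exists_eq {w f} hw hf := by
    obtain ⟨C, h, hC, hh, hw⟩ := hw
    exact ⟨⟨f, h * ((2 : ℝ) ^ (Fintype.card ι + 1)) ^ s + 1, by positivity, hf.1, C,
      hf.gsQuot_le (by linarith) hC hh hw (by positivity) (by linarith)⟩, rfl⟩
  isVonNBounded_iff B := by
    rw [withSeminorms.isVonNBounded_iff_seminorm_bounded]
    constructor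
    · intro hB
      by_contra! hcon
      have h1 : ∀ k : ℕ, ∃ f ∈ B, ∃ τ x, k * gsWeight s 1 (k + 1) τ.length < ‖wordOp τ f x‖ := by
        intro k
        obtain ⟨f, hf, hfw⟩ := hcon (gsWeight s k (k + 1)) ⟨k, k + 1, by positivity, by positivity,
          fun n => le_rfl⟩
        by_contra! h2
        refine hfw ⟨f.contDiff, fun τ x => (h2 f hf τ x).trans (le_of_eq ?_)⟩
        unfold gsWeight
        ring
      choose f hfB τ x hfx using h1
      obtain ⟨p, hp, hpw⟩ := exists_seminorm_of_words hs τ x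
      obtain ⟨r, -, hr⟩ := hB ⟨p, hp⟩
      obtain ⟨k, hk⟩ := exists_nat_gt r
      have h3 := (hfx k).trans_le (hpw k (f k))
      have h4 : (0 : ℝ) < gsWeight s 1 (k + 1) (τ k).length := by
        unfold gsWeight
        positivity
      have h5 : (k : ℝ) < p (f k) := lt_of_mul_lt_mul_right h3 h4.le
      exact (hk.trans h5).not_gt (hr _ (hfB k))
    · rintro ⟨w, hw, hBw⟩ ⟨p, hp⟩
      obtain ⟨C, hC⟩ := exists_seminorm_le_of_wordBdd p hp (by linarith) hw
      exact ⟨|C| + 1, by positivity, fun f hf =>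
        (hC f (hBw f hf)).trans_lt ((le_abs_self C).trans_lt (lt_add_one _))⟩
  continuous_seminorm p hp := by
    refine withSeminorms.continuous_seminorm (⟨p, fun h hh => ?_⟩ : {p : Seminorm ℂ
      (GelfandShilov s ι) // ∀ h : ℝ, 0 < h → ∃ C : ℝ,
        ∀ f : GelfandShilov s ι, IsGS s h f → p f ≤ C * gsNorm s h f})
    obtain ⟨h', hh', H⟩ := exists_wordBdd_of_isGS (ι := ι) hs hh
    obtain ⟨C, hC⟩ := hp (gsWeight s 1 h') ⟨1, h', zero_le_one, hh', fun _ => le_rfl⟩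
    refine ⟨C, fun f hf => ?_⟩
    rcases (gsNorm_nonneg (s := s) (f := f) hh).eq_or_lt with h0 | h0
    · have hf0 : f = 0 := DFunLike.coe_injective (funext fun x => by
        have h1 := hf.norm_le x
        rw [← h0] at h1
        exact norm_le_zero_iff.1 h1)
      rw [hf0, map_zero, ← hf0, ← h0, mul_zero]
    · have h1 := hC ((((gsNorm s h f)⁻¹ : ℝ) : ℂ) • f) (by
        rw [map_smul]
        refine ((H f hf).smul _).mono fun n => le_of_eq ?_
        rw [Complex.norm_real, Real.norm_of_nonneg (by positivity)]
        unfold gsWeight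
        field_simp)
      rw [map_smul_eq_mul, Complex.norm_real, Real.norm_of_nonneg (by positivity),
        inv_mul_le_iff₀ h0] at h1
      linarith

end GelfandShilov

/-! ### The spaces `Σ_s` are described by word bounds -/

namespace GelfandShilovSigma

variable {s s' : ℝ} {ι : Type} [Fintype ι]

/-- Elements of `Σ_s` as functions. -/
def toFunLM (s : ℝ) (ι : Type) [Fintype ι] :
    GelfandShilovSigma s ι →ₗ[ℂ] (EuclideanSpace ℝ ι → ℂ) where
  toFun f := f
  map_add' := coe_add
  map_smul' := coe_smul

theorem contDiff (f : GelfandShilovSigma s ι) : ContDiff ℝ ∞ f := (f.isGS one_pos).1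

/-- The increasing sequence of the norms `‖·‖_{𝒮_{s,1/(k+1)}}`. -/
def normSeq (s : ℝ) (ι : Type) [Fintype ι] (k : ℕ) : Seminorm ℂ (GelfandShilovSigma s ι) :=
  seminormFamily s ι ⟨1 / (k + 1), Nat.one_div_pos_of_nat⟩

theorem gsNorm_anti (f : GelfandShilovSigma s ι) {h h' : ℝ} (hh : 0 < h) (hle : h ≤ h') :
    gsNorm s h' f ≤ gsNorm s h f :=
  ciSup_le fun q => le_trans (by unfold gsQuot; gcongr) ((f.isGS hh).le_gsNorm q.1 q.2.1 q.2.2)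

theorem monotone_normSeq : Monotone (normSeq s ι) := fun _ _ hjk f =>
  gsNorm_anti f Nat.one_div_pos_of_nat (Nat.one_div_le_one_div hjk)

/-- The exponent `s'` of the weights may differ from `s` only in dimension zero. -/
theorem isTestSpace (hs : 1 / 2 < s')
    (hss : ∀ (h : ℝ) (f : EuclideanSpace ℝ ι → ℂ) α β x, gsQuot s h f α β x = gsQuot s' h f α β x) :
    IsTestSpace (beurlingClass s') (toFunLM s ι) := by
  have hbdd : ∀ B : Set (GelfandShilovSigma s ι), Bornology.IsVonNBounded ℂ B ↔
      ∃ w ∈ beurlingClass s', ∀ f ∈ B, WordBdd w (toFunLM s ι f) := by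
    intro B
    rw [withSeminorms.isVonNBounded_iff_seminorm_bounded]
    constructor
    · intro hB
      have hle : ∀ h' : ℝ, 0 < h' → ∃ C : ℝ, 0 ≤ C ∧ ∀ f ∈ B, WordBdd (gsWeight s' C h') f := by
        intro h' hh'
        obtain ⟨h, A, hh, hA, H⟩ := exists_wordBdd_of_gsQuot_le_of_lt (ι := ι) hs hh'
        obtain ⟨r, hr0, hr⟩ := hB ⟨h, hh⟩
        refine ⟨r * A, by positivity, fun f hf => H f r f.contDiff fun α β x => ?_⟩
        rw [← hss]
        exact ((f.isGS hh).le_gsNorm α β x).trans (hr f hf).le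
      obtain ⟨C₁, -, hC₁⟩ := hle 1 one_pos
      -- The least common weight. As it does not depend on `h'`, all the bounds `hle` apply to it
      -- simultaneously.
      refine ⟨fun n => sSup {r | ∃ f ∈ B, ∃ τ : List (ι ⊕ ι), τ.length = n ∧
        ∃ x, r = ‖wordOp τ f x‖}, fun h' hh' => ?_, fun f hf => ⟨f.contDiff, fun τ x =>
          le_csSup ⟨gsWeight s' C₁ 1 τ.length, ?_⟩ ⟨f, hf, τ, rfl, x, rfl⟩⟩⟩
      · obtain ⟨C, hC, hCB⟩ := hle h' hh'
        refine ⟨C, hC, fun n => Real.sSup_le ?_ (gsWeight_nonneg hC hh'.le n)⟩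
        rintro _ ⟨f, hf, τ, rfl, x, rfl⟩
        exact (hCB f hf).2 τ x
      · rintro _ ⟨g, hg, σ, hσ, y, rfl⟩
        rw [← hσ]
        exact (hC₁ g hg).2 σ y
    · rintro ⟨w, hw, hBw⟩ ⟨h, hh⟩
      obtain ⟨C, hC, hwC⟩ := hw (h / ((2 : ℝ) ^ (Fintype.card ι + 1)) ^ s') (by positivity)
      refine ⟨C + 1, by positivity, fun f hf => lt_of_le_of_lt (ciSup_le fun q => ?_) (lt_add_one C)⟩
      rw [hss]
      exact (hBw f hf).gsQuot_le (by linarith) hC (by positivity) hwC hh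
        (div_mul_cancel₀ _ (by positivity)).le _ _ _
  refine ⟨DFunLike.coe_injective, fun {w f} hw hf => ?_, hbdd, fun p hp => ?_⟩
  · refine ⟨⟨f, fun h hh => ?_⟩, rfl⟩
    obtain ⟨C, hC, hwC⟩ := hw (h / ((2 : ℝ) ^ (Fintype.card ι + 1)) ^ s') (by positivity)
    refine ⟨hf.1, C, fun α β x => ?_⟩
    rw [hss]
    exact hf.gsQuot_le (by linarith) hC (by positivity) hwC hh
      (div_mul_cancel₀ _ (by positivity)).le _ _ _
  · refine Seminorm.continuous_of_bounded (normSeq s ι) monotone_normSeq (fun k =>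
      withSeminorms.continuous_seminorm (⟨1 / (k + 1), Nat.one_div_pos_of_nat⟩ : {h : ℝ // 0 < h}))
      p fun B hB => ?_
    obtain ⟨w, hw, hBw⟩ := (hbdd B).1 (withSeminorms.isVonNBounded_iff_seminorm_bounded.2 (by
      rintro ⟨h, hh⟩
      obtain ⟨k, hk⟩ := exists_nat_one_div_lt hh
      obtain ⟨C, hC⟩ := hB k
      refine ⟨|C| + 1, by positivity, fun f hf => ?_⟩
      have h1 := gsNorm_anti f Nat.one_div_pos_of_nat hk.le
      have h2 : gsNorm s (1 / ((k : ℝ) + 1)) f ≤ C := hC f hf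
      have h3 : gsNorm s h f < |C| + 1 := by linarith [le_abs_self C]
      exact h3))
    obtain ⟨C, hC⟩ := hp w hw
    exact ⟨C, fun f hf => hC f (hBw f hf)⟩

end GelfandShilovSigma

/-! ### The Schwartz space is described by word bounds -/

section Schwartz

variable {ι : Type} [Fintype ι]

/-- Letters as continuous operators on the Schwartz space. -/
def letterCLM : ι ⊕ ι → 𝓢(EuclideanSpace ℝ ι, ℂ) →L[ℂ] 𝓢(EuclideanSpace ℝ ι, ℂ)
  | .inl i => SchwartzMap.smulLeftCLM ℂ fun x => ((x i : ℝ) : ℂ)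
  | .inr i => LineDeriv.lineDerivOpCLM ℂ _ (EuclideanSpace.basisFun ι ℝ i)

theorem letterCLM_apply (ℓ : ι ⊕ ι) (f : 𝓢(EuclideanSpace ℝ ι, ℂ)) :
    ⇑(letterCLM ℓ f) = letterOp ℓ f := by
  rcases ℓ with i | i <;> ext x
  · have h : Function.HasTemperateGrowth fun x : EuclideanSpace ℝ ι => ((x i : ℝ) : ℂ) :=
      (Complex.ofRealCLM ∘L (EuclideanSpace.proj i : EuclideanSpace ℝ ι →L[ℝ] ℝ)).hasTemperateGrowth
    exact SchwartzMap.smulLeftCLM_apply_apply h f x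
  · rfl

/-- Words as continuous operators on the Schwartz space. -/
def wordCLM (τ : List (ι ⊕ ι)) : 𝓢(EuclideanSpace ℝ ι, ℂ) →L[ℂ] 𝓢(EuclideanSpace ℝ ι, ℂ) :=
  τ.foldr (fun ℓ A => letterCLM ℓ ∘L A) (ContinuousLinearMap.id ℂ _)

theorem wordCLM_apply (τ : List (ι ⊕ ι)) (f : 𝓢(EuclideanSpace ℝ ι, ℂ)) :
    ⇑(wordCLM τ f) = wordOp τ f := by
  induction τ with
  | nil => rfl
  | cons ℓ τ ih =>
    rw [wordOp_cons, ← ih, ← letterCLM_apply]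
    rfl

theorem norm_iteratedFDeriv_le_of_wordOp {f : EuclideanSpace ℝ ι → ℂ} (hf : ContDiff ℝ ∞ f)
    {n : ℕ} {x : EuclideanSpace ℝ ι} {C : ℝ} (hC : 0 ≤ C)
    (h : ∀ l : List ι, l.length = n → ‖wordOp (l.map .inr) f x‖ ≤ C) :
    ‖iteratedFDeriv ℝ n f x‖ ≤ (Fintype.card ι) ^ n * C := by
  classical
  refine ContinuousMultilinearMap.opNorm_le_bound (by positivity) fun v => ?_
  have h1 : iteratedFDeriv ℝ n f x v = ∑ σ : Fin n → ι, (∏ j, v j (σ j)) •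
      iteratedFDeriv ℝ n f x fun j => EuclideanSpace.basisFun ι ℝ (σ j) := by
    conv_lhs => rw [show v = fun j => ∑ i, v j i • EuclideanSpace.basisFun ι ℝ i from
      funext fun j => (sum_coord_smul_basisFun (v j)).symm]
    rw [ContinuousMultilinearMap.map_sum]
    exact Finset.sum_congr rfl fun σ _ => ContinuousMultilinearMap.map_smul_univ _ _ _
  rw [h1]
  refine (norm_sum_le _ _).trans ?_
  calc _ ≤ ∑ _σ : Fin n → ι, (∏ j, ‖v j‖) * C := by
        refine Finset.sum_le_sum fun σ _ => ?_
        rw [norm_smul, norm_prod, iteratedFDeriv_basis_eq_wordOp hf]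
        refine mul_le_mul (Finset.prod_le_prod (fun _ _ => norm_nonneg _) fun j _ =>
          abs_coord_le_norm (v j) (σ j)) (h _ (by simp)) (norm_nonneg _)
          (Finset.prod_nonneg fun _ _ => norm_nonneg _)
    _ = _ := by
        simp
        ring

theorem WordBdd.exists_schwartz_bound (w : ℕ → ℝ) (k n : ℕ) :
    ∃ C : ℝ, 0 ≤ C ∧ ∀ f : EuclideanSpace ℝ ι → ℂ, WordBdd w f →
      ∀ x, ‖x‖ ^ k * ‖iteratedFDeriv ℝ n f x‖ ≤ C := by
  set A := decayBound ι k fun j => |w (j + n)| with hA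
  refine ⟨(Fintype.card ι) ^ n * |A|, by positivity, fun f hf x => ?_⟩
  have hx : 0 < (1 + ∑ i, |x i|) ^ k := by positivity
  have h1 : ∀ l : List ι, l.length = n →
      ‖_root_.wordOp (l.map .inr) f x‖ ≤ |A| / (1 + ∑ i, |x i|) ^ k := by
    intro l hl
    rw [le_div_iff₀ hx, mul_comm]
    refine le_trans (WordBdd.decay k ((hf.wordOp (l.map .inr)).mono fun j => ?_) x) (le_abs_self A)
    rw [List.length_map, hl]
    exact le_abs_self _
  have h2 := norm_iteratedFDeriv_le_of_wordOp hf.1 (by positivity) h1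
  calc ‖x‖ ^ k * ‖iteratedFDeriv ℝ n f x‖
      ≤ (1 + ∑ i, |x i|) ^ k * ((Fintype.card ι) ^ n * (|A| / (1 + ∑ i, |x i|) ^ k)) := by
        gcongr
        exact (norm_le_sum_abs x).trans (by linarith)
    _ = _ := by field_simp

/-- Schwartz functions as functions. -/
def schwartzToFunLM (ι : Type) [Fintype ι] :
    𝓢(EuclideanSpace ℝ ι, ℂ) →ₗ[ℂ] (EuclideanSpace ℝ ι → ℂ) where
  toFun f := f
  map_add' _ _ := rfl
  map_smul' _ _ := rfl

/-- An increasing sequence of seminorms that defines the topology of the Schwartz space. -/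
def schwartzSeq (ι : Type) [Fintype ι] (k : ℕ) : Seminorm ℂ 𝓢(EuclideanSpace ℝ ι, ℂ) :=
  (Finset.Iic (k, k)).sup (schwartzSeminormFamily ℂ (EuclideanSpace ℝ ι) ℂ)

theorem monotone_schwartzSeq : Monotone (schwartzSeq ι) := fun _ _ h =>
  Finset.sup_mono (Finset.Iic_subset_Iic.2 (Prod.mk_le_mk.2 ⟨h, h⟩))

theorem isTestSpace_schwartz : IsTestSpace Set.univ (schwartzToFunLM ι) := by
  have hS := schwartz_withSeminorms ℂ (EuclideanSpace ℝ ι) ℂ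
  have hbdd : ∀ B : Set 𝓢(EuclideanSpace ℝ ι, ℂ), Bornology.IsVonNBounded ℂ B ↔
      ∃ w ∈ Set.univ, ∀ f ∈ B, WordBdd w (schwartzToFunLM ι f) := by
    intro B
    constructor
    · intro hB
      have h1 : ∀ τ : List (ι ⊕ ι), ∃ C : ℝ, ∀ f ∈ B, ∀ x, ‖wordOp τ f x‖ ≤ C := by
        intro τ
        obtain ⟨C, -, hC⟩ := hS.isVonNBounded_iff_seminorm_bounded.1 (hB.image (wordCLM τ)) (0, 0)
        refine ⟨C, fun f hf x => ?_⟩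
        rw [← wordCLM_apply]
        exact (SchwartzMap.norm_le_seminorm ℂ _ x).trans (hC _ ⟨f, hf, rfl⟩).le
      choose C hC using h1
      -- There are finitely many words of each length, so the bounds for single words combine into a
      -- weight.
      have h2 : ∀ n : ℕ, ∃ w : ℝ, ∀ τ ∈ {τ : List (ι ⊕ ι) | τ.length = n}, C τ ≤ w := by
        intro n
        obtain ⟨w, hw⟩ := ((List.finite_length_eq (ι ⊕ ι) n).image C).bddAbove
        exact ⟨w, fun τ hτ => hw ⟨τ, hτ, rfl⟩⟩
      choose w hw using h2
      exact ⟨w, trivial, fun f hf => ⟨f.smooth ⊤, fun τ x => (hC τ f hf x).trans (hw _ τ rfl)⟩⟩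
    · rintro ⟨w, -, hw⟩
      rw [hS.isVonNBounded_iff_seminorm_bounded]
      rintro ⟨k, n⟩
      obtain ⟨C, hC0, hC⟩ := WordBdd.exists_schwartz_bound (ι := ι) w k n
      exact ⟨C + 1, by positivity, fun f hf =>
        (SchwartzMap.seminorm_le_bound ℂ k n f hC0 (hC f (hw f hf))).trans_lt (lt_add_one C)⟩
  refine ⟨DFunLike.coe_injective, fun {w f} _ hf => ?_, hbdd, fun p hp => ?_⟩
  · exact ⟨⟨f, hf.1, fun k n => by
      obtain ⟨C, -, hC⟩ := WordBdd.exists_schwartz_bound (ι := ι) w k n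
      exact ⟨C, hC f hf⟩⟩, rfl⟩
  · refine Seminorm.continuous_of_bounded (schwartzSeq ι) monotone_schwartzSeq (fun k =>
      Seminorm.continuous_finsetSup fun i _ => hS.continuous_seminorm i) p fun B hB => ?_
    obtain ⟨w, -, hBw⟩ := (hbdd B).1 (hS.isVonNBounded_iff_seminorm_bounded.2 (by
      rintro ⟨k, n⟩
      obtain ⟨C, hC⟩ := hB (max k n)
      refine ⟨|C| + 1, by positivity, fun f hf => ?_⟩
      have h1 : schwartzSeminormFamily ℂ (EuclideanSpace ℝ ι) ℂ (k, n) ≤ schwartzSeq ι (max k n) :=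
        Finset.le_sup (f := schwartzSeminormFamily ℂ (EuclideanSpace ℝ ι) ℂ) (Finset.mem_Iic.2
          (Prod.mk_le_mk.2 ⟨le_max_left k n, le_max_right k n⟩))
      have h2 := (h1 f).trans (hC f hf)
      linarith [le_abs_self C]))
    obtain ⟨C, hC⟩ := hp w trivial
    exact ⟨C, fun f hf => hC f (hBw f hf)⟩

end Schwartz

/-! ### The space `Σ_{1/2}` is trivial in positive dimension -/

section Trivial

/-- The `a`-th term of the Taylor expansion of an entire extension in imaginary direction. -/
def extensionTerm (b : ℕ → ℝ → ℂ) (a : ℕ) (z : ℂ) : ℂ :=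
  b a z.re * ((Complex.I * z.im) ^ a / a !)

/-- The derivative of `extensionTerm` in the real direction. -/
def extensionTermDeriv (b : ℕ → ℝ → ℂ) (a : ℕ) (z : ℂ) : ℂ :=
  b (a + 1) z.re * ((Complex.I * z.im) ^ a / a !)

/-- The derivative of `extensionTerm` in the imaginary direction. -/
def extensionTermDerivIm (b : ℕ → ℝ → ℂ) : ℕ → ℂ → ℂ
  | 0, _ => 0
  | a + 1, z => Complex.I * extensionTermDeriv b a z

variable {b : ℕ → ℝ → ℂ}

/-- The imaginary derivative of a term is `i` times the real derivative of the preceding term. The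
single terms are not holomorphic, but their sum therefore satisfies the Cauchy-Riemann equations. -/
theorem hasFDerivAt_extensionTerm (hb : ∀ a t, HasDerivAt (b a) (b (a + 1) t) t) (a : ℕ) (z : ℂ) :
    HasFDerivAt (𝕜 := ℝ) (extensionTerm b a)
      (Complex.reCLM.smulRight (extensionTermDeriv b a z) +
        Complex.imCLM.smulRight (extensionTermDerivIm b a z)) z := by
  have h1 : HasFDerivAt (fun z : ℂ => b a z.re) (Complex.reCLM.smulRight (b (a + 1) z.re)) z := by
    have h := (hb a z.re).hasFDerivAt.comp z Complex.reCLM.hasFDerivAt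
    refine h.congr_fderiv ?_
    ext; simp
  have h0 : HasFDerivAt (fun z : ℂ => Complex.I * (z.im : ℂ))
      (Complex.imCLM.smulRight Complex.I) z := by
    have h := (Complex.imCLM.smulRight Complex.I).hasFDerivAt (x := z)
    refine h.congr_of_eventuallyEq (Filter.Eventually.of_forall fun y => ?_)
    simp [mul_comm]
  have h2 : HasFDerivAt (𝕜 := ℝ) (fun z : ℂ => (Complex.I * (z.im : ℂ)) ^ a / (a ! : ℂ))
      (((a ! : ℂ)⁻¹ * (a * (Complex.I * (z.im : ℂ)) ^ (a - 1))) •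
        Complex.imCLM.smulRight Complex.I) z := by
    have h := (h0.pow a).const_mul ((a ! : ℂ)⁻¹)
    refine (h.congr_fderiv ?_).congr_of_eventuallyEq (Filter.Eventually.of_forall fun y => ?_)
    · ext; simp [mul_assoc]
    · simp [div_eq_inv_mul]
  refine (h1.mul h2).congr_fderiv ?_
  rcases a with _ | a
  · ext; simp [extensionTermDeriv, extensionTermDerivIm]
  · have hf : ((a + 1)! : ℂ) = (a + 1) * a ! := by push_cast [Nat.factorial_succ]; ring
    have ha : (a + 1 : ℂ) ≠ 0 := by exact_mod_cast Nat.succ_ne_zero a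
    have ha' : (a ! : ℂ) ≠ 0 := by exact_mod_cast Nat.factorial_ne_zero a
    ext x
    simp [extensionTermDeriv, extensionTermDerivIm, hf]
    field_simp
    ring

theorem sqrt_factorial_succ_div_le (a : ℕ) : √((a + 1)! : ℝ) / a ! ≤ 2 ^ a := by
  have h1 : √((a + 1)! : ℝ) ≤ (a + 1)! := by
    rw [Real.sqrt_le_left (by positivity)]
    exact le_self_pow₀ (by exact_mod_cast Nat.one_le_of_lt (Nat.factorial_pos _)) two_ne_zero
  rw [div_le_iff₀ (by positivity)]
  refine h1.trans ?_
  rw [Nat.factorial_succ]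
  push_cast
  gcongr
  exact_mod_cast Nat.lt_two_pow_self

theorem norm_extensionTermDeriv_le {C h R : ℝ} (hC : 0 ≤ C) (hh : 0 ≤ h)
    (hbd : ∀ a t, ‖b a t‖ ≤ C * h ^ a * √(a ! : ℝ)) (a : ℕ) {z : ℂ} (hz : |z.im| ≤ R) :
    ‖extensionTermDeriv b a z‖ ≤ C * h * (2 * h * R) ^ a := by
  have hR : 0 ≤ R := (abs_nonneg _).trans hz
  calc ‖extensionTermDeriv b a z‖ = ‖b (a + 1) z.re‖ * (|z.im| ^ a / a !) := by
        simp [extensionTermDeriv]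
    _ ≤ C * h ^ (a + 1) * √((a + 1)! : ℝ) * (R ^ a / a !) := by
        gcongr
        exact hbd _ _
    _ = C * h ^ (a + 1) * R ^ a * (√((a + 1)! : ℝ) / a !) := by ring
    _ ≤ C * h ^ (a + 1) * R ^ a * 2 ^ a := by
        gcongr
        exact sqrt_factorial_succ_div_le a
    _ = _ := by
        rw [pow_succ, mul_pow, mul_pow]
        ring

theorem differentiable_extension (hb : ∀ a t, HasDerivAt (b a) (b (a + 1) t) t)
    (hbd : ∀ h : ℝ, 0 < h → ∃ C : ℝ, 0 ≤ C ∧ ∀ a t, ‖b a t‖ ≤ C * h ^ a * √(a ! : ℝ)) :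
    Differentiable ℂ fun z => ∑' a, extensionTerm b a z := by
  intro z
  set R : ℝ := ‖z‖ + 1 with hR
  have hR0 : 0 < R := by positivity
  -- The choice makes the ratio `2 h R` of the dominating geometric series equal to `1 / 2`.
  obtain ⟨C, hC, hCb⟩ := hbd (1 / (4 * R)) (by positivity)
  have hcR : 2 * (1 / (4 * R)) * R = 1 / 2 := by field_simp; norm_num
  set M : ℝ := C * (1 / (4 * R)) with hM
  have hM0 : 0 ≤ M := by positivity
  have hc : ∀ a, ∀ y ∈ Metric.ball (0 : ℂ) R, ‖extensionTermDeriv b a y‖ ≤ M * (1 / 2) ^ a := by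
    intro a y hy
    have h1 := norm_extensionTermDeriv_le hC (by positivity) hCb a (z := y) (R := R)
      ((Complex.abs_im_le_norm y).trans (mem_ball_zero_iff.1 hy).le)
    rwa [hcR] at h1
  have he : ∀ a, ∀ y ∈ Metric.ball (0 : ℂ) R,
      ‖extensionTermDerivIm b a y‖ ≤ 2 * M * (1 / 2) ^ a := by
    intro a y hy
    rcases a with _ | a
    · simp only [extensionTermDerivIm, norm_zero]
      positivity
    · rw [extensionTermDerivIm, norm_mul, Complex.norm_I, one_mul]
      refine (hc a y hy).trans (le_of_eq ?_)
      rw [pow_succ]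
      ring
  have hgeo : Summable fun a : ℕ => (1 / 2 : ℝ) ^ a := summable_geometric_two
  have hz : z ∈ Metric.ball (0 : ℂ) R := by simp [hR]
  have h1 := hasFDerivAt_tsum_of_isPreconnected (𝕜 := ℝ) (u := fun a => 3 * M * (1 / 2) ^ a)
    (f := extensionTerm b) (s := Metric.ball 0 R) (x₀ := 0) (hgeo.mul_left _) Metric.isOpen_ball
    (convex_ball (0 : ℂ) R).isPreconnected (fun a y _ => hasFDerivAt_extensionTerm hb a y)
    (fun a y hy => by
      refine (norm_add_le _ _).trans ?_
      rw [ContinuousLinearMap.norm_smulRight_apply, ContinuousLinearMap.norm_smulRight_apply,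
        Complex.reCLM_norm, Complex.imCLM_norm]
      linarith [hc a y hy, he a y hy])
    (by simpa using hR0) (by
      refine (hasSum_single 0 fun a ha => ?_).summable
      simp [extensionTerm, ha]) hz
  have hS : HasSum (fun a => extensionTermDeriv b a z) (∑' a, extensionTermDeriv b a z) :=
    (Summable.of_norm_bounded (hgeo.mul_left M) fun a => hc a z hz).hasSum
  set S := ∑' a, extensionTermDeriv b a z
  have hS' : HasSum (fun a => extensionTermDerivIm b a z) (Complex.I * S) := by
    have := (hasSum_nat_add_iff (f := fun a => extensionTermDerivIm b a z) 1).1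
      (hS.mul_left Complex.I)
    simpa [extensionTermDerivIm] using this
  have h2 : HasSum (fun a => Complex.reCLM.smulRight (extensionTermDeriv b a z) +
        Complex.imCLM.smulRight (extensionTermDerivIm b a z))
      (Complex.reCLM.smulRight S + Complex.imCLM.smulRight (Complex.I * S)) :=
    (hS.mapL (ContinuousLinearMap.smulRightL ℝ ℂ ℂ Complex.reCLM)).add
      (hS'.mapL (ContinuousLinearMap.smulRightL ℝ ℂ ℂ Complex.imCLM))
  rw [h2.tsum_eq] at h1
  refine (hasFDerivAt_of_restrictScalars ℝ h1
    (f' := S • ContinuousLinearMap.id ℂ ℂ) ?_).differentiableAt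
  ext x
  simp only [ContinuousLinearMap.coe_restrictScalars', smul_apply,
    ContinuousLinearMap.id_apply, add_apply,
    ContinuousLinearMap.smulRight_apply, Complex.reCLM_apply, Complex.imCLM_apply, smul_eq_mul,
    Complex.real_smul]
  conv_lhs => rw [← Complex.re_add_im x]
  ring

theorem sqrt_factorial_two_mul_le (n : ℕ) : √((2 * n)! : ℝ) ≤ 2 ^ n * n ! := by
  rw [Real.sqrt_le_left (by positivity)]
  have h := factorial_add_le n n
  rw [← two_mul, pow_mul] at h
  calc ((2 * n)! : ℝ) ≤ ((2 ^ 2) ^ n * (n ! * n !) : ℕ) := by exact_mod_cast h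
    _ = _ := by
        push_cast
        rw [mul_pow, pow_right_comm, sq (n ! : ℝ)]
        norm_num

theorem hasSum_pow_div_factorial (t : ℝ) :
    HasSum (fun n : ℕ => t ^ n / (n ! : ℝ)) (Real.exp t) := by
  rw [Real.exp_eq_exp_ℝ]
  exact NormedSpace.expSeries_div_hasSum_exp t

/-- The Gaussian is expanded in a series and the bounds for `t^{2n}` are summed: `√(2n)! ≤ 2^n n!`
cancels the `n!`, and the small powers of `1/4` leave a geometric series. -/
theorem exp_mul_norm_le {C : ℝ} (hC : 0 ≤ C)
    (hbd : ∀ a n t, |t| ^ n * ‖b a t‖ ≤ C * (1 / 4) ^ (a + n) * (√(a ! : ℝ) * √(n ! : ℝ)))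
    (a : ℕ) (t : ℝ) : Real.exp (2 * t ^ 2) * ‖b a t‖ ≤ 2 * C * (1 / 4) ^ a * √(a ! : ℝ) := by
  have h1 : HasSum (fun n : ℕ => (2 * t ^ 2) ^ n / n ! * ‖b a t‖)
      (Real.exp (2 * t ^ 2) * ‖b a t‖) :=
    (hasSum_pow_div_factorial _).mul_right _
  have h2 := hasSum_geometric_two.mul_left (C * (1 / 4) ^ a * √(a ! : ℝ))
  refine (hasSum_le (fun n => ?_) h1 h2).trans (le_of_eq (by ring))
  have h3 := hbd a (2 * n) t
  have h4 : |t| ^ (2 * n) = (t ^ 2) ^ n := by rw [pow_mul, sq_abs]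
  rw [h4] at h3
  calc (2 * t ^ 2) ^ n / n ! * ‖b a t‖ = 2 ^ n / n ! * ((t ^ 2) ^ n * ‖b a t‖) := by
        rw [mul_pow]; ring
    _ ≤ 2 ^ n / n ! * (C * (1 / 4) ^ (a + 2 * n) * (√(a ! : ℝ) * (2 ^ n * n !))) := by
        refine mul_le_mul_of_nonneg_left (h3.trans ?_) (by positivity)
        gcongr
        exact sqrt_factorial_two_mul_le n
    _ = C * (1 / 4) ^ a * √(a ! : ℝ) * (1 / 4) ^ n := by
        rw [pow_add, pow_mul]
        have e : (2 : ℝ) ^ n * 2 ^ n * ((1 / 4) ^ 2) ^ n = (1 / 4) ^ n := by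
          rw [← mul_pow, ← mul_pow]
          norm_num
        rw [← e]
        field_simp
    _ ≤ _ := by
        gcongr
        norm_num

/-- The left side is the geometric mean of the two terms on the right. -/
theorem pow_div_sqrt_factorial_le {t : ℝ} (a : ℕ) (ht : 0 ≤ t) :
    t ^ a / √(a ! : ℝ) ≤ (1 / 2) ^ a + (2 * t ^ 2) ^ a / a ! := by
  have h0 : 0 < √(a ! : ℝ) := by positivity
  set p : ℝ := √((1 / 2) ^ a)
  set q : ℝ := √((2 * t ^ 2) ^ a / a !)
  have hp : p ^ 2 = (1 / 2) ^ a := Real.sq_sqrt (by positivity)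
  have hq : q ^ 2 = (2 * t ^ 2) ^ a / a ! := Real.sq_sqrt (by positivity)
  have hpq : p * q = t ^ a / √(a ! : ℝ) := by
    rw [← Real.sqrt_mul (by positivity), ← mul_div_assoc, ← mul_pow, Real.sqrt_div (by positivity)]
    congr 1
    rw [show 1 / 2 * (2 * t ^ 2) = t ^ 2 by ring, ← pow_mul, mul_comm, pow_mul]
    exact Real.sqrt_sq (by positivity)
  rw [← hpq, ← hp, ← hq]
  nlinarith [sq_nonneg (p - q), sq_nonneg p, sq_nonneg q]

/-- A function with the bounds of `Σ_{1/2}(ℝ)` vanishes. -/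
theorem eq_zero_of_gaussian_bounds (hb : ∀ a t, HasDerivAt (b a) (b (a + 1) t) t)
    (hbd : ∀ h : ℝ, 0 < h → ∃ C : ℝ, 0 ≤ C ∧ ∀ a n t,
      |t| ^ n * ‖b a t‖ ≤ C * h ^ (a + n) * (√(a ! : ℝ) * √(n ! : ℝ))) (t : ℝ) : b 0 t = 0 := by
  have hG := differentiable_extension hb fun h hh => by
    obtain ⟨C, hC, hCb⟩ := hbd h hh
    exact ⟨C, hC, fun a t => by simpa using hCb a 0 t⟩
  set G : ℂ → ℂ := fun z => ∑' a, extensionTerm b a z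
  obtain ⟨C, hC, hCb⟩ := hbd (1 / 4) (by norm_num)
  have hdec := exp_mul_norm_le hC hCb
  have hGb : ∀ z : ℂ, Real.exp (2 * z.re ^ 2) * ‖G z‖ ≤ 2 * C * (2 + Real.exp (z.im ^ 2)) := by
    intro z
    have hterm : ∀ a, Real.exp (2 * z.re ^ 2) * ‖extensionTerm b a z‖ ≤
        2 * C * ((1 / 2) ^ a + (z.im ^ 2) ^ a / a !) := by
      intro a
      have ha : (a ! : ℝ) = √(a ! : ℝ) * √(a ! : ℝ) := (Real.mul_self_sqrt (by positivity)).symm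
      have ha0 : √(a ! : ℝ) ≠ 0 := by positivity
      calc Real.exp (2 * z.re ^ 2) * ‖extensionTerm b a z‖
          = Real.exp (2 * z.re ^ 2) * ‖b a z.re‖ * (|z.im| ^ a / a !) := by
            simp [extensionTerm, mul_assoc]
        _ ≤ 2 * C * (1 / 4) ^ a * √(a ! : ℝ) * (|z.im| ^ a / a !) := by
            exact mul_le_mul_of_nonneg_right (hdec a z.re) (by positivity)
        _ = 2 * C * ((1 / 4 * |z.im|) ^ a / √(a ! : ℝ)) := by
            rw [mul_pow]
            nth_rw 2 [ha]
            field_simp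
        _ ≤ 2 * C * ((1 / 2) ^ a + (2 * (1 / 4 * |z.im|) ^ 2) ^ a / a !) := by
            gcongr
            exact pow_div_sqrt_factorial_le a (by positivity)
        _ ≤ _ := by
            gcongr
            rw [mul_pow, sq_abs]
            nlinarith [sq_nonneg z.im]
    have hsum := (hasSum_geometric_two.add (hasSum_pow_div_factorial (z.im ^ 2))).mul_left (2 * C)
    have hn : ‖G z‖ ≤ Real.exp (-(2 * z.re ^ 2)) * (2 * C * (2 + Real.exp (z.im ^ 2))) := by
      refine tsum_of_norm_bounded (hsum.mul_left (Real.exp (-(2 * z.re ^ 2)))) fun a => ?_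
      rw [Real.exp_neg, ← div_eq_inv_mul, le_div_iff₀ (Real.exp_pos _), mul_comm]
      exact hterm a
    rwa [Real.exp_neg, ← div_eq_inv_mul, le_div_iff₀ (Real.exp_pos _), mul_comm] at hn
  -- Since `|e^{z²}| = e^{x²-y²}`, this factor removes the growth `e^{y²}` of `G` at the price of
  -- half of its decay `e^{-2x²}`. So `F` is bounded, hence constant, and tends to zero along the
  -- real axis.
  set F : ℂ → ℂ := fun z => Complex.exp (z ^ 2) * G z with hF
  have hFd : Differentiable ℂ F := (Complex.differentiable_exp.comp (differentiable_pow 2)).mul hG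
  have hFb : ∀ z, ‖F z‖ ≤ 6 * C * Real.exp (-z.re ^ 2) := by
    intro z
    have h1 : ‖F z‖ = Real.exp (-z.im ^ 2) * (Real.exp (-z.re ^ 2) *
        (Real.exp (2 * z.re ^ 2) * ‖G z‖)) := by
      rw [hF, norm_mul, Complex.norm_exp, ← mul_assoc, ← mul_assoc, ← Real.exp_add, ← Real.exp_add]
      congr 2
      simp [pow_two]
      ring
    have h2 : Real.exp (-z.im ^ 2) * (2 + Real.exp (z.im ^ 2)) ≤ 3 := by
      rw [mul_add, ← Real.exp_add, neg_add_cancel, Real.exp_zero]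
      have : Real.exp (-z.im ^ 2) ≤ 1 := Real.exp_le_one_iff.2 (by nlinarith [sq_nonneg z.im])
      linarith
    calc ‖F z‖ ≤ Real.exp (-z.im ^ 2) * (Real.exp (-z.re ^ 2) *
          (2 * C * (2 + Real.exp (z.im ^ 2)))) := by
          rw [h1]
          exact mul_le_mul_of_nonneg_left (mul_le_mul_of_nonneg_left (hGb z) (by positivity))
            (by positivity)
      _ = 2 * C * Real.exp (-z.re ^ 2) * (Real.exp (-z.im ^ 2) * (2 + Real.exp (z.im ^ 2))) := by
          ring
      _ ≤ 2 * C * Real.exp (-z.re ^ 2) * 3 := by gcongr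
      _ = _ := by ring
  have hbounded : Bornology.IsBounded (Set.range F) := by
    refine isBounded_iff_forall_norm_le.2 ⟨6 * C, ?_⟩
    rintro _ ⟨z, rfl⟩
    refine (hFb z).trans (mul_le_of_le_one_right (by positivity) ?_)
    exact Real.exp_le_one_iff.2 (by nlinarith [sq_nonneg z.re])
  have hconst : ∀ z w, F z = F w := fun z w => hFd.apply_eq_apply_of_bounded hbounded z w
  have hlim : Filter.Tendsto (fun n : ℕ => 6 * C * Real.exp (-(n : ℝ) ^ 2)) Filter.atTop
      (nhds 0) := by
    have h1 : Filter.Tendsto (fun n : ℕ => -(n : ℝ) ^ 2) Filter.atTop Filter.atBot :=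
      Filter.tendsto_neg_atTop_atBot.comp ((Filter.tendsto_pow_atTop two_ne_zero).comp
        tendsto_natCast_atTop_atTop)
    simpa using (Real.tendsto_exp_atBot.comp h1).const_mul (6 * C)
  have hF0 : F t = 0 := norm_le_zero_iff.1 (ge_of_tendsto' hlim fun n => by
    rw [hconst t ((n : ℝ) : ℂ)]
    simpa using hFb ((n : ℝ) : ℂ))
  have hG0 : G t = 0 := (mul_eq_zero.1 hF0).resolve_left (Complex.exp_ne_zero _)
  have hGt : G t = b 0 t := by
    change ∑' a, extensionTerm b a t = _
    rw [tsum_eq_single 0 fun a ha => by simp [extensionTerm, ha]]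
    simp [extensionTerm]
  rw [← hGt, hG0]

theorem GelfandShilovSigma.subsingleton_of_nonempty {ι : Type} [Fintype ι] [Nonempty ι] :
    Subsingleton (GelfandShilovSigma (1 / 2) ι) := by
  classical
  refine subsingleton_of_forall_eq 0 fun f => DFunLike.coe_injective (funext fun x => ?_)
  obtain ⟨i⟩ := ‹Nonempty ι›
  set e := EuclideanSpace.basisFun ι ℝ i
  set y := x - x i • e
  have hyi : ∀ t : ℝ, (y + t • e) i = t := fun t => by simp [y, e]
  -- Restriction to the line through `x` in direction `e`, parametrized by the coordinate `i`,
  -- reduces the claim to one variable.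
  let b : ℕ → ℝ → ℂ := fun a t => wordOp ((List.replicate a i).map .inr) f (y + t • e)
  have hb : ∀ a t, HasDerivAt (b a) (b (a + 1) t) t := by
    intro a t
    have h1 : HasDerivAt (fun t : ℝ => y + t • e) e t := by
      simpa using ((hasDerivAt_id t).smul_const e).const_add y
    exact ((f.contDiff.wordOp ((List.replicate a i).map .inr)).diffAt
      (y + t • e)).hasFDerivAt.comp_hasDerivAt t h1
  have hbd : ∀ h : ℝ, 0 < h → ∃ C : ℝ, 0 ≤ C ∧ ∀ a n t,
      |t| ^ n * ‖b a t‖ ≤ C * h ^ (a + n) * (√(a ! : ℝ) * √(n ! : ℝ)) := by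
    intro h hh
    have hh' : 0 < h / 2 ^ (1 / 2 : ℝ) := by positivity
    refine ⟨gsNorm (1 / 2) (h / 2 ^ (1 / 2 : ℝ)) f, gsNorm_nonneg hh', fun a n t => ?_⟩
    have h1 := norm_wordOp_normalWord_le (by norm_num) hh' f.contDiff
      (f.isGS hh').le_gsNorm (List.replicate n i) (List.replicate a i) (y + t • e)
    rw [normalWord, wordOp_append, wordOp_map_inl, norm_mul, List.map_replicate,
      List.prod_replicate, hyi, Complex.norm_real, norm_pow, Real.norm_eq_abs,
      List.length_replicate, List.length_replicate, add_comm n a] at h1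
    refine h1.trans ?_
    have h0 : 0 ≤ gsNorm (1 / 2) (h / 2 ^ (1 / 2 : ℝ)) f := gsNorm_nonneg hh'
    calc gsWeight (1 / 2) (gsNorm (1 / 2) (h / 2 ^ (1 / 2 : ℝ)) f) (h / 2 ^ (1 / 2 : ℝ)) (a + n)
        ≤ gsNorm (1 / 2) (h / 2 ^ (1 / 2 : ℝ)) f * (h / 2 ^ (1 / 2 : ℝ)) ^ (a + n) *
          ((2 ^ (1 / 2 : ℝ)) ^ (a + n) * ((a ! : ℝ) ^ (1 / 2 : ℝ) * (n ! : ℝ) ^ (1 / 2 : ℝ))) :=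
          mul_le_mul_of_nonneg_left (factorial_add_rpow_le (by norm_num) a n) (by positivity)
      _ = _ := by
          rw [Real.sqrt_eq_rpow, Real.sqrt_eq_rpow, div_pow]
          field_simp
  have h2 := eq_zero_of_gaussian_bounds hb hbd (x i)
  have h3 : y + x i • e = x := by simp [y]
  change wordOp [] f (y + x i • e) = 0 at h2
  rw [h3] at h2
  exact h2

end Trivial

/-! ### Quantization on `Σ_s` -/

/-- Without variables all products of factorials are `1`, so the exponent drops out. -/
theorem gsQuot_of_isEmpty {ι : Type} [Fintype ι] [IsEmpty ι] (s s' h : ℝ)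
    (f : EuclideanSpace ℝ ι → ℂ) (α β : ι → ℕ) (x : EuclideanSpace ℝ ι) :
    gsQuot s h f α β x = gsQuot s' h f α β x := by
  simp [gsQuot]

theorem bornJordanOp_zero_right {d : ℕ} (a : EuclideanSpace ℝ (Fin d ⊕ Fin d) → ℂ)
    (x : EuclideanSpace ℝ (Fin d)) : bornJordanOp a 0 x = 0 := by
  simp [bornJordanOp, shubinOp]

namespace GelfandShilovSigma

/-- Normal ordering covers `s > 1/2`. At `s = 1/2` both spaces vanish in positive dimension, while
in dimension zero any larger exponent describes them, and `1` is taken. -/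
theorem exists_isTestSpace_or_subsingleton (d : ℕ) {s : ℝ} (hs : 1 / 2 ≤ s) :
    (∃ s', 0 ≤ s' ∧ IsTestSpace (beurlingClass s') (toFunLM s (Fin d)) ∧
      IsTestSpace (beurlingClass s') (toFunLM s (Fin d ⊕ Fin d))) ∨
    (Subsingleton (GelfandShilovSigma s (Fin d)) ∧
      Subsingleton (GelfandShilovSigma s (Fin d ⊕ Fin d))) := by
  rcases hs.lt_or_eq with hs | rfl
  · exact .inl ⟨s, by linarith, isTestSpace hs fun _ _ _ _ _ => rfl,
      isTestSpace hs fun _ _ _ _ _ => rfl⟩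
  rcases d.eq_zero_or_pos with rfl | hd
  · exact .inl ⟨1, zero_le_one, isTestSpace (by norm_num) (gsQuot_of_isEmpty _ _),
      isTestSpace (by norm_num) (gsQuot_of_isEmpty _ _)⟩
  · have : NeZero d := ⟨hd.ne'⟩
    exact .inr ⟨subsingleton_of_nonempty, subsingleton_of_nonempty⟩

theorem exists_bornJordan_regularizing {d : ℕ} {s : ℝ} (hs : 1 / 2 ≤ s)
    (a : GelfandShilovSigma s (Fin d ⊕ Fin d)) :
    ∃ T : StrongDual ℂ (GelfandShilovSigma s (Fin d)) →L[ℂ] GelfandShilovSigma s (Fin d),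
      (∀ (f : GelfandShilovSigma s (Fin d)) x, T f.toDual x = bornJordanOp a f x) ∧
      ∀ T' : StrongDual ℂ (GelfandShilovSigma s (Fin d)) → GelfandShilovSigma s (Fin d),
        Continuous T' →
        (∀ (f : GelfandShilovSigma s (Fin d)) x, T' f.toDual x = bornJordanOp a f x) →
        ∀ u, T' u = T u := by
  rcases exists_isTestSpace_or_subsingleton d hs with ⟨s', hs', hE, hE'⟩ | ⟨_, _⟩
  · exact IsTestSpace.exists_bornJordan_regularizing (isWeightClass_beurlingClass hs') hE hE'
      toDual (fun _ _ => rfl) a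
  · refine ⟨0, fun f x => ?_, fun _ _ _ _ => Subsingleton.elim _ _⟩
    rw [Subsingleton.elim f 0]
    exact (bornJordanOp_zero_right a x).symm

theorem exists_bornJordan_quantization {d : ℕ} {s : ℝ} (hs : 1 / 2 ≤ s) :
    ∃ T : StrongDual ℂ (GelfandShilovSigma s (Fin d ⊕ Fin d)) →L[ℂ]
        GelfandShilovSigma s (Fin d) →L[ℂ] StrongDual ℂ (GelfandShilovSigma s (Fin d)),
      (∀ (a : GelfandShilovSigma s (Fin d ⊕ Fin d)) (f g : GelfandShilovSigma s (Fin d)),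
        T a.toDual f g = ∫ x, bornJordanOp a f x * g x) ∧
      ∀ T' : StrongDual ℂ (GelfandShilovSigma s (Fin d ⊕ Fin d)) →
          GelfandShilovSigma s (Fin d) →L[ℂ] StrongDual ℂ (GelfandShilovSigma s (Fin d)),
        (∀ f g, Continuous fun u => T' u f g) →
        (∀ (a : GelfandShilovSigma s (Fin d ⊕ Fin d)) (f g : GelfandShilovSigma s (Fin d)),
          T' a.toDual f g = ∫ x, bornJordanOp a f x * g x) → ∀ u, T' u = T u := by
  rcases exists_isTestSpace_or_subsingleton d hs with ⟨s', hs', hE, hE'⟩ | ⟨_, _⟩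
  · exact IsTestSpace.exists_bornJordan_quantization (isWeightClass_beurlingClass hs') hE hE'
      toDual (fun _ _ => rfl)
  · refine ⟨0, fun a f g => ?_, fun T' _ _ u => ContinuousLinearMap.ext fun f => ?_⟩
    · rw [Subsingleton.elim f 0]
      have h : ∀ x, bornJordanOp a (0 : GelfandShilovSigma s (Fin d)) x = 0 :=
        bornJordanOp_zero_right a
      simp [h]
    · rw [Subsingleton.elim f 0, map_zero, map_zero]

end GelfandShilovSigma

end

/-! ### The theorem for the three families of spaces -/

theorem mainTheorem9 (d : ℕ) (s : ℝ) (hs : 1 / 2 ≤ s) :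
    -- the spaces `𝒮_s` and `𝒮_s'`
    ((∀ a : GelfandShilov s (Fin d ⊕ Fin d),
        ∃ T : StrongDual ℂ (GelfandShilov s (Fin d)) →L[ℂ] GelfandShilov s (Fin d),
          (∀ (f : GelfandShilov s (Fin d)) x, T f.toDual x = bornJordanOp a f x) ∧
          ∀ T' : StrongDual ℂ (GelfandShilov s (Fin d)) → GelfandShilov s (Fin d),
            Continuous T' → (∀ (f : GelfandShilov s (Fin d)) x, T' f.toDual x = bornJordanOp a f x) → ∀ u, T' u = T u) ∧
      ∃ T : StrongDual ℂ (GelfandShilov s (Fin d ⊕ Fin d)) →L[ℂ]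
          GelfandShilov s (Fin d) →L[ℂ] StrongDual ℂ (GelfandShilov s (Fin d)),
        (∀ (a : GelfandShilov s (Fin d ⊕ Fin d)) (f g : GelfandShilov s (Fin d)),
          T a.toDual f g = ∫ x, bornJordanOp a f x * g x) ∧
        ∀ T' : StrongDual ℂ (GelfandShilov s (Fin d ⊕ Fin d)) →
            GelfandShilov s (Fin d) →L[ℂ] StrongDual ℂ (GelfandShilov s (Fin d)),
          (∀ f g, Continuous fun u => T' u f g) →
          (∀ (a : GelfandShilov s (Fin d ⊕ Fin d)) (f g : GelfandShilov s (Fin d)),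
            T' a.toDual f g = ∫ x, bornJordanOp a f x * g x) → ∀ u, T' u = T u) ∧
    -- the spaces `Σ_s` and `Σ_s'`
    ((∀ a : GelfandShilovSigma s (Fin d ⊕ Fin d),
        ∃ T : StrongDual ℂ (GelfandShilovSigma s (Fin d)) →L[ℂ] GelfandShilovSigma s (Fin d),
          (∀ (f : GelfandShilovSigma s (Fin d)) x, T f.toDual x = bornJordanOp a f x) ∧
          ∀ T' : StrongDual ℂ (GelfandShilovSigma s (Fin d)) → GelfandShilovSigma s (Fin d),
            Continuous T' → (∀ (f : GelfandShilovSigma s (Fin d)) x, T' f.toDual x = bornJordanOp a f x) → ∀ u, T' u = T u) ∧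
      ∃ T : StrongDual ℂ (GelfandShilovSigma s (Fin d ⊕ Fin d)) →L[ℂ]
          GelfandShilovSigma s (Fin d) →L[ℂ] StrongDual ℂ (GelfandShilovSigma s (Fin d)),
        (∀ (a : GelfandShilovSigma s (Fin d ⊕ Fin d)) (f g : GelfandShilovSigma s (Fin d)),
          T a.toDual f g = ∫ x, bornJordanOp a f x * g x) ∧
        ∀ T' : StrongDual ℂ (GelfandShilovSigma s (Fin d ⊕ Fin d)) →
            GelfandShilovSigma s (Fin d) →L[ℂ] StrongDual ℂ (GelfandShilovSigma s (Fin d)),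
          (∀ f g, Continuous fun u => T' u f g) →
          (∀ (a : GelfandShilovSigma s (Fin d ⊕ Fin d)) (f g : GelfandShilovSigma s (Fin d)),
            T' a.toDual f g = ∫ x, bornJordanOp a f x * g x) → ∀ u, T' u = T u) ∧
    -- the spaces `𝒮` and `𝒮'`
    ((∀ a : 𝓢(EuclideanSpace ℝ (Fin d ⊕ Fin d), ℂ),
        ∃ T : StrongDual ℂ 𝓢(EuclideanSpace ℝ (Fin d), ℂ) →L[ℂ] 𝓢(EuclideanSpace ℝ (Fin d), ℂ),
          (∀ f x, T (schwartzToDual f) x = bornJordanOp a f x) ∧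
          ∀ T' : StrongDual ℂ 𝓢(EuclideanSpace ℝ (Fin d), ℂ) → 𝓢(EuclideanSpace ℝ (Fin d), ℂ),
            Continuous T' → (∀ f x, T' (schwartzToDual f) x = bornJordanOp a f x) → ∀ u, T' u = T u) ∧
      ∃ T : StrongDual ℂ 𝓢(EuclideanSpace ℝ (Fin d ⊕ Fin d), ℂ) →L[ℂ]
          𝓢(EuclideanSpace ℝ (Fin d), ℂ) →L[ℂ] StrongDual ℂ 𝓢(EuclideanSpace ℝ (Fin d), ℂ),
        (∀ a f g, T (schwartzToDual a) f g = ∫ x, bornJordanOp a f x * g x) ∧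
        ∀ T' : StrongDual ℂ 𝓢(EuclideanSpace ℝ (Fin d ⊕ Fin d), ℂ) →
            𝓢(EuclideanSpace ℝ (Fin d), ℂ) →L[ℂ] StrongDual ℂ 𝓢(EuclideanSpace ℝ (Fin d), ℂ),
          (∀ f g, Continuous fun u => T' u f g) →
          (∀ a f g, T' (schwartzToDual a) f g = ∫ x, bornJordanOp a f x * g x) → ∀ u, T' u = T u) := by
  refine ⟨⟨fun a => ?_, ?_⟩, ⟨GelfandShilovSigma.exists_bornJordan_regularizing hs,
    GelfandShilovSigma.exists_bornJordan_quantization hs⟩, ⟨fun a => ?_, ?_⟩⟩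
  · exact IsTestSpace.exists_bornJordan_regularizing
      (isWeightClass_roumieuClass (by linarith)) (GelfandShilov.isTestSpace hs)
      (GelfandShilov.isTestSpace hs) GelfandShilov.toDual (fun _ _ => rfl) a
  · exact IsTestSpace.exists_bornJordan_quantization
      (isWeightClass_roumieuClass (by linarith)) (GelfandShilov.isTestSpace hs)
      (GelfandShilov.isTestSpace hs) GelfandShilov.toDual (fun _ _ => rfl)
  · exact IsTestSpace.exists_bornJordan_regularizing isWeightClass_univ
      isTestSpace_schwartz isTestSpace_schwartz schwartzToDual schwartzToDual_apply a
  · exact IsTestSpace.exists_bornJordan_quantization isWeightClass_univ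
      isTestSpace_schwartz isTestSpace_schwartz schwartzToDual schwartzToDual_apply
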